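/- **Setting.** Let $\lambda>0$, let $e_1,\dots,e_d>0$ be pairwise distinct with multiplicities $r_k\in\{1,2,\dots\}$, $N=\sum_k r_k$, and let $$R(z)=z-\frac{\lambda}{N}\sum_{k=1}^d\frac{\varrho_k}{\varepsilon_k+z},\qquad R(\varepsilon_k)=e_k,\quad \varrho_kR'(\varepsilon_k)=r_k,$$ where $(\varepsilon_k,\varrho_k)$ is a solution with $\varepsilon_k,\varrho_k>0$. Write $v\in\{w,\hat w^1,\dots,\hat w^d\}$ for the solutions of $R(v)=R(w)$, $\{0,\pm\alpha_1,\dots,\pm\alpha_d\}$ for the $2d+1$ distinct solutions of $R(v)=R(-v)$, and assume that $R$ has $2d$ distinct (hence simple) ramification points $\beta_1,\dots,\beta_{2d}\in\mathbb C$, $R'(\beta_i)=0$. Put $x(z)=R(z)$, $y(z)=-R(-z)$, $$\omega_{0,1}(z)=y(z)\,dx(z),\qquad \omega_{0,2}(u,z)=\frac{du\,dz}{(u-z)^2}+\frac{du\,dz}{(u+z)^2}=\Omega_2^{(0)}(u,z)R'(u)R'(z)\,du\,dz,$$ $$\mathcal G^{(0)}(z,w)=\frac{1-\frac{\lambda}{N}\sum_{k=1}^d\frac{r_k}{(R(z)-R(\varepsilon_k))(R(\varepsilon_k)-R(-w))}\prod_{j=1}^d\frac{R(w)-R(-\widehat{\varepsilon_k}^j)}{R(w)-R(\varepsilon_j)}}{R(w)-R(-z)}$$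 (extended by continuity to removable singularities), $\mathfrak G_0(z)=\operatorname{Res}_{v\to -z}\mathcal G^{(0)}(z,v)\,dv$, and assume $\mathfrak G_0(\beta_i)\ne0$ for all $i$. Moreover let $$\mathcal T^{(0)}(u\|z,w|)=\lambda\,\mathcal G^{(0)}(z,w)\operatorname*{Res}_{t\to z,\,-\hat w^j}\frac{R'(t)\,dt}{(R(z)-R(t))(R(w)-R(-t))\mathcal G^{(0)}(t,w)}\Big[\Omega^{(0)}_2(u,t)\mathcal G^{(0)}(t,w)+\frac{\partial}{\partial R(u)}\frac{\mathcal G^{(0)}(u,w)}{R(u)-R(t)}\Big],$$ $$\mathcal G^{(0)}(z|w)=\frac{\lambda\prod_{j}\frac{R(z)-R(\alpha_j)}{R(z)-R(\varepsilon_j)}}{R(z)-R(-z)}\operatorname*{Res}_{t\to z,\,\alpha_j}\frac{R'(t)\,dt\prod_k(R(t)-R(\varepsilon_k))}{(R(z)-R(t))\prod_k(R(t)-R(\alpha_k))}\cdot\frac{\mathcal G^{(0)}(t,w)-\mathcal G^{(0)}(w,w)}{R(w)-R(t)},$$ where $\operatorname{Res}_{t\to a,b_j}$ denotes the sum of the residues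 at the listed points and $\frac{\partial}{\partial R(u)}=\frac1{R'(u)}\frac{\partial}{\partial u}$. Define $\mathfrak t_{0,1}(u\|z,w|)=\lambda^{-1}\mathcal T^{(0)}(u\|z,w|)R'(u)\,du$, $\mathfrak t_{0,0}(z|w)=\lambda^{-1}\mathcal G^{(0)}(z|w)$, and the one-form $\omega_{1,1}$ by the residue formula $$\omega_{1,1}(z)=\operatorname*{Res}_{q\to0,\,\beta_i}\frac{dz}{(q-z)\mathfrak G_0(q)}\Big[\frac{\lambda}{N}\sum_{n=1}^d\frac{r_n\,\mathfrak t_{0,1}(q\|q,\varepsilon_n|)}{R'(q)(R(\varepsilon_n)-R(-q))}+\frac{\lambda}{N}\sum_{n=1}^d\frac{r_n\,\mathfrak t_{0,0}(q|\varepsilon_n)\,dq}{(R(\varepsilon_n)-R(q))(R(\varepsilon_n)-R(-q))}-\mathfrak t_{0,0}(q|q)\,dq\Big].$$ Let $\mathcal P_z\omega_{1,1}$ be the sum of the residues at $q\to\beta_1,\dots,\beta_{2d}$ and $\mathcal H_z\omega_{1,1}$ the residue at $q\to0$, so that $\omega_{1,1}=\mathcal P_z\omega_{1,1}+\mathcal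 H_z\omega_{1,1}$. **Proposition.** With $x_{n,i}=\frac{R^{(n+2)}(\beta_i)}{R''(\beta_i)}$ and $y_{n,i}=(-1)^n\frac{R^{(n+1)}(-\beta_i)}{R'(-\beta_i)}$ one has $$\mathcal P_z\omega_{1,1}(z)=\sum_{i=1}^{2d}\frac{dz}{R'(-\beta_i)R''(\beta_i)}\Big\{-\frac{1}{8(z-\beta_i)^4}+\frac{x_{1,i}}{24(z-\beta_i)^3}+\frac{1}{(z-\beta_i)^2}\Big(\frac{x_{2,i}}{48}-\frac{x_{1,i}^2}{48}-\frac{x_{1,i}y_{1,i}}{48}+\frac{y_{2,i}}{48}-\frac{1}{8\beta_i^2}\Big)\Big\},$$ $$\mathcal H_z\omega_{1,1}(z)=-\frac{dz}{8(R'(0))^2z^3}+\frac{R''(0)\,dz}{16(R'(0))^3z^2}.$$ Moreover, for every $i$ and the local Galois involution $\sigma_i$ of $R$ near $\beta_i$ (analytic, $\sigma_i(\beta_i)=\beta_i$, $R\circ\sigma_i=R$, $\sigma_i\neq\mathrm{id}$), $\omega_{1,1}$ satisfies the linear loop equation $$\omega_{1,1}(z)+\omega_{1,1}(\sigma_i(z))=\mathcal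 O(z-\beta_i)\,dz$$ and the quadratic loop equation $$\omega_{0,2}(z,\sigma_i(z))+\omega_{0,1}(z)\,\omega_{1,1}(\sigma_i(z))+\omega_{1,1}(z)\,\omega_{0,1}(\sigma_i(z))=\mathcal O((z-\beta_i)^2)(dz)^2,$$ where the left-hand sides extend holomorphically to $\beta_i$ with at least a simple, respectively double, zero there. -/

import Mathlib

open Filter Topology Complex
open scoped BigOperators

noncomputable section

namespace QuarticKontsevich

/-- The residue of `f` at `a`: the limit of `(2πi)⁻¹ ∮ f` over circles shrinking to `a`
(for `f` meromorphic at `a` the integral does not depend on the small radius). -/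
def residue (f : ℂ → ℂ) (a : ℂ) : ℂ :=
  limUnder (𝓝[>] (0 : ℝ)) fun s => (2 * Real.pi * I)⁻¹ * ∮ z in C(a, s), f z

/-- `R(z) = z - (lam/N) ∑ₖ ρₖ / (εₖ + z)`, with simple poles in `z = -εₖ` (and in `∞`). -/
def cover {d : ℕ} (lam : ℝ) (N : ℕ) (ε ρ : Fin d → ℝ) (z : ℂ) : ℂ :=
  z - (lam / N : ℂ) * ∑ k, (ρ k : ℂ) / (ε k + z)

/-- The parameters of the model: coupling constant `lam > 0`, pairwise distinct `eₖ > 0`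
with multiplicities `rₖ ≥ 1`, where `N = ∑ rₖ`, and the positive solution `(εₖ, ρₖ)` of the
implicit system `R(εₖ) = eₖ`, `ρₖ R'(εₖ) = rₖ`. -/
structure Model (d : ℕ) where
  lam : ℝ
  r : Fin d → ℕ
  e : Fin d → ℝ
  ε : Fin d → ℝ
  ρ : Fin d → ℝ
  lam_pos : 0 < lam
  r_pos : ∀ k, 0 < r k
  e_pos : ∀ k, 0 < e k
  e_injective : Function.Injective e
  ε_pos : ∀ k, 0 < ε k
  ρ_pos : ∀ k, 0 < ρ k
  cover_eq : ∀ k, cover lam (∑ j, r j) ε ρ (ε k) = e k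
  deriv_cover_eq : ∀ k, (ρ k : ℂ) * deriv (cover lam (∑ j, r j) ε ρ) (ε k) = r k

namespace Model

variable {d : ℕ} (M : Model d)

def N : ℕ := ∑ k, M.r k

/-- The ramified covering `R`; also written `x`. -/
def R (z : ℂ) : ℂ := cover M.lam M.N M.ε M.ρ z

/-- The finite poles of `R`. -/
def IsPole (z : ℂ) : Prop := ∃ k, z = -(M.ε k : ℂ)

/-- The preimages `ŵʲ` of `R(w)` under `R` other than `w` itself. They are needed for
`w = εₖ`, where there are exactly `d` of them, all simple. -/
def otherPreimages (w : ℂ) : Set ℂ := {v | ¬ M.IsPole v ∧ M.R v = M.R w ∧ v ≠ w}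

/-! ### The planar two-point function -/

/-- The explicit formula for `𝒢⁽⁰⁾(z,w)`, to be used where no denominator vanishes. -/
def twoPointFormula (p : ℂ × ℂ) : ℂ :=
  (1 - (M.lam / M.N : ℂ) * ∑ k, (M.r k : ℂ) /
      ((M.R p.1 - M.R (M.ε k)) * (M.R (M.ε k) - M.R (-p.2))) *
      ((∏ᶠ v ∈ M.otherPreimages (M.ε k), (M.R p.2 - M.R (-v))) /
        ∏ j, (M.R p.2 - M.R (M.ε j)))) /
    (M.R p.2 - M.R (-p.1))

/-- The dense open set of pairs `(z,w)` where nothing in the formula for `𝒢⁽⁰⁾(z,w)` is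
singular: no argument of `R` is a pole of `R`, and no denominator vanishes. -/
def twoPointDomain : Set (ℂ × ℂ) :=
  {p | ¬ M.IsPole p.1 ∧ ¬ M.IsPole (-p.1) ∧ ¬ M.IsPole p.2 ∧ ¬ M.IsPole (-p.2) ∧
    (∀ k, M.R p.1 ≠ M.R (M.ε k)) ∧ (∀ k, M.R p.2 ≠ M.R (M.ε k)) ∧
    (∀ k, M.R (M.ε k) ≠ M.R (-p.2)) ∧ M.R p.2 ≠ M.R (-p.1)}

/-- The planar two-point function `𝒢⁽⁰⁾(z,w)`: the explicit rational function, extended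
to its removable singularities (such as `z = εₖ` or `w = εₖ`) by continuity. -/
def G (z w : ℂ) : ℂ := extendFrom M.twoPointDomain M.twoPointFormula (z, w)

/-- `𝔊₀(z) = Res_{v → -z} 𝒢⁽⁰⁾(z,v) dv`. -/
def G₀ (z : ℂ) : ℂ := residue (fun v => M.G z v) (-z)

/-! ### Differentials of low degree (as coefficients of `dz`, `du dz`) -/

/-- `y(z) = -R(-z)`. -/
def y (z : ℂ) : ℂ := -M.R (-z)

/-- `ω_{0,1}(z) = y(z) dx(z) = -R(-z) R'(z) dz`. -/
def ω₀₁ (z : ℂ) : ℂ := M.y z * deriv M.R z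

/-- `ω_{0,2}(u,z) = du dz / (u-z)² + du dz / (u+z)²`. -/
def ω₀₂ (u z : ℂ) : ℂ := 1 / (u - z) ^ 2 + 1 / (u + z) ^ 2

/-- `Ω⁽⁰⁾₂(u,z)`, so that `ω_{0,2}(u,z) = Ω⁽⁰⁾₂(u,z) R'(u) R'(z) du dz`. -/
def Ω₂ (u z : ℂ) : ℂ := 1 / (deriv M.R u * deriv M.R z) * ω₀₂ u z

/-! ### The planar functions with one marked point, or with two boundaries -/

/-- The form (coefficient of `dt`) whose residues give `𝒯⁽⁰⁾(u‖z,w|)`; the derivative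
`∂/∂R(u)` is `R'(u)⁻¹ ∂/∂u`. -/
def markedIntegrand (u z w t : ℂ) : ℂ :=
  deriv M.R t / ((M.R z - M.R t) * (M.R w - M.R (-t)) * M.G t w) *
    (M.Ω₂ u t * M.G t w +
      deriv (fun u' => M.G u' w / (M.R u' - M.R t)) u / deriv M.R u)

/-- The generalised two-point function `𝒯⁽⁰⁾(u‖z,w|)`, through residues at `t → z` and
`t → -ŵʲ`. -/
def T (u z w : ℂ) : ℂ :=
  M.lam * M.G z w *
    (residue (M.markedIntegrand u z w) z +
      ∑ᶠ v ∈ M.otherPreimages w, residue (M.markedIntegrand u z w) (-v))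

/-- `0, ±α₁, …, ±α_d` are the `2d+1` distinct solutions of `R(v) = R(-v)`. -/
def IsFixedPointFamily (α : Fin d → ℂ) : Prop :=
  Function.Injective α ∧ (∀ j k, α j ≠ -α k) ∧
    ∀ j, ¬ M.IsPole (α j) ∧ ¬ M.IsPole (-α j) ∧ M.R (α j) = M.R (-α j)

/-- The form (coefficient of `dt`) whose residues give `𝒢⁽⁰⁾(z|w)`. -/
def twoBoundaryIntegrand (α : Fin d → ℂ) (z w t : ℂ) : ℂ :=
  deriv M.R t * (∏ k, (M.R t - M.R (M.ε k))) /
      ((M.R z - M.R t) * ∏ k, (M.R t - M.R (α k))) *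
    ((M.G t w - M.G w w) / (M.R w - M.R t))

/-- The planar `(1+1)`-point function `𝒢⁽⁰⁾(z|w)`, through residues at `t → z` and
`t → αⱼ`. -/
def G₁₁ (α : Fin d → ℂ) (z w : ℂ) : ℂ :=
  M.lam * (∏ j, (M.R z - M.R (α j)) / (M.R z - M.R (M.ε j))) / (M.R z - M.R (-z)) *
    (residue (M.twoBoundaryIntegrand α z w) z +
      ∑ j, residue (M.twoBoundaryIntegrand α z w) (α j))

/-! ### The form `ω_{1,1}` -/

/-- `𝔱_{0,1}(u‖z,w|) = lam⁻¹ 𝒯⁽⁰⁾(u‖z,w|) R'(u) du`. -/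
def t₀₁ (u z w : ℂ) : ℂ := (M.lam : ℂ)⁻¹ * M.T u z w * deriv M.R u

/-- `𝔱_{0,0}(z|w) = lam⁻¹ 𝒢⁽⁰⁾(z|w)`. -/
def t₀₀ (α : Fin d → ℂ) (z w : ℂ) : ℂ := (M.lam : ℂ)⁻¹ * M.G₁₁ α z w

/-- The form `[…]` (coefficient of `dq`) in the residue formula for `ω_{1,1}`. -/
def bracket (α : Fin d → ℂ) (q : ℂ) : ℂ :=
  (M.lam / M.N : ℂ) * ∑ n, (M.r n : ℂ) * M.t₀₁ q q (M.ε n) /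
      (deriv M.R q * (M.R (M.ε n) - M.R (-q))) +
    (M.lam / M.N : ℂ) * ∑ n, (M.r n : ℂ) * M.t₀₀ α q (M.ε n) /
      ((M.R (M.ε n) - M.R q) * (M.R (M.ε n) - M.R (-q))) -
    M.t₀₀ α q q

/-- `Res_{q → p} dz / ((q - z) 𝔊₀(q)) […]`, as coefficient of `dz`. -/
def contribution (α : Fin d → ℂ) (p z : ℂ) : ℂ :=
  residue (fun q => 1 / ((q - z) * M.G₀ q) * M.bracket α q) p

/-- `β₁, …, β_{2d}` are `2d` distinct zeros of `R'`. As `R'` has `2d` zeros with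
multiplicity, these are all ramification points in `ℂ`, and all of them are simple. -/
def IsRamificationFamily (β : Fin (2 * d) → ℂ) : Prop :=
  Function.Injective β ∧ ∀ i, ¬ M.IsPole (β i) ∧ deriv M.R (β i) = 0

/-- The polar part `𝒫_z ω_{1,1}`. -/
def polarPart (α : Fin d → ℂ) (β : Fin (2 * d) → ℂ) (z : ℂ) : ℂ :=
  ∑ i, M.contribution α (β i) z

/-- The part `ℋ_z ω_{1,1}` holomorphic at the ramification points. -/
def holomorphicPart (α : Fin d → ℂ) (z : ℂ) : ℂ := M.contribution α 0 z

/-- `ω_{1,1}`, given by the residue formula with residues at `q → 0, βᵢ`. -/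
def ω₁₁ (α : Fin d → ℂ) (β : Fin (2 * d) → ℂ) (z : ℂ) : ℂ :=
  M.polarPart α β z + M.holomorphicPart α z

/-- `x_{n} = R⁽ⁿ⁺²⁾(b) / R''(b)` at a ramification point `b`. -/
def xCoeff (n : ℕ) (b : ℂ) : ℂ := iteratedDeriv (n + 2) M.R b / iteratedDeriv 2 M.R b

/-- `y_{n} = (-1)ⁿ R⁽ⁿ⁺¹⁾(-b) / R'(-b)` at a ramification point `b`. -/
def yCoeff (n : ℕ) (b : ℂ) : ℂ :=
  (-1) ^ n * iteratedDeriv (n + 1) M.R (-b) / deriv M.R (-b)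

end Model

/-! ### Loop equations -/

/-- `σ` is a local Galois involution of `x` at `b`. -/
def IsLocalGaloisInvolution (x : ℂ → ℂ) (b : ℂ) (σ : ℂ → ℂ) : Prop :=
  AnalyticAt ℂ σ b ∧ σ b = b ∧ (∀ᶠ z in 𝓝 b, x (σ z) = x z) ∧ ¬ ∀ᶠ z in 𝓝 b, σ z = z

/-- The linear loop equation `ω(z) + ω(σ(z)) = 𝒪(z - b) dz` for a one-form `ω = f dz`;
here `ω(σ(z)) = f(σ(z)) σ'(z) dz`. -/
def LinearLoopEquation (f : ℂ → ℂ) (b : ℂ) (σ : ℂ → ℂ) : Prop :=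
  ∃ h : ℂ → ℂ, AnalyticAt ℂ h b ∧
    ∀ᶠ z in 𝓝[≠] b, f z + f (σ z) * deriv σ z = (z - b) * h z

/-- The quadratic loop equation for `(g,m) = (1,1)`,
`ω_{0,2}(z,σ(z)) + ω_{0,1}(z) ω_{1,1}(σ(z)) + ω_{1,1}(z) ω_{0,1}(σ(z)) = 𝒪((z-b)²) (dz)²`,
where `f₀₁`, `f₀₂`, `f₁₁` are the coefficients of the forms. -/
def QuadraticLoopEquation (f₀₁ : ℂ → ℂ) (f₀₂ : ℂ → ℂ → ℂ) (f₁₁ : ℂ → ℂ) (b : ℂ)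
    (σ : ℂ → ℂ) : Prop :=
  ∃ h : ℂ → ℂ, AnalyticAt ℂ h b ∧
    ∀ᶠ z in 𝓝[≠] b,
      f₀₂ z (σ z) * deriv σ z + f₀₁ z * (f₁₁ (σ z) * deriv σ z) +
        f₁₁ z * (f₀₁ (σ z) * deriv σ z) = (z - b) ^ 2 * h z

end QuarticKontsevich

end

/-!
The integrand of the residue formula for `ω_{1,1}` is a bracket `B(q)` divided by `𝔊₀(q)`. The
residue formula projects `B / 𝔊₀` to its principal parts at the ramification points `β` and at
the origin, so the task is to find these principal parts.

*The planar functions.* The two-point function has the form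
`𝒢⁽⁰⁾(z,w) = P(R(z),R(w)) / ((R(z) - R(-w)) (R(w) - R(-z)))` with a symmetric rational function
`P`; the symmetry is `r_mul_H`. Liouville's theorem gives `P(R(z),R(-z)) = 0` (`P_R_R_neg`) and,
as the values `R(αⱼ)` in the fixed points of the reflection are double zeros of the diagonal,
`P(y,y) = 2 (y - R(0)) S(y)²` (`P_diag`). Hence `𝔊₀(q) R'(q)` is the value of `∂₁P` in
`(R(-q),R(q))` (`G₀_mul_U`). By the residue theorem, `𝔱_{0,1}(q‖q,εₙ|)` reduces to residues of
`ω_{0,2}(q,t) / ((R(q) - R(t)) (eₙ - R(-t)))` at `t = q` and at the points `t = -v`, where `v ≠ εₙ`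
is a preimage of `eₙ` (`t₀₁_eq`), and the functions with two boundaries have a closed form (`C_eq`).

*The collected form.* Summed with the weights of the bracket, the forms above give a single
meromorphic form `J q` in `t`, so that `R'(q) B(q)` is the residue of `J q` at `t = q` plus the
contribution `V q` of the points `-v` plus `R'(q) C(q)` (`bracket_eq`).

*Ramification points.* As `q → β`, the poles of `J q` in `q` and in the other preimage `σ(q)`
merge, so the sum of the two residues converges to the residue of `J β` in `β`
(`tendsto_add_residue`). The residue in `σ(q)` is `-𝔊₀(q) R'(q) F(q)` with
`F(z) = ω_{0,2}(z,σ(z)) / (R'(σ(z)) (R(-z) - R(-σ(z))))` (`residue_J_sheet`). Therefore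
`R'(q) (B(q) - 𝔊₀(q) F(q))` converges to the sum of all residues of `J β`: the limit of
`R'(q) C(q)` is the residue in `-β`. The residue theorem (`Ram.sum_residue`) shows that this limit
is zero, and `B / 𝔊₀ - F` is regular at `β` (`IsSheet.regularAt_bracket`).

*The origin.* The same argument with the merging poles `q` and `-q` shows that `B / 𝔊₀` has the
principal part of an explicit function `E` (`regularAt_bracket_zero`).

*Conclusion.* The principal parts of `F` and `E` are found by Taylor expansion; the coefficient of
the simple pole vanishes by symmetry (`IsSheet.hasPolar_F`, `hasPolar_E`). Near `β`, `ω_{1,1}` is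
`-F` plus a holomorphic form. The one-form `F` is odd under `σ`, which is the linear loop equation,
and it is made such that it cancels `ω_{0,2}(z,σ(z))` in the quadratic one.
-/


noncomputable section

namespace QuarticKontsevich

/-! ### Residues and principal parts -/

/-- A function is *regular* at `a` if near `a`, except possibly in `a`, it agrees with an
analytic function, i.e. if it has at most a removable singularity there. -/
def RegularAt (f : ℂ → ℂ) (a : ℂ) : Prop := ∃ g, AnalyticAt ℂ g a ∧ f =ᶠ[𝓝[≠] a] g

/-- The Laurent polynomial `∑ₖ cₖ / (z - a)ᵏ⁺¹`. -/
def polar (n : ℕ) (c : ℕ → ℂ) (a z : ℂ) : ℂ := ∑ k ∈ Finset.range n, c k / (z - a) ^ (k + 1)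

/-- `polar n c a` is the principal part of `f` at `a`. -/
def HasPolar (f : ℂ → ℂ) (a : ℂ) (n : ℕ) (c : ℕ → ℂ) : Prop :=
  RegularAt (fun z => f z - polar n c a z) a

lemma AnalyticAt.regularAt {f : ℂ → ℂ} {a : ℂ} (h : AnalyticAt ℂ f a) : RegularAt f a :=
  ⟨f, h, EventuallyEq.rfl⟩

namespace RegularAt

variable {f g : ℂ → ℂ} {a : ℂ}

lemma congr (hf : RegularAt f a) (h : g =ᶠ[𝓝[≠] a] f) : RegularAt g a := by
  obtain ⟨k, hk, e⟩ := hf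
  exact ⟨k, hk, h.trans e⟩

lemma add (hf : RegularAt f a) (hg : RegularAt g a) : RegularAt (fun z => f z + g z) a := by
  obtain ⟨k, hk, e⟩ := hf
  obtain ⟨l, hl, e'⟩ := hg
  exact ⟨_, hk.add hl, e.add e'⟩

lemma sub (hf : RegularAt f a) (hg : RegularAt g a) : RegularAt (fun z => f z - g z) a := by
  obtain ⟨k, hk, e⟩ := hf
  obtain ⟨l, hl, e'⟩ := hg
  exact ⟨_, hk.sub hl, e.sub e'⟩

lemma mul (hf : RegularAt f a) (hg : RegularAt g a) : RegularAt (fun z => f z * g z) a := by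
  obtain ⟨k, hk, e⟩ := hf
  obtain ⟨l, hl, e'⟩ := hg
  exact ⟨_, hk.mul hl, e.mul e'⟩

lemma const (c : ℂ) : RegularAt (fun _ => c) a := AnalyticAt.regularAt analyticAt_const

lemma sum {ι : Type*} {s : Finset ι} {F : ι → ℂ → ℂ} (h : ∀ i ∈ s, RegularAt (F i) a) :
    RegularAt (fun z => ∑ i ∈ s, F i z) a := by
  classical
  induction s using Finset.induction_on with
  | empty => simpa using const 0
  | insert i s hi ih =>
    simp only [Finset.sum_insert hi]
    exact (h i (by simp)).add (ih fun j hj => h j (by simp [hj]))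

lemma meromorphicAt (hf : RegularAt f a) : MeromorphicAt f a := by
  obtain ⟨k, hk, e⟩ := hf
  exact hk.meromorphicAt.congr e.symm

end RegularAt

/-- A meromorphic function that stays bounded has a removable singularity. -/
lemma regularAt_of_isBigO {f : ℂ → ℂ} {a : ℂ} (hf : MeromorphicAt f a)
    (hb : f =O[𝓝[≠] a] fun _ => (1 : ℂ)) : RegularAt f a := by
  have ho : 0 ≤ meromorphicOrderAt f a := by
    by_contra h
    have h1 := tendsto_cobounded_of_meromorphicOrderAt_neg (not_le.mp h)
    have h2 := (Asymptotics.isBigO_one_iff (F := ℂ)).mp hb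
    have h3 := tendsto_norm_cobounded_atTop.comp h1
    obtain ⟨C, hC⟩ := h2
    have h4 := h3.eventually_gt_atTop C
    have h5 : ∀ᶠ z in 𝓝[≠] a, False := by
      filter_upwards [h4, Filter.eventually_map.mp hC] with z hz hz'
      exact absurd hz (not_lt.mpr hz')
    exact (NeBot.ne (inferInstance : NeBot (𝓝[≠] a))) (Filter.eventually_false_iff_eq_bot.mp h5)
  by_cases ht : meromorphicOrderAt f a = ⊤
  · refine ⟨fun _ => 0, analyticAt_const, ?_⟩
    exact meromorphicOrderAt_eq_top_iff.mp ht
  · obtain ⟨g, hg, -, e⟩ := (meromorphicOrderAt_ne_top_iff hf).mp ht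
    lift meromorphicOrderAt f a to ℤ using ht with m hm
    have hm0 : 0 ≤ m := by exact_mod_cast ho
    lift m to ℕ using hm0
    refine ⟨fun z => (z - a) ^ m * g z, by fun_prop, ?_⟩
    filter_upwards [e] with z hz
    simpa using hz

lemma regularAt_of_tendsto {f : ℂ → ℂ} {a l : ℂ} (hf : MeromorphicAt f a)
    (hb : Tendsto f (𝓝[≠] a) (𝓝 l)) : RegularAt f a :=
  regularAt_of_isBigO hf (hb.isBigO_one ℂ)

/-- If `u` has a simple zero in `a` and `u f → 0`, then `f` has a removable singularity. -/
lemma regularAt_of_mul_tendsto_zero {f u : ℂ → ℂ} {a : ℂ} (hf : MeromorphicAt f a)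
    (hu : AnalyticAt ℂ u a) (hu0 : u a = 0) (hu' : deriv u a ≠ 0)
    (h : Tendsto (fun z => u z * f z) (𝓝[≠] a) (𝓝 0)) : RegularAt f a := by
  obtain ⟨g, hg, e⟩ := regularAt_of_tendsto (hu.meromorphicAt.mul hf) h
  have hga : g a = 0 := by
    have h1 : Tendsto g (𝓝[≠] a) (𝓝 (g a)) := hg.continuousAt.tendsto.mono_left nhdsWithin_le_nhds
    exact tendsto_nhds_unique (h1.congr' (e.symm)) h
  have hd : ∀ k : ℂ → ℂ, AnalyticAt ℂ k a → k a = 0 → AnalyticAt ℂ (dslope k a) a ∧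
      ∀ᶠ z in 𝓝[≠] a, k z = (z - a) * dslope k a z := by
    intro k hk hk0
    obtain ⟨p, hp⟩ := hk
    refine ⟨⟨_, hp.has_fpower_series_dslope_fslope⟩, ?_⟩
    filter_upwards [self_mem_nhdsWithin] with z hz
    have := sub_smul_dslope k a z
    simp only [smul_eq_mul, hk0, sub_zero] at this
    exact this.symm
  obtain ⟨hu1, hu2⟩ := hd u hu hu0
  obtain ⟨hg1, hg2⟩ := hd g hg hga
  have hne : dslope u a a ≠ 0 := by rwa [dslope_same]
  refine ⟨fun z => dslope g a z / dslope u a z, hg1.div hu1 hne, ?_⟩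
  have hne' : ∀ᶠ z in 𝓝[≠] a, dslope u a z ≠ 0 :=
    (hu1.continuousAt.eventually_ne hne).filter_mono nhdsWithin_le_nhds
  filter_upwards [e, hu2, hg2, hne', self_mem_nhdsWithin] with z h1 h2 h3 h4 h5
  have h5' : z - a ≠ 0 := sub_ne_zero.mpr h5
  simp only [Pi.mul_apply] at h1
  rw [h2, h3, mul_assoc] at h1
  rw [eq_div_iff h4]
  have := mul_left_cancel₀ h5' h1
  rw [← this]; ring

lemma hasPolar_div_pow (n : ℕ) : ∀ {h : ℂ → ℂ} {a : ℂ}, AnalyticAt ℂ h a →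
    ∃ c, HasPolar (fun z => h z / (z - a) ^ n) a n c := by
  induction n with
  | zero =>
    intro h a hh
    exact ⟨fun _ => 0, by simpa [HasPolar, polar] using AnalyticAt.regularAt hh⟩
  | succ n ih =>
    intro h a hh
    obtain ⟨p, hp⟩ := hh
    obtain ⟨c, hc⟩ := ih (h := dslope h a) ⟨_, hp.has_fpower_series_dslope_fslope⟩
    refine ⟨fun k => if k = n then h a else c k, ?_⟩
    refine RegularAt.congr hc ?_
    filter_upwards [self_mem_nhdsWithin] with z hz
    have hz' : z - a ≠ 0 := sub_ne_zero.mpr hz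
    have h1 := sub_smul_dslope h a z
    simp only [smul_eq_mul] at h1
    have h2 : ∑ k ∈ Finset.range n, (if k = n then h a else c k) / (z - a) ^ (k + 1) =
        ∑ k ∈ Finset.range n, c k / (z - a) ^ (k + 1) :=
      Finset.sum_congr rfl fun k hk => by
        rw [if_neg (Finset.mem_range.mp hk).ne]
    simp only [polar, Finset.sum_range_succ, h2, if_true]
    have h3 : h z = (z - a) * dslope h a z + h a := by rw [h1]; ring
    rw [h3]
    field_simp
    ring

lemma exists_hasPolar {f : ℂ → ℂ} {a : ℂ} (hf : MeromorphicAt f a) :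
    ∃ n c, HasPolar f a (n + 1) c := by
  obtain ⟨n, hn⟩ := hf
  obtain ⟨c, hc⟩ := hasPolar_div_pow (n + 1) (h := fun z => (z - a) * ((z - a) ^ n • f z))
    (a := a) (by fun_prop)
  refine ⟨n, c, hc.congr ?_⟩
  filter_upwards [self_mem_nhdsWithin] with z hz
  have hz' : z - a ≠ 0 := sub_ne_zero.mpr hz
  simp only [smul_eq_mul]
  congr 1
  field_simp
  ring

lemma continuousOn_polar (n : ℕ) (c : ℕ → ℂ) (a : ℂ) : ContinuousOn (polar n c a) {a}ᶜ := by
  intro z hz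
  have hz' : z - a ≠ 0 := sub_ne_zero.mpr hz
  apply ContinuousAt.continuousWithinAt
  unfold polar
  fun_prop (disch := first | exact pow_ne_zero _ hz')

lemma analyticAt_polar (n : ℕ) (c : ℕ → ℂ) {a z : ℂ} (hz : z ≠ a) :
    AnalyticAt ℂ (polar n c a) z := by
  have hz' : z - a ≠ 0 := sub_ne_zero.mpr hz
  unfold polar
  refine Finset.analyticAt_fun_sum _ fun k _ => ?_
  exact analyticAt_const.div (by fun_prop) (pow_ne_zero _ hz')

lemma integral_polar {n : ℕ} {c : ℕ → ℂ} {a b : ℂ} {r : ℝ} (ha : a ∈ Metric.ball b r) :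
    (∮ z in C(b, r), polar (n + 1) c a z) = 2 * Real.pi * I * c 0 := by
  have hr : 0 < r := (Metric.nonempty_ball.mp ⟨a, ha⟩)
  have hab : a ∉ Metric.sphere b |r| := by
    rw [abs_of_pos hr]
    intro h
    rw [Metric.mem_sphere] at h
    rw [Metric.mem_ball] at ha
    exact ha.ne h
  have hk : ∀ k, (fun z : ℂ => c k / (z - a) ^ (k + 1)) =
      fun z => c k * (z - a) ^ (-((k : ℤ) + 1)) := by
    intro k
    funext z
    rw [zpow_neg, div_eq_mul_inv]
    norm_cast
  have hint : ∀ k ∈ Finset.range (n + 1),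
      CircleIntegrable (fun z : ℂ => c k / (z - a) ^ (k + 1)) b r := by
    intro k _
    rw [hk k]
    exact ((circleIntegrable_sub_zpow_iff).mpr (Or.inr (Or.inr hab))).const_smul (a := c k)
  unfold polar
  rw [circleIntegral.integral_fun_sum hint, Finset.sum_range_succ', Finset.sum_eq_zero]
  · rw [zero_add]
    have : (fun z : ℂ => c 0 / (z - a) ^ (0 + 1)) = fun z => c 0 * (z - a)⁻¹ := by
      funext z; simp [div_eq_mul_inv]
    rw [this, circleIntegral.integral_const_mul, circleIntegral.integral_sub_inv_of_mem_ball ha]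
    ring
  · intro k _
    rw [hk (k + 1), circleIntegral.integral_const_mul,
      circleIntegral.integral_sub_zpow_of_ne (by push_cast; omega), mul_zero]

lemma circleIntegral_eq_zero {g : ℂ → ℂ} {b : ℂ} {r : ℝ} (hr : 0 ≤ r)
    (hg : ∀ z ∈ Metric.closedBall b r, AnalyticAt ℂ g z) : (∮ z in C(b, r), g z) = 0 :=
  circleIntegral_eq_zero_of_differentiable_on_off_countable hr Set.countable_empty
    (fun z hz => (hg z hz).continuousAt.continuousWithinAt)
    (fun z hz => (hg z (Metric.ball_subset_closedBall hz.1)).differentiableAt)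

/-- The residue is the coefficient of `(z - a)⁻¹` in the principal part. -/
lemma HasPolar.residue_eq {f : ℂ → ℂ} {a : ℂ} {n : ℕ} {c : ℕ → ℂ} (h : HasPolar f a (n + 1) c) :
    residue f a = c 0 := by
  obtain ⟨g, hg, e⟩ := h
  have h1 : ∀ᶠ z in 𝓝 a, AnalyticAt ℂ g z ∧ (z ≠ a → f z = polar (n + 1) c a z + g z) := by
    refine (hg.eventually_analyticAt).and ?_
    filter_upwards [eventually_nhdsWithin_iff.mp e] with z hz hza
    rw [← hz hza]; ring
  obtain ⟨δ, hδ, hball⟩ := Metric.eventually_nhds_iff_ball.mp h1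
  refine Tendsto.limUnder_eq ?_
  refine tendsto_const_nhds.congr' ?_
  filter_upwards [Ioo_mem_nhdsGT hδ] with s hs
  have hs0 : 0 < s := hs.1
  have hsub : Metric.closedBall a s ⊆ Metric.ball a δ := Metric.closedBall_subset_ball hs.2
  have hcongr : (∮ z in C(a, s), f z) = ∮ z in C(a, s), (polar (n + 1) c a z + g z) := by
    refine circleIntegral.integral_congr hs0.le fun z hz => ?_
    refine (hball z (hsub (Metric.sphere_subset_closedBall hz))).2 ?_
    rintro rfl
    simp [hs0.ne] at hz
  have hi1 : CircleIntegrable (polar (n + 1) c a) a s := by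
    refine ContinuousOn.circleIntegrable hs0.le ((continuousOn_polar _ c a).mono fun z hz => ?_)
    rintro rfl
    simp [hs0.ne] at hz
  have hi2 : CircleIntegrable g a s := by
    refine ContinuousOn.circleIntegrable hs0.le fun z hz => ?_
    exact (hball z (hsub (Metric.sphere_subset_closedBall hz))).1.continuousAt.continuousWithinAt
  rw [hcongr, circleIntegral.integral_add hi1 hi2, integral_polar (Metric.mem_ball_self hs0),
    circleIntegral_eq_zero hs0.le fun z hz => (hball z (hsub hz)).1]
  have : (2 * Real.pi * I : ℂ) ≠ 0 := two_pi_I_ne_zero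
  rw [add_zero, inv_mul_cancel_left₀ this]

lemma polar_add (n : ℕ) (c c' : ℕ → ℂ) (a z : ℂ) :
    polar n (fun k => c k + c' k) a z = polar n c a z + polar n c' a z := by
  simp [polar, add_div, Finset.sum_add_distrib]

lemma polar_smul (n : ℕ) (u : ℂ) (c : ℕ → ℂ) (a z : ℂ) :
    polar n (fun k => u * c k) a z = u * polar n c a z := by
  simp [polar, mul_div_assoc, Finset.mul_sum]

lemma polar_extend {n m : ℕ} (h : n ≤ m) (c : ℕ → ℂ) (a z : ℂ) :
    polar m (fun k => if k < n then c k else 0) a z = polar n c a z := by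
  simp only [polar]
  rw [← Finset.sum_subset (Finset.range_mono h)]
  · exact Finset.sum_congr rfl fun k hk => by rw [if_pos (Finset.mem_range.mp hk)]
  · intro k _ hk
    rw [if_neg (by simpa using hk), zero_div]

lemma HasPolar.congr {f g : ℂ → ℂ} {a : ℂ} {n : ℕ} {c : ℕ → ℂ} (h : HasPolar f a n c)
    (e : g =ᶠ[𝓝[≠] a] f) : HasPolar g a n c :=
  RegularAt.congr h (e.sub EventuallyEq.rfl)

lemma HasPolar.add {f g : ℂ → ℂ} {a : ℂ} {n : ℕ} {c c' : ℕ → ℂ} (h : HasPolar f a n c)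
    (h' : HasPolar g a n c') : HasPolar (fun z => f z + g z) a n (fun k => c k + c' k) := by
  refine RegularAt.congr (RegularAt.add h h') (Eventually.of_forall fun z => ?_)
  simp only [polar_add]; ring

lemma HasPolar.const_mul {f : ℂ → ℂ} {a : ℂ} {n : ℕ} {c : ℕ → ℂ} (h : HasPolar f a n c) (u : ℂ) :
    HasPolar (fun z => u * f z) a n (fun k => u * c k) := by
  refine RegularAt.congr ((RegularAt.const u).mul h) (Eventually.of_forall fun z => ?_)
  simp only [polar_smul]; ring

lemma HasPolar.extend {f : ℂ → ℂ} {a : ℂ} {n m : ℕ} {c : ℕ → ℂ} (h : HasPolar f a n c)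
    (hnm : n ≤ m) : HasPolar f a m (fun k => if k < n then c k else 0) := by
  refine RegularAt.congr h (Eventually.of_forall fun z => ?_)
  simp only [polar_extend hnm]

lemma RegularAt.hasPolar {f : ℂ → ℂ} {a : ℂ} (h : RegularAt f a) (n : ℕ) :
    HasPolar f a n (fun _ => 0) := by
  simpa [HasPolar, polar] using h

lemma residue_congr {f g : ℂ → ℂ} {a : ℂ} (hg : MeromorphicAt g a) (e : f =ᶠ[𝓝[≠] a] g) :
    residue f a = residue g a := by
  obtain ⟨n, c, h⟩ := exists_hasPolar hg
  rw [h.residue_eq, (h.congr e).residue_eq]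

lemma RegularAt.residue_eq {f : ℂ → ℂ} {a : ℂ} (h : RegularAt f a) : residue f a = 0 :=
  (h.hasPolar 1).residue_eq

lemma residue_add {f g : ℂ → ℂ} {a : ℂ} (hf : MeromorphicAt f a) (hg : MeromorphicAt g a) :
    residue (fun z => f z + g z) a = residue f a + residue g a := by
  obtain ⟨n, c, h⟩ := exists_hasPolar hf
  obtain ⟨m, c', h'⟩ := exists_hasPolar hg
  have := (h.extend (m := n + m + 1) (by omega)).add (h'.extend (m := n + m + 1) (by omega))
  rw [this.residue_eq, h.residue_eq, h'.residue_eq]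
  simp

lemma residue_const_mul {f : ℂ → ℂ} {a : ℂ} (hf : MeromorphicAt f a) (u : ℂ) :
    residue (fun z => u * f z) a = u * residue f a := by
  obtain ⟨n, c, h⟩ := exists_hasPolar hf
  rw [h.residue_eq, (h.const_mul u).residue_eq]

lemma residue_sum {ι : Type*} {s : Finset ι} {F : ι → ℂ → ℂ} {a : ℂ}
    (h : ∀ i ∈ s, MeromorphicAt (F i) a) :
    residue (fun z => ∑ i ∈ s, F i z) a = ∑ i ∈ s, residue (F i) a := by
  classical
  induction s using Finset.induction_on with
  | empty => simpa using (RegularAt.const (a := a) 0).residue_eq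
  | insert i s hi ih =>
    simp only [Finset.sum_insert hi]
    rw [residue_add (h i (by simp)) (MeromorphicAt.fun_sum fun j hj => h j (by simp [hj])),
      ih fun j hj => h j (by simp [hj])]

lemma HasPolar.of_div_pow_one {g : ℂ → ℂ} {a : ℂ} (hg : AnalyticAt ℂ g a) :
    HasPolar (fun z => g z / (z - a)) a 1 (fun _ => g a) := by
  obtain ⟨p, hp⟩ := hg
  refine ⟨dslope g a, ⟨_, hp.has_fpower_series_dslope_fslope⟩, ?_⟩
  filter_upwards [self_mem_nhdsWithin] with z hz
  have hz' : z - a ≠ 0 := sub_ne_zero.mpr hz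
  have h1 := sub_smul_dslope g a z
  simp only [smul_eq_mul] at h1
  simp only [polar, Finset.sum_range_one, zero_add, pow_one]
  rw [← sub_div, ← h1]
  field_simp

/-- Residue at a simple pole. -/
lemma residue_div_sub {g : ℂ → ℂ} {a : ℂ} (hg : AnalyticAt ℂ g a) :
    residue (fun z => g z / (z - a)) a = g a :=
  (HasPolar.of_div_pow_one hg).residue_eq

lemma HasPolar.of_div_pow_two {g : ℂ → ℂ} {a : ℂ} (hg : AnalyticAt ℂ g a) :
    HasPolar (fun z => g z / (z - a) ^ 2) a 2 (fun k => if k = 0 then deriv g a else g a) := by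
  obtain ⟨p, hp⟩ := hg
  have h := HasPolar.of_div_pow_one (g := dslope g a) (a := a)
    ⟨_, hp.has_fpower_series_dslope_fslope⟩
  refine RegularAt.congr h ?_
  filter_upwards [self_mem_nhdsWithin] with z hz
  have hz' : z - a ≠ 0 := sub_ne_zero.mpr hz
  have h1 := sub_smul_dslope g a z
  simp only [smul_eq_mul] at h1
  have h3 : g z = (z - a) * dslope g a z + g a := by rw [h1]; ring
  simp only [polar, Finset.sum_range_succ, Finset.range_zero, Finset.sum_empty, dslope_same]
  rw [h3]
  field_simp
  simp
  ring

/-- Residue at a double pole. -/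
lemma residue_div_sub_sq {g : ℂ → ℂ} {a : ℂ} (hg : AnalyticAt ℂ g a) :
    residue (fun z => g z / (z - a) ^ 2) a = deriv g a := by
  simpa using (HasPolar.of_div_pow_two hg).residue_eq

/-- A derivative of a meromorphic function has no residue. -/
lemma residue_deriv {f : ℂ → ℂ} {a : ℂ} (hf : MeromorphicAt f a) : residue (deriv f) a = 0 := by
  have h1 : ∀ᶠ z in 𝓝 a, z ≠ a → AnalyticAt ℂ f z :=
    eventually_nhdsWithin_iff.mp hf.eventually_analyticAt
  obtain ⟨δ, hδ, hball⟩ := Metric.eventually_nhds_iff_ball.mp h1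
  refine Tendsto.limUnder_eq ?_
  refine tendsto_const_nhds.congr' ?_
  filter_upwards [Ioo_mem_nhdsGT hδ] with s hs
  have hs0 : 0 < s := hs.1
  rw [circleIntegral.integral_eq_zero_of_hasDerivWithinAt hs0.le (f := f), mul_zero]
  intro z hz
  refine (HasDerivAt.hasDerivWithinAt ?_)
  refine (hball z ?_ ?_).differentiableAt.hasDerivAt
  · rw [Metric.mem_sphere] at hz
    rw [Metric.mem_ball, hz]
    exact hs.2
  · rintro rfl
    simp [hs0.ne] at hz

/-- Invariance of residues under a local change of coordinates. -/
lemma residue_comp {f φ : ℂ → ℂ} {a : ℂ} (hφ : AnalyticAt ℂ φ a) (hφ' : deriv φ a ≠ 0)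
    (hf : MeromorphicAt f (φ a)) :
    residue (fun z => f (φ z) * deriv φ z) a = residue f (φ a) := by
  obtain ⟨n, c, hp⟩ := exists_hasPolar hf
  obtain ⟨g, hg, e⟩ := hp
  have htend : Tendsto φ (𝓝[≠] a) (𝓝[≠] (φ a)) :=
    hφ.differentiableAt.hasDerivAt.tendsto_nhdsNE hφ'
  have e' := htend.eventually e
  have hm : ∀ k, MeromorphicAt (fun z => c k / (φ z - φ a) ^ (k + 1) * deriv φ z) a := by
    intro k
    have h1 : MeromorphicAt φ a := hφ.meromorphicAt
    have h2 : MeromorphicAt (deriv φ) a := hφ.deriv.meromorphicAt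
    exact ((MeromorphicAt.const _ _).div ((h1.sub (MeromorphicAt.const _ _)).pow _)).mul h2
  have hgm : RegularAt (fun z => g (φ z) * deriv φ z) a :=
    AnalyticAt.regularAt ((hg.comp hφ).mul hφ.deriv)
  have h0 : residue (fun z => f (φ z) * deriv φ z) a =
      residue (fun z => ∑ k ∈ Finset.range (n + 1), c k / (φ z - φ a) ^ (k + 1) * deriv φ z +
        g (φ z) * deriv φ z) a := by
    refine residue_congr ((MeromorphicAt.fun_sum fun k _ => hm k).add hgm.meromorphicAt) ?_
    filter_upwards [e'] with z hz
    rw [← Finset.sum_mul, ← hz]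
    simp only [polar]
    ring
  rw [h0, residue_add (MeromorphicAt.fun_sum fun k _ => hm k) hgm.meromorphicAt, hgm.residue_eq,
    add_zero, residue_sum fun k _ => hm k, Finset.sum_range_succ', Finset.sum_eq_zero, zero_add]
  · rw [HasPolar.residue_eq ⟨g, hg, e⟩]
    obtain ⟨p, hp⟩ := hφ
    have hd : AnalyticAt ℂ (dslope φ a) a := ⟨_, hp.has_fpower_series_dslope_fslope⟩
    have hda : dslope φ a a ≠ 0 := by rwa [dslope_same]
    have h2 := residue_div_sub (g := fun z => c 0 * deriv φ z / dslope φ a z) (a := a)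
      ((analyticAt_const.mul (AnalyticAt.deriv ⟨p, hp⟩)).div hd hda)
    have h3 : c 0 * deriv φ a / dslope φ a a = c 0 := by
      rw [dslope_same, mul_div_cancel_right₀ _ hφ']
    rw [h3] at h2
    refine Eq.trans ?_ h2
    congr 1
    funext z
    have := sub_smul_dslope φ a z
    simp only [smul_eq_mul] at this
    rw [← this, zero_add, pow_one, div_div, mul_comm (dslope φ a z)]
    ring
  · intro k _
    -- for `k ≥ 1` the summand is a derivative
    have hψ : MeromorphicAt (fun z => -c (k + 1) / (k + 1) / (φ z - φ a) ^ (k + 1)) a :=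
      (MeromorphicAt.const _ _).div
        ((hφ.meromorphicAt.sub (MeromorphicAt.const _ _)).pow _)
    rw [← residue_deriv hψ]
    refine residue_congr hψ.deriv ?_
    have hne : ∀ᶠ z in 𝓝[≠] a, φ z ≠ φ a := htend.eventually self_mem_nhdsWithin
    have han : ∀ᶠ z in 𝓝[≠] a, AnalyticAt ℂ φ z :=
      hφ.eventually_analyticAt.filter_mono nhdsWithin_le_nhds
    filter_upwards [hne, han] with z hz hz'
    have hz0 : φ z - φ a ≠ 0 := sub_ne_zero.mpr hz
    have hd := ((hz'.differentiableAt.hasDerivAt.sub_const (φ a)).fun_pow (k + 1)).fun_inv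
      (pow_ne_zero _ hz0)
    have hd2 := hd.const_mul (-c (k + 1) / (k + 1))
    have : (fun z => -c (k + 1) / (k + 1) / (φ z - φ a) ^ (k + 1)) =
      fun z => -c (k + 1) / (k + 1) * ((φ z - φ a) ^ (k + 1))⁻¹ := by
      funext w; rw [div_eq_mul_inv]
    rw [this, hd2.deriv]
    have hk : ((k : ℂ) + 1) ≠ 0 := Nat.cast_add_one_ne_zero k
    push_cast
    field_simp
    ring

/-! ### Liouville's theorem and the residue theorem -/

/-- The function with all removable singularities of `f` removed. -/
def regularize (f : ℂ → ℂ) (z : ℂ) : ℂ := limUnder (𝓝[≠] z) f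

lemma regularize_eventuallyEq {f g : ℂ → ℂ} {a : ℂ} (hg : AnalyticAt ℂ g a)
    (e : f =ᶠ[𝓝[≠] a] g) : regularize f =ᶠ[𝓝 a] g := by
  have h1 : ∀ᶠ z in 𝓝 a, ∀ᶠ y in 𝓝[≠] z, f y = g y := by
    have h := eventually_nhdsWithin_iff.mp e
    have h3 : ∀ᶠ z in 𝓝[≠] a, ∀ᶠ y in 𝓝[≠] z, f y = g y := by
      have h4 := eventually_eventually_nhds.mpr h
      filter_upwards [h4.filter_mono nhdsWithin_le_nhds, self_mem_nhdsWithin] with z hz hza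
      filter_upwards [hz.filter_mono nhdsWithin_le_nhds,
        (eventually_ne_nhds (Set.mem_compl_singleton_iff.mp hza)).filter_mono nhdsWithin_le_nhds]
        with y hy hya
      exact hy hya
    rw [eventually_nhdsWithin_iff] at h3
    filter_upwards [h3] with z hz
    by_cases hza : z = a
    · rw [hza]; exact e
    · exact hz hza
  filter_upwards [h1, hg.eventually_analyticAt] with z hz hgz
  refine Tendsto.limUnder_eq ?_
  exact (hgz.continuousAt.tendsto.mono_left nhdsWithin_le_nhds).congr'
    (EventuallyEq.symm hz)

lemma RegularAt.analyticAt_regularize {f : ℂ → ℂ} {a : ℂ} (h : RegularAt f a) :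
    AnalyticAt ℂ (regularize f) a := by
  obtain ⟨g, hg, e⟩ := h
  exact hg.congr (regularize_eventuallyEq hg e).symm

lemma regularize_eq {f : ℂ → ℂ} {a : ℂ} (h : AnalyticAt ℂ f a) : regularize f a = f a :=
  (regularize_eventuallyEq h EventuallyEq.rfl).self_of_nhds

/-- **Liouville's theorem** for functions with finitely many removable singularities. -/
lemma eq_of_tendsto_cocompact {f : ℂ → ℂ} (h : ∀ z, RegularAt f z) {l : ℂ}
    (hl : Tendsto f (cocompact ℂ) (𝓝 l)) (S : Finset ℂ) (hS : ∀ z ∉ S, AnalyticAt ℂ f z)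
    {z : ℂ} (hz : z ∉ S) : f z = l := by
  have hd : Differentiable ℂ (regularize f) := fun w => (h w).analyticAt_regularize.differentiableAt
  have ht : Tendsto (regularize f) (cocompact ℂ) (𝓝 l) := by
    refine hl.congr' ?_
    have : (S : Set ℂ)ᶜ ∈ cocompact ℂ := S.finite_toSet.isCompact.compl_mem_cocompact
    filter_upwards [this] with w hw
    exact (regularize_eq (hS w hw)).symm
  rw [← regularize_eq (hS z hz)]
  exact hd.apply_eq_of_tendsto_cocompact z ht

/-- **Residue theorem** for a disc and finitely many isolated singularities. -/
theorem circleIntegral_eq_sum_residue {f : ℂ → ℂ} {b : ℂ} {r : ℝ} (hr : 0 < r) (S : Finset ℂ)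
    (hS : ∀ s ∈ S, s ∈ Metric.ball b r) (hm : ∀ s ∈ S, MeromorphicAt f s)
    (hf : ∀ z ∈ Metric.closedBall b r, z ∉ S → RegularAt f z)
    (hc : ∀ z ∈ Metric.sphere b r, AnalyticAt ℂ f z) :
    (2 * Real.pi * I)⁻¹ * (∮ z in C(b, r), f z) = ∑ s ∈ S, residue f s := by
  classical
  choose! n c hp using fun s (hs : s ∈ S) => exists_hasPolar (hm s hs)
  set g : ℂ → ℂ := fun z => f z - ∑ s ∈ S, polar (n s + 1) (c s) s z with hgdef
  have hreg : ∀ z ∈ Metric.closedBall b r, RegularAt g z := by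
    intro z hz
    by_cases hzS : z ∈ S
    · have h1 : RegularAt (fun w => ∑ s ∈ S.erase z, polar (n s + 1) (c s) s w) z :=
        RegularAt.sum fun s hs => AnalyticAt.regularAt
          (analyticAt_polar _ _ (Finset.ne_of_mem_erase hs).symm)
      refine ((hp z hzS).sub h1).congr (Eventually.of_forall fun w => ?_)
      simp only [hgdef]
      rw [← Finset.add_sum_erase S _ hzS]
      ring
    · exact (hf z hz hzS).sub (RegularAt.sum fun s hs => AnalyticAt.regularAt
        (analyticAt_polar _ _ fun h => hzS (h ▸ hs)))
  have hSs : ∀ z ∈ Metric.sphere b r, ∀ s ∈ S, z ≠ s := by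
    rintro z hz s hs rfl
    exact (Metric.mem_ball.mp (hS z hs)).ne (Metric.mem_sphere.mp hz)
  have hsph : Set.EqOn f (fun z => ∑ s ∈ S, polar (n s + 1) (c s) s z + regularize g z)
      (Metric.sphere b r) := by
    intro z hz
    have : AnalyticAt ℂ g z :=
      (hc z hz).sub (Finset.analyticAt_fun_sum _ fun s hs => analyticAt_polar _ _ (hSs z hz s hs))
    have h5 := regularize_eq this
    beta_reduce
    rw [h5, hgdef]
    ring
  have hi1 : ∀ s ∈ S, CircleIntegrable (polar (n s + 1) (c s) s) b r := fun s hs =>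
    ContinuousOn.circleIntegrable hr.le ((continuousOn_polar _ _ _).mono fun z hz => hSs z hz s hs)
  have hi2 : CircleIntegrable (regularize g) b r :=
    ContinuousOn.circleIntegrable hr.le fun z hz =>
      (hreg z (Metric.sphere_subset_closedBall
        hz)).analyticAt_regularize.continuousAt.continuousWithinAt
  rw [circleIntegral.integral_congr hr.le hsph, circleIntegral.integral_add
    (CircleIntegrable.fun_sum S hi1) hi2,
    circleIntegral.integral_fun_sum hi1,
    circleIntegral_eq_zero hr.le fun z hz => (hreg z hz).analyticAt_regularize, add_zero,
    Finset.mul_sum]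
  refine Finset.sum_congr rfl fun s hs => ?_
  rw [integral_polar (hS s hs), (hp s hs).residue_eq, inv_mul_cancel_left₀ two_pi_I_ne_zero]

/-- **Residue theorem** on the sphere, for forms without residue at infinity. -/
theorem sum_residue_eq_zero {f : ℂ → ℂ} (S : Finset ℂ) (hm : ∀ s ∈ S, MeromorphicAt f s)
    (T : Finset ℂ) (hf : ∀ z ∉ S, RegularAt f z) (hT : ∀ z ∉ T, AnalyticAt ℂ f z)
    (hl : Tendsto (fun z => z * f z) (cocompact ℂ) (𝓝 0)) :
    ∑ s ∈ S, residue f s = 0 := by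
  have hbdd : Bornology.IsBounded ((S ∪ T : Finset ℂ) : Set ℂ) :=
    (Finset.finite_toSet _).isBounded
  obtain ⟨r₀, hr₀⟩ := hbdd.subset_ball 0
  have key : ∀ ε > 0, ‖∑ s ∈ S, residue f s‖ ≤ ε := by
    intro ε hε
    have h1 : ∀ᶠ z in cocompact ℂ, ‖z * f z‖ ≤ ε := by
      have := hl.norm
      simp only [norm_zero] at this
      exact this.eventually_le_const hε
    rw [← Metric.cobounded_eq_cocompact, ← comap_norm_atTop, eventually_comap,
      eventually_atTop] at h1
    obtain ⟨r₁, hr₁⟩ := h1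
    set r := max (max r₀ r₁) 1
    have hr : 0 < r := lt_of_lt_of_le one_pos (le_max_right _ _)
    have hrr : r₀ ≤ r := (le_max_left _ _).trans (le_max_left _ _)
    have hrr1 : r₁ ≤ r := (le_max_right _ _).trans (le_max_left _ _)
    rw [← circleIntegral_eq_sum_residue hr S (b := 0)]
    · have h2 : ∀ z ∈ Metric.sphere (0 : ℂ) r, ‖f z‖ ≤ ε / r := by
        intro z hz
        have hz' : ‖z‖ = r := by simpa using hz
        have := hr₁ r hrr1 z hz'
        rw [norm_mul, hz'] at this
        rw [le_div_iff₀ hr]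
        linarith
      have := circleIntegral.norm_two_pi_i_inv_smul_integral_le_of_norm_le_const hr.le h2
      rw [smul_eq_mul] at this
      rwa [mul_div_cancel₀ _ hr.ne'] at this
    · intro s hs
      exact Metric.ball_subset_ball hrr (hr₀ (by simp [hs]))
    · exact hm
    · exact fun z _ hz => hf z hz
    · intro z hz
      refine hT z fun hzT => ?_
      have := Metric.ball_subset_ball hrr
        (hr₀ (show z ∈ ((S ∪ T : Finset ℂ) : Set ℂ) by simp [hzT]))
      exact (Metric.mem_ball.mp this).ne (Metric.mem_sphere.mp hz)
  have := le_of_forall_pos_le_add (a := ‖∑ s ∈ S, residue f s‖) (b := 0)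
    fun ε hε => by simpa using key ε hε
  simpa using this

/-! ### Taylor expansions to second order -/

/-- Taylor's formula with analytic remainder. -/
lemma exists_taylor {f : ℂ → ℂ} {a : ℂ} (hf : AnalyticAt ℂ f a) (n : ℕ) :
    ∃ g, AnalyticAt ℂ g a ∧ ∀ᶠ z in 𝓝 a,
      f z = ∑ k ∈ Finset.range n, iteratedDeriv k f a / k.factorial * (z - a) ^ k +
        (z - a) ^ n * g z := by
  induction n generalizing f with
  | zero => exact ⟨f, hf, by simp⟩
  | succ n ih =>
    have h1 : ∃ c g, AnalyticAt ℂ g a ∧ ∀ᶠ z in 𝓝 a,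
        f z = ∑ k ∈ Finset.range n, iteratedDeriv k f a / k.factorial * (z - a) ^ k +
          (z - a) ^ n * c + (z - a) ^ (n + 1) * g z := by
      obtain ⟨g, ⟨p, hp⟩, e⟩ := ih hf
      refine ⟨g a, dslope g a, ⟨_, hp.has_fpower_series_dslope_fslope⟩, ?_⟩
      filter_upwards [e] with z hz
      have h1 := sub_smul_dslope g a z
      simp only [smul_eq_mul] at h1
      rw [hz, pow_succ, mul_assoc, h1]
      ring
    obtain ⟨c, g, hg, e⟩ := h1
    refine ⟨g, hg, ?_⟩
    -- comparing the `n`-th derivatives on both sides identifies the coefficient `c`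
    have h2 : ∀ m : ℕ, ∀ u : ℂ → ℂ, AnalyticAt ℂ u a → ∀ k, k < m →
        iteratedDeriv k (fun z => (z - a) ^ m * u z) a = 0 := by
      intro m u hu
      have hA : AnalyticAt ℂ (fun z => (z - a) ^ m * u z) a := by fun_prop
      rw [← natCast_le_analyticOrderAt_iff_iteratedDeriv_eq_zero hA,
        natCast_le_analyticOrderAt hA]
      exact ⟨u, hu, by simp⟩
    have h3 : ∀ m : ℕ, ∀ c : ℂ, iteratedDeriv m (fun z => c * (z - a) ^ m) a = c * m.factorial := by
      intro m c
      rw [iteratedDeriv_const_mul_field]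
      congr 1
      have := iteratedDeriv_comp_sub_const m (fun z : ℂ => z ^ m) a
      rw [this]
      simp [Nat.descFactorial_self]
    have hc : iteratedDeriv n f a = c * n.factorial := by
      have hev : f =ᶠ[𝓝 a] fun z =>
          (∑ k ∈ Finset.range n, iteratedDeriv k f a / k.factorial * (z - a) ^ k) +
          (c * (z - a) ^ n + (z - a) ^ (n + 1) * g z) := by
        filter_upwards [e] with z hz
        rw [hz]; ring
      rw [hev.iteratedDeriv_eq, iteratedDeriv_fun_add (AnalyticAt.contDiffAt (by fun_prop))
        (AnalyticAt.contDiffAt (by fun_prop)), iteratedDeriv_fun_add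
        (AnalyticAt.contDiffAt (by fun_prop)) (AnalyticAt.contDiffAt (by fun_prop)), h3,
        h2 (n + 1) g hg n (by omega), add_zero, iteratedDeriv_fun_sum
        (fun i _ => AnalyticAt.contDiffAt (by fun_prop)), Finset.sum_eq_zero, zero_add]
      intro k hk
      have hk' := Finset.mem_range.mp hk
      rw [iteratedDeriv_const_mul_field, iteratedDeriv_comp_sub_const n (fun z : ℂ => z ^ k) a]
      simp [iteratedDeriv_eq_iterate, Nat.descFactorial_eq_zero_iff_lt.mpr hk']
    filter_upwards [e] with z hz
    rw [hz, Finset.sum_range_succ, hc, mul_div_assoc,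
      div_self (Nat.cast_ne_zero.mpr n.factorial_ne_zero)]
    ring

/-- The Taylor expansion `f(z) = c₀ + c₁ (z-a) + c₂ (z-a)² + 𝒪((z-a)³)`, where the value
of `f` in `a` itself does not matter. -/
def HasJet (f : ℂ → ℂ) (a c₀ c₁ c₂ : ℂ) : Prop :=
  ∃ g, AnalyticAt ℂ g a ∧
    f =ᶠ[𝓝[≠] a] fun z => c₀ + c₁ * (z - a) + c₂ * (z - a) ^ 2 + (z - a) ^ 3 * g z

namespace HasJet

variable {f g : ℂ → ℂ} {a c₀ c₁ c₂ b₀ b₁ b₂ : ℂ}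

lemma congr (h : HasJet f a c₀ c₁ c₂) (e : g =ᶠ[𝓝[≠] a] f) : HasJet g a c₀ c₁ c₂ := by
  obtain ⟨k, hk, e'⟩ := h
  exact ⟨k, hk, e.trans e'⟩

lemma of_analyticAt (hf : AnalyticAt ℂ f a) :
    HasJet f a (f a) (deriv f a) (iteratedDeriv 2 f a / 2) := by
  obtain ⟨g, hg, e⟩ := exists_taylor hf 3
  refine ⟨g, hg, ?_⟩
  filter_upwards [e.filter_mono nhdsWithin_le_nhds] with z hz
  rw [hz]
  simp [Finset.sum_range_succ, Nat.factorial]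

lemma const (c : ℂ) : HasJet (fun _ => c) a c 0 0 :=
  ⟨fun _ => 0, analyticAt_const, by simp⟩

lemma sub_self : HasJet (fun z => z - a) a 0 1 0 :=
  ⟨fun _ => 0, analyticAt_const, by simp⟩

lemma add (hf : HasJet f a c₀ c₁ c₂) (hg : HasJet g a b₀ b₁ b₂) :
    HasJet (fun z => f z + g z) a (c₀ + b₀) (c₁ + b₁) (c₂ + b₂) := by
  obtain ⟨k, hk, e⟩ := hf
  obtain ⟨l, hl, e'⟩ := hg
  refine ⟨_, hk.add hl, ?_⟩
  filter_upwards [e, e'] with z h1 h2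
  rw [h1, h2, Pi.add_apply]; ring

lemma mul (hf : HasJet f a c₀ c₁ c₂) (hg : HasJet g a b₀ b₁ b₂) :
    HasJet (fun z => f z * g z) a (c₀ * b₀) (c₀ * b₁ + c₁ * b₀) (c₀ * b₂ + c₁ * b₁ + c₂ * b₀) := by
  obtain ⟨k, hk, e⟩ := hf
  obtain ⟨l, hl, e'⟩ := hg
  refine ⟨fun z => c₁ * b₂ + c₂ * b₁ + c₂ * b₂ * (z - a) +
    (c₀ + c₁ * (z - a) + c₂ * (z - a) ^ 2) * l z +
    (b₀ + b₁ * (z - a) + b₂ * (z - a) ^ 2) * k z + (z - a) ^ 3 * k z * l z, by fun_prop, ?_⟩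
  filter_upwards [e, e'] with z h1 h2
  rw [h1, h2]; ring

lemma inv (hf : HasJet f a c₀ c₁ c₂) (h0 : c₀ ≠ 0) :
    HasJet (fun z => (f z)⁻¹) a c₀⁻¹ (-c₁ / c₀ ^ 2) (c₁ ^ 2 / c₀ ^ 3 - c₂ / c₀ ^ 2) := by
  obtain ⟨k, hk, e⟩ := hf
  set F : ℂ → ℂ := fun z => c₀ + c₁ * (z - a) + c₂ * (z - a) ^ 2 + (z - a) ^ 3 * k z
  have hF : AnalyticAt ℂ F a := by fun_prop
  have hFa : F a ≠ 0 := by simpa [F] using h0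
  set b₁ := -c₁ / c₀ ^ 2 with hb₁
  set b₂ := c₁ ^ 2 / c₀ ^ 3 - c₂ / c₀ ^ 2 with hb₂
  refine ⟨fun z => -(c₁ * b₂ + c₂ * b₁ + c₂ * b₂ * (z - a) +
    (c₀⁻¹ + b₁ * (z - a) + b₂ * (z - a) ^ 2) * k z) / F z, ?_, ?_⟩
  · exact AnalyticAt.div (by fun_prop) hF hFa
  · have hne : ∀ᶠ z in 𝓝[≠] a, F z ≠ 0 :=
      (hF.continuousAt.eventually_ne hFa).filter_mono nhdsWithin_le_nhds
    filter_upwards [e, hne] with z h1 h2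
    rw [h1]
    have h3 : 1 = F z * (c₀⁻¹ + b₁ * (z - a) + b₂ * (z - a) ^ 2) -
      (z - a) ^ 3 * (c₁ * b₂ + c₂ * b₁ + c₂ * b₂ * (z - a) +
        (c₀⁻¹ + b₁ * (z - a) + b₂ * (z - a) ^ 2) * k z) := by
      simp only [F, hb₁, hb₂]
      field_simp
      ring
    calc (F z)⁻¹ = (F z * (c₀⁻¹ + b₁ * (z - a) + b₂ * (z - a) ^ 2) -
          (z - a) ^ 3 * (c₁ * b₂ + c₂ * b₁ + c₂ * b₂ * (z - a) +
          (c₀⁻¹ + b₁ * (z - a) + b₂ * (z - a) ^ 2) * k z)) / F z := by rw [← h3, one_div]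
      _ = _ := by rw [sub_div, mul_div_cancel_left₀ _ h2]; ring

lemma neg (hf : HasJet f a c₀ c₁ c₂) : HasJet (fun z => -f z) a (-c₀) (-c₁) (-c₂) := by
  have := (const (a := a) (-1)).mul hf
  simpa using this

lemma sub (hf : HasJet f a c₀ c₁ c₂) (hg : HasJet g a b₀ b₁ b₂) :
    HasJet (fun z => f z - g z) a (c₀ - b₀) (c₁ - b₁) (c₂ - b₂) := by
  simpa [sub_eq_add_neg] using hf.add hg.neg

/-- A jet is determined by the function. -/
lemma unique (hf : HasJet f a c₀ c₁ c₂) (hg : HasJet f a b₀ b₁ b₂) :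
    c₀ = b₀ ∧ c₁ = b₁ ∧ c₂ = b₂ := by
  obtain ⟨k, hk, e⟩ := hf.sub hg
  have e0 : ∀ᶠ z in 𝓝[≠] a, (0 : ℂ) = (c₀ - b₀) + (c₁ - b₁) * (z - a) + (c₂ - b₂) * (z - a) ^ 2 +
      (z - a) ^ 3 * k z := by
    filter_upwards [e] with z hz
    rw [← hz, sub_eq_add_neg, add_neg_cancel]
  have lim0 : ∀ u : ℂ → ℂ, AnalyticAt ℂ u a → (∀ᶠ z in 𝓝[≠] a, u z = 0) → u a = 0 := by
    intro u hu h
    have h1 : Tendsto u (𝓝[≠] a) (𝓝 (u a)) :=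
      hu.continuousAt.tendsto.mono_left nhdsWithin_le_nhds
    exact tendsto_nhds_unique h1 (tendsto_const_nhds.congr' (EventuallyEq.symm h))
  have A : c₀ - b₀ = 0 := by
    have := lim0 (fun z => (c₀ - b₀) + (c₁ - b₁) * (z - a) + (c₂ - b₂) * (z - a) ^ 2 +
      (z - a) ^ 3 * k z) (by fun_prop) (e0.mono fun z hz => hz.symm)
    simpa using this
  have B : c₁ - b₁ = 0 := by
    have := lim0 (fun z => (c₁ - b₁) + (c₂ - b₂) * (z - a) + (z - a) ^ 2 * k z) (by fun_prop) (by
      filter_upwards [e0, self_mem_nhdsWithin] with z hz hza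
      have hz' : z - a ≠ 0 := sub_ne_zero.mpr hza
      rw [A] at hz
      refine (mul_eq_zero_iff_left hz').mp ?_
      linear_combination -hz)
    simpa using this
  have C : c₂ - b₂ = 0 := by
    have := lim0 (fun z => (c₂ - b₂) + (z - a) * k z) (by fun_prop) (by
      filter_upwards [e0, self_mem_nhdsWithin] with z hz hza
      have hz' : z - a ≠ 0 := sub_ne_zero.mpr hza
      rw [A, B] at hz
      refine (mul_eq_zero_iff_left (pow_ne_zero 2 hz')).mp ?_
      linear_combination -hz)
    simpa using this
  exact ⟨sub_eq_zero.mp A, sub_eq_zero.mp B, sub_eq_zero.mp C⟩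

lemma cast {d₀ d₁ d₂ : ℂ} (hf : HasJet f a c₀ c₁ c₂) (h0 : c₀ = d₀) (h1 : c₁ = d₁) (h2 : c₂ = d₂) :
    HasJet f a d₀ d₁ d₂ := by
  rwa [← h0, ← h1, ← h2]

end HasJet

/-! ### Partial fractions -/

/-- Partial fraction expansion of `p / ∏ (y - aⱼ)` for a monic polynomial `p` of the same
degree as the denominator. -/
lemma eval_div_prod_eq {ι : Type*} [DecidableEq ι] (s : Finset ι) (a : ι → ℂ) (ha : Set.InjOn a s)
    (p : Polynomial ℂ) (hp : p.Monic) (hd : p.natDegree = s.card) {y : ℂ} (hy : ∀ j ∈ s, y ≠ a j) :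
    p.eval y / ∏ j ∈ s, (y - a j) =
      1 + ∑ j ∈ s, p.eval (a j) / (∏ i ∈ s.erase j, (a j - a i)) / (y - a j) := by
  have hdeg : p.degree = s.card := by
    rw [Polynomial.degree_eq_natDegree hp.ne_zero, hd]
  have h1 : (p - Lagrange.nodal s a).degree < s.card := by
    rw [← hdeg]
    refine Polynomial.degree_sub_lt_left ?_ hp.ne_zero ?_
    · rw [hdeg, Lagrange.degree_nodal]
    · rw [hp.leadingCoeff, (Lagrange.nodal_monic (s := s) (v := a)).leadingCoeff]
  have h2 := Lagrange.eq_interpolate (f := p - Lagrange.nodal s a) ha h1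
  have h3 := congrArg (Polynomial.eval y) h2
  rw [Lagrange.eval_interpolate_not_at_node _ hy] at h3
  rw [Polynomial.eval_sub, Lagrange.eval_nodal] at h3
  have hne : ∏ j ∈ s, (y - a j) ≠ 0 :=
    Finset.prod_ne_zero_iff.mpr fun j hj => sub_ne_zero.mpr (hy j hj)
  rw [div_eq_iff hne]
  rw [sub_eq_iff_eq_add] at h3
  rw [h3]
  have h4 : ∀ i ∈ s, Lagrange.nodalWeight s a i * (y - a i)⁻¹ *
      Polynomial.eval (a i) (p - Lagrange.nodal s a) =
      p.eval (a i) / (∏ k ∈ s.erase i, (a i - a k)) / (y - a i) := by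
    intro i hi
    rw [Polynomial.eval_sub, Lagrange.eval_nodal_at_node hi, sub_zero, Lagrange.nodalWeight,
      Finset.prod_inv_distrib]
    field_simp
  rw [Finset.sum_congr rfl h4]
  ring

namespace Model

variable {d : ℕ} (M : Model d)

/-! ### The ramified covering -/

/-- The coupling constant divided by the size of the matrices. -/
def c : ℝ := M.lam / M.N

/-- The divided difference of `R`: `R(q) - R(t) = (q - t) U(q,t)`. -/
def U (q t : ℂ) : ℂ := 1 + M.c * ∑ k, (M.ρ k : ℂ) / ((M.ε k + q) * (M.ε k + t))

/-- The negative of the divided difference of `U`. -/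
def Ξ (q s t : ℂ) : ℂ := M.c * ∑ k, (M.ρ k : ℂ) / ((M.ε k + q) * (M.ε k + s) * (M.ε k + t))

lemma coe_c : (M.lam / M.N : ℂ) = M.c := by simp [c]

lemma c_nonneg : 0 ≤ M.c := div_nonneg M.lam_pos.le (Nat.cast_nonneg _)

lemma N_pos (k : Fin d) : 0 < M.N :=
  lt_of_lt_of_le (M.r_pos k) (Finset.single_le_sum (f := M.r) (fun _ _ => Nat.zero_le _)
    (Finset.mem_univ k))

lemma c_pos (k : Fin d) : 0 < M.c := div_pos M.lam_pos (Nat.cast_pos.mpr (M.N_pos k))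

lemma c_ne_zero (k : Fin d) : (M.c : ℂ) ≠ 0 := by exact_mod_cast (M.c_pos k).ne'

lemma R_eq (z : ℂ) : M.R z = z - M.c * ∑ k, (M.ρ k : ℂ) / (M.ε k + z) := by
  simp [R, cover, c]

lemma R_ε (k : Fin d) : M.R (M.ε k) = M.e k := M.cover_eq k

variable {M}

lemma eps_add_ne {z : ℂ} (h : ¬ M.IsPole z) (k : Fin d) : (M.ε k : ℂ) + z ≠ 0 := by
  intro h0
  exact h ⟨k, by linear_combination h0⟩

lemma not_isPole_of_re {z : ℂ} (h : 0 ≤ z.re) : ¬ M.IsPole z := by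
  rintro ⟨k, rfl⟩
  have := M.ε_pos k
  simp at h
  linarith

lemma not_isPole_of_im {z : ℂ} (h : z.im ≠ 0) : ¬ M.IsPole z := by
  rintro ⟨k, rfl⟩
  simp at h

lemma not_isPole_ε (k : Fin d) : ¬ M.IsPole (M.ε k : ℂ) :=
  not_isPole_of_re (by simpa using (M.ε_pos k).le)

variable (M) in
lemma finite_poles : {z | M.IsPole z}.Finite := by
  have : {z | M.IsPole z} = Set.range fun k => -(M.ε k : ℂ) := by
    ext z; simp [IsPole, eq_comm]
  rw [this]
  exact Set.finite_range _

variable (M) in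
lemma U_comm (q t : ℂ) : M.U q t = M.U t q := by
  simp only [U, mul_comm]

lemma R_sub {q t : ℂ} (hq : ¬ M.IsPole q) (ht : ¬ M.IsPole t) :
    M.R q - M.R t = (q - t) * M.U q t := by
  have h : ∀ k, (M.ρ k : ℂ) / (M.ε k + q) - (M.ρ k : ℂ) / (M.ε k + t) =
      -((q - t) * ((M.ρ k : ℂ) / ((M.ε k + q) * (M.ε k + t)))) := by
    intro k
    have h1 := eps_add_ne hq k
    have h2 := eps_add_ne ht k
    field_simp
    ring
  have h2 : (∑ k, (M.ρ k : ℂ) / (M.ε k + q)) - ∑ k, (M.ρ k : ℂ) / (M.ε k + t) =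
      -((q - t) * ∑ k, (M.ρ k : ℂ) / ((M.ε k + q) * (M.ε k + t))) := by
    rw [← Finset.sum_sub_distrib, Finset.sum_congr rfl fun k _ => h k, Finset.sum_neg_distrib,
      ← Finset.mul_sum]
  rw [R_eq, R_eq, U]
  linear_combination -(M.c : ℂ) * h2

lemma U_sub {q s t : ℂ} (hq : ¬ M.IsPole q) (hs : ¬ M.IsPole s) (ht : ¬ M.IsPole t) :
    M.U q s - M.U q t = (t - s) * M.Ξ q s t := by
  have h : ∀ k, (M.ρ k : ℂ) / ((M.ε k + q) * (M.ε k + s)) -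
      (M.ρ k : ℂ) / ((M.ε k + q) * (M.ε k + t)) =
      (t - s) * ((M.ρ k : ℂ) / ((M.ε k + q) * (M.ε k + s) * (M.ε k + t))) := by
    intro k
    have h1 := eps_add_ne hq k
    have h2 := eps_add_ne ht k
    have h3 := eps_add_ne hs k
    field_simp
    ring
  have h2 : (∑ k, (M.ρ k : ℂ) / ((M.ε k + q) * (M.ε k + s))) -
      ∑ k, (M.ρ k : ℂ) / ((M.ε k + q) * (M.ε k + t)) =
      (t - s) * ∑ k, (M.ρ k : ℂ) / ((M.ε k + q) * (M.ε k + s) * (M.ε k + t)) := by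
    rw [← Finset.sum_sub_distrib, Finset.sum_congr rfl fun k _ => h k, ← Finset.mul_sum]
  rw [U, U, Ξ]
  linear_combination (M.c : ℂ) * h2

lemma analyticAt_U {f g : ℂ → ℂ} {a : ℂ} (hf : AnalyticAt ℂ f a) (hg : AnalyticAt ℂ g a)
    (h1 : ¬ M.IsPole (f a)) (h2 : ¬ M.IsPole (g a)) :
    AnalyticAt ℂ (fun z => M.U (f z) (g z)) a := by
  unfold U
  refine analyticAt_const.add (analyticAt_const.mul (Finset.analyticAt_fun_sum _ fun k _ => ?_))
  refine analyticAt_const.div (by fun_prop) (mul_ne_zero (eps_add_ne h1 k) (eps_add_ne h2 k))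

lemma analyticAt_R {z : ℂ} (h : ¬ M.IsPole z) : AnalyticAt ℂ M.R z := by
  have : M.R = fun z => z - M.c * ∑ k, (M.ρ k : ℂ) / (M.ε k + z) := funext M.R_eq
  rw [this]
  refine analyticAt_id.sub (analyticAt_const.mul (Finset.analyticAt_fun_sum _ fun k _ => ?_))
  exact analyticAt_const.div (by fun_prop) (eps_add_ne h k)

lemma analyticAt_R_neg {z : ℂ} (h : ¬ M.IsPole (-z)) : AnalyticAt ℂ (fun z => M.R (-z)) z :=
  (analyticAt_R h).fun_comp (analyticAt_id.neg)

lemma hasDerivAt_R {z : ℂ} (h : ¬ M.IsPole z) : HasDerivAt M.R (M.U z z) z := by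
  have : M.R = fun z => z - M.c * ∑ k, (M.ρ k : ℂ) / (M.ε k + z) := funext M.R_eq
  rw [this]
  have h1 : ∀ k ∈ Finset.univ, HasDerivAt (fun z => (M.ρ k : ℂ) / (M.ε k + z))
      (-((M.ρ k : ℂ) / ((M.ε k + z) * (M.ε k + z)))) z := by
    intro k _
    have := (hasDerivAt_const z (M.ρ k : ℂ)).fun_div
      ((hasDerivAt_id z).const_add (M.ε k : ℂ)) (eps_add_ne h k)
    refine this.congr_deriv ?_
    simp only [id]
    ring
  refine ((hasDerivAt_id z).sub ((HasDerivAt.fun_sum h1).const_mul (M.c : ℂ))).congr_deriv ?_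
  rw [U, Finset.sum_neg_distrib]
  ring

lemma deriv_R {z : ℂ} (h : ¬ M.IsPole z) : deriv M.R z = M.U z z := (hasDerivAt_R h).deriv

lemma hasDerivAt_R_neg {z : ℂ} (h : ¬ M.IsPole (-z)) :
    HasDerivAt (fun z => M.R (-z)) (-M.U (-z) (-z)) z := by
  have := (hasDerivAt_R h).comp z (hasDerivAt_neg z)
  rwa [mul_neg, mul_one] at this

lemma isOpen_not_isPole : IsOpen {z | ¬ M.IsPole z} := by
  have := M.finite_poles.isClosed.isOpen_compl
  exact this

lemma eventually_not_isPole {z : ℂ} (h : ¬ M.IsPole z) : ∀ᶠ w in 𝓝 z, ¬ M.IsPole w :=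
  isOpen_not_isPole.mem_nhds h

lemma eventually_not_isPole_neg {z : ℂ} (h : ¬ M.IsPole (-z)) : ∀ᶠ w in 𝓝 z, ¬ M.IsPole (-w) :=
  continuous_neg.continuousAt.eventually (eventually_not_isPole h)

lemma deriv_deriv_R {z : ℂ} (h : ¬ M.IsPole z) : deriv (deriv M.R) z = -2 * M.Ξ z z z := by
  have e : deriv M.R =ᶠ[𝓝 z] fun w => M.U w w :=
    (eventually_not_isPole h).mono fun w hw => deriv_R hw
  rw [e.deriv_eq]
  have h1 : ∀ k ∈ Finset.univ, HasDerivAt (fun z => (M.ρ k : ℂ) / ((M.ε k + z) * (M.ε k + z)))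
      (-2 * ((M.ρ k : ℂ) / ((M.ε k + z) * (M.ε k + z) * (M.ε k + z)))) z := by
    intro k _
    have h2 := (hasDerivAt_id z).const_add (M.ε k : ℂ)
    have := (hasDerivAt_const z (M.ρ k : ℂ)).fun_div (h2.fun_mul h2)
      (mul_ne_zero (eps_add_ne h k) (eps_add_ne h k))
    refine this.congr_deriv ?_
    have h3 := eps_add_ne h k
    simp only [id]
    field_simp
    ring
  have := ((HasDerivAt.fun_sum h1).const_mul (M.c : ℂ)).const_add 1
  refine (this.congr_deriv ?_).deriv
  rw [Ξ, ← Finset.mul_sum]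
  ring

lemma meromorphicAt_R (z : ℂ) : MeromorphicAt M.R z := by
  have : M.R = fun z => z - M.c * ∑ k, (M.ρ k : ℂ) / (M.ε k + z) := funext M.R_eq
  rw [this]
  refine (MeromorphicAt.id z).fun_sub ((MeromorphicAt.const _ _).fun_mul
    (MeromorphicAt.fun_sum fun k _ => ?_))
  exact (MeromorphicAt.const _ _).fun_div ((MeromorphicAt.const _ _).fun_add (MeromorphicAt.id z))

lemma meromorphicAt_R_neg (z : ℂ) : MeromorphicAt (fun z => M.R (-z)) z :=
  (meromorphicAt_R (-z)).comp_analyticAt (f := M.R) (g := fun z => -z) (by fun_prop)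

variable (M) in
lemma ε_injective : Function.Injective M.ε := by
  intro j k h
  apply M.e_injective
  have h1 := M.R_ε j
  rw [h, M.R_ε k] at h1
  exact_mod_cast h1.symm

variable (M) in
lemma e_inj {j k : Fin d} : (M.e j : ℂ) = M.e k ↔ j = k := by
  rw [ofReal_inj]
  exact M.e_injective.eq_iff

variable (M) in
lemma ρ_mul_deriv (k : Fin d) : (M.ρ k : ℂ) * M.U (M.ε k) (M.ε k) = M.r k := by
  rw [← deriv_R (not_isPole_ε k)]
  exact M.deriv_cover_eq k

/-! ### `R` is a Pick function -/

/-- `R` has positive imaginary part exactly in the upper half plane, so that all preimages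
of real numbers are real. -/
lemma im_R (z : ℂ) :
    (M.R z).im = z.im * (1 + M.c * ∑ k, M.ρ k / normSq (M.ε k + z)) := by
  rw [R_eq]
  simp only [sub_im, im_ofReal_mul, im_sum, div_im, ofReal_re, ofReal_im, add_im,
    add_re, zero_mul, zero_div, zero_sub, zero_add]
  rw [mul_add, mul_one, Finset.mul_sum, Finset.mul_sum, Finset.mul_sum, sub_eq_add_neg,
    ← Finset.sum_neg_distrib]
  congr 1
  refine Finset.sum_congr rfl fun k _ => ?_
  ring

lemma pick_pos (z : ℂ) : 0 < 1 + M.c * ∑ k, M.ρ k / normSq (M.ε k + z) := by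
  have : 0 ≤ M.c * ∑ k, M.ρ k / normSq (M.ε k + z) :=
    mul_nonneg M.c_nonneg (Finset.sum_nonneg fun k _ => div_nonneg (M.ρ_pos k).le (normSq_nonneg _))
  linarith

lemma im_R_eq_zero {z : ℂ} : (M.R z).im = 0 ↔ z.im = 0 := by
  rw [im_R, mul_eq_zero, or_iff_left (pick_pos z).ne']

lemma im_R_pos {z : ℂ} : 0 < (M.R z).im ↔ 0 < z.im := by
  rw [im_R, mul_pos_iff_of_pos_right (pick_pos z)]

lemma im_R_neg {z : ℂ} : (M.R z).im < 0 ↔ z.im < 0 := by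
  rw [im_R, mul_neg_iff]
  have := pick_pos (M := M) z
  constructor
  · rintro (⟨_, h⟩ | ⟨h, _⟩)
    · linarith
    · exact h
  · exact fun h => Or.inr ⟨h, this⟩

lemma R_ne_R_neg {z : ℂ} (h : z.im ≠ 0) : M.R z ≠ M.R (-z) := by
  intro h0
  rcases lt_or_gt_of_ne h with h1 | h1
  · have h2 := im_R_neg (M := M).mpr h1
    rw [h0, im_R_neg] at h2
    simp at h2; linarith
  · have h2 := im_R_pos (M := M).mpr h1
    rw [h0, im_R_pos] at h2
    simp at h2; linarith

lemma eq_ofReal {z : ℂ} (h : z.im = 0) : z = (z.re : ℂ) := by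
  apply Complex.ext <;> simp [h]

lemma U_pos {x y : ℝ} (hx : 0 ≤ x) (hy : 0 ≤ y) : M.U x y ≠ 0 := by
  have h1 : M.U x y = ((1 + M.c * ∑ k, M.ρ k / ((M.ε k + x) * (M.ε k + y)) : ℝ) : ℂ) := by
    simp [U]
  rw [h1, ofReal_ne_zero]
  have : 0 ≤ M.c * ∑ k, M.ρ k / ((M.ε k + x) * (M.ε k + y)) :=
    mul_nonneg M.c_nonneg (Finset.sum_nonneg fun k _ => div_nonneg (M.ρ_pos k).le
      (mul_nonneg (by have := M.ε_pos k; linarith) (by have := M.ε_pos k; linarith)))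
  linarith

lemma R_injOn_nonneg {x y : ℝ} (hx : 0 ≤ x) (hy : 0 ≤ y) (h : M.R x = M.R y) : x = y := by
  have h1 := R_sub (M := M) (q := x) (t := y) (not_isPole_of_re (by simpa))
    (not_isPole_of_re (by simpa))
  rw [h, sub_self, eq_comm, mul_eq_zero, or_iff_left (U_pos hx hy), sub_eq_zero] at h1
  exact_mod_cast h1

lemma deriv_R_ne_zero_of_real {z : ℂ} (h : z.im = 0) : M.U z z ≠ 0 := by
  rw [eq_ofReal h]
  have h1 : M.U (z.re : ℂ) (z.re : ℂ) =
      ((1 + M.c * ∑ k, M.ρ k / ((M.ε k + z.re) * (M.ε k + z.re)) : ℝ) : ℂ) := by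
    simp [U]
  rw [h1, ofReal_ne_zero]
  have : 0 ≤ M.c * ∑ k, M.ρ k / ((M.ε k + z.re) * (M.ε k + z.re)) :=
    mul_nonneg M.c_nonneg (Finset.sum_nonneg fun k _ => div_nonneg (M.ρ_pos k).le
      (mul_self_nonneg _))
  linarith

/-- In a half plane the pair `(R(z), R(-z))` determines `z`: the two divided differences do
not vanish simultaneously. This includes the infinitesimal version `q = t`. -/
lemma U_ne_zero_or {q t : ℂ} (h : 0 < q.im * t.im) : M.U q t ≠ 0 ∨ M.U (-q) (-t) ≠ 0 := by
  have him : ∀ q t : ℂ, (M.U q t).im = M.c * ∑ k, M.ρ k *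
      (-((M.ε k + q.re) * t.im + (M.ε k + t.re) * q.im) /
        normSq ((M.ε k + q) * (M.ε k + t))) := by
    intro q t
    rw [U, add_im, one_im, zero_add, im_ofReal_mul, im_sum]
    congr 1
    refine Finset.sum_congr rfl fun k _ => ?_
    rw [div_im]
    simp only [ofReal_re, ofReal_im, mul_im, add_re, add_im, zero_mul, zero_div, zero_add, zero_sub]
    ring
  have hq : q.im ≠ 0 := by rintro h0; simp [h0] at h
  have ht : t.im ≠ 0 := by rintro h0; simp [h0] at h
  by_cases hd : IsEmpty (Fin d)
  · left; simp [U]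
  rw [not_isEmpty_iff] at hd
  obtain ⟨k₀⟩ := hd
  have hc := M.c_pos k₀
  have hpos : ∀ q t : ℂ, q.im ≠ 0 → t.im ≠ 0 → ∀ k, 0 < normSq ((M.ε k + q) * (M.ε k + t)) := by
    intro q t hq ht k
    exact normSq_pos.mpr (mul_ne_zero (eps_add_ne (not_isPole_of_im hq) k)
      (eps_add_ne (not_isPole_of_im ht) k))
  -- all summands of the imaginary part have the same strict sign
  have key : ∀ q t : ℂ, q.im ≠ 0 → t.im ≠ 0 →
      (∀ k, 0 < ((M.ε k + q.re) * t.im + (M.ε k + t.re) * q.im)) ∨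
      (∀ k, ((M.ε k + q.re) * t.im + (M.ε k + t.re) * q.im) < 0) → M.U q t ≠ 0 := by
    intro q t hq ht hs h0
    have h1 := him q t
    rw [h0, zero_im, eq_comm, mul_eq_zero, or_iff_right hc.ne'] at h1
    rcases hs with hs | hs
    · have : ∑ k, M.ρ k * (-((M.ε k + q.re) * t.im + (M.ε k + t.re) * q.im) /
          normSq ((M.ε k + q) * (M.ε k + t))) < 0 :=
        Finset.sum_neg (fun k _ => mul_neg_of_pos_of_neg (M.ρ_pos k)
          (div_neg_of_neg_of_pos (neg_lt_zero.mpr (hs k)) (hpos q t hq ht k))) ⟨k₀, by simp⟩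
      linarith
    · have : 0 < ∑ k, M.ρ k * (-((M.ε k + q.re) * t.im + (M.ε k + t.re) * q.im) /
          normSq ((M.ε k + q) * (M.ε k + t))) :=
        Finset.sum_pos (fun k _ => mul_pos (M.ρ_pos k)
          (div_pos (neg_pos.mpr (hs k)) (hpos q t hq ht k))) ⟨k₀, by simp⟩
      linarith
  have hqn : (-q).im ≠ 0 := by simpa using hq
  have htn : (-t).im ≠ 0 := by simpa using ht
  rcases lt_or_gt_of_ne hq with hq' | hq'
  · have ht' : t.im < 0 := by nlinarith
    rcases le_total (q.re * t.im + t.re * q.im) 0 with h2 | h2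
    · left
      refine key q t hq ht (Or.inr fun k => ?_)
      have := M.ε_pos k
      nlinarith
    · right
      refine key _ _ hqn htn (Or.inl fun k => ?_)
      have := M.ε_pos k
      simp only [neg_re, neg_im]
      nlinarith
  · have ht' : 0 < t.im := by nlinarith
    rcases le_total (q.re * t.im + t.re * q.im) 0 with h2 | h2
    · right
      refine key _ _ hqn htn (Or.inr fun k => ?_)
      have := M.ε_pos k
      simp only [neg_re, neg_im]
      nlinarith
    · left
      refine key q t hq ht (Or.inl fun k => ?_)
      have := M.ε_pos k
      nlinarith

/-! ### Behaviour of `R` at its poles and at infinity -/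

variable (M) in
lemma c_mul_ρ_ne_zero (k : Fin d) : (M.c * M.ρ k : ℂ) ≠ 0 :=
  mul_ne_zero (M.c_ne_zero k) (by exact_mod_cast (M.ρ_pos k).ne')

variable (M) in
lemma tendsto_R_cocompact : Tendsto M.R (cocompact ℂ) (cocompact ℂ) := by
  have h1 : Tendsto (fun z => M.c * ∑ k, (M.ρ k : ℂ) / (M.ε k + z)) (cocompact ℂ) (𝓝 0) := by
    have : ∀ k ∈ Finset.univ, Tendsto (fun z => (M.ρ k : ℂ) / (M.ε k + z)) (cocompact ℂ) (𝓝 0) := by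
      intro k _
      have h2 : Tendsto (fun z : ℂ => (M.ε k : ℂ) + z) (cocompact ℂ) (cocompact ℂ) :=
        (Homeomorph.addLeft (M.ε k : ℂ)).isClosedEmbedding.tendsto_cocompact
      have h3 := (tendsto_inv₀_cobounded (α := ℂ))
      rw [Metric.cobounded_eq_cocompact] at h3
      simpa [div_eq_mul_inv] using (h3.comp h2).const_mul (M.ρ k : ℂ)
    simpa using (tendsto_finsetSum _ this).const_mul (M.c : ℂ)
  rw [← Metric.cobounded_eq_cocompact] at *
  rw [← tendsto_norm_atTop_iff_cobounded]
  have h2 : ∀ᶠ z in Bornology.cobounded ℂ, ‖M.c * ∑ k, (M.ρ k : ℂ) / (M.ε k + z)‖ ≤ 1 := by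
    have := h1.norm
    rw [norm_zero] at this
    exact this.eventually_le_const one_pos
  have h3 : Tendsto (fun z : ℂ => ‖z‖ - 1) (Bornology.cobounded ℂ) atTop :=
    tendsto_atTop_add_const_right _ (-1) tendsto_norm_cobounded_atTop
  refine tendsto_atTop_mono' _ ?_ h3
  filter_upwards [h2] with z hz
  rw [R_eq]
  have := norm_sub_norm_le z (M.c * ∑ k, (M.ρ k : ℂ) / (M.ε k + z))
  linarith

variable (M) in
lemma tendsto_R_neg_cocompact : Tendsto (fun z => M.R (-z)) (cocompact ℂ) (cocompact ℂ) :=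
  M.tendsto_R_cocompact.comp (Homeomorph.neg ℂ).isClosedEmbedding.tendsto_cocompact

/-- The part of `R` without pole in `-εₖ`. -/
def Rreg (M : Model d) (k : Fin d) (z : ℂ) : ℂ :=
  z - M.c * ∑ j ∈ Finset.univ.erase k, (M.ρ j : ℂ) / (M.ε j + z)

lemma R_eq_Rreg (k : Fin d) (z : ℂ) : M.R z = M.Rreg k z - M.c * M.ρ k / (M.ε k + z) := by
  rw [R_eq, Rreg, ← Finset.add_sum_erase _ _ (Finset.mem_univ k)]
  ring

lemma analyticAt_Rreg (k : Fin d) : AnalyticAt ℂ (M.Rreg k) (-(M.ε k : ℂ)) := by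
  unfold Rreg
  refine analyticAt_id.sub (analyticAt_const.mul (Finset.analyticAt_fun_sum _ fun j hj => ?_))
  refine analyticAt_const.div (by fun_prop) ?_
  have : M.ε j ≠ M.ε k := fun h => (Finset.ne_of_mem_erase hj) (M.ε_injective h)
  rw [← sub_eq_add_neg, sub_ne_zero]
  exact_mod_cast this

lemma tendsto_sub_mul_R (k : Fin d) :
    Tendsto (fun z => (M.ε k + z) * M.R z) (𝓝[≠] (-(M.ε k : ℂ))) (𝓝 (-(M.c * M.ρ k))) := by
  have h1 : Tendsto (fun z => (M.ε k + z) * M.Rreg k z - M.c * M.ρ k) (𝓝 (-(M.ε k : ℂ)))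
      (𝓝 (-(M.c * M.ρ k))) := by
    have : ContinuousAt (fun z => (M.ε k + z) * M.Rreg k z - M.c * M.ρ k) (-(M.ε k : ℂ)) :=
      ((continuousAt_const.add continuousAt_id).mul (analyticAt_Rreg k).continuousAt).sub
        continuousAt_const
    simpa [ContinuousAt] using this
  refine (h1.mono_left nhdsWithin_le_nhds).congr' ?_
  filter_upwards [self_mem_nhdsWithin] with z hz
  have : (M.ε k : ℂ) + z ≠ 0 := fun h =>
    hz (by simp only [Set.mem_singleton_iff]; linear_combination h)
  rw [R_eq_Rreg k]
  field_simp

lemma tendsto_R_pole (k : Fin d) :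
    Tendsto M.R (𝓝[≠] (-(M.ε k : ℂ))) (cocompact ℂ) := by
  have h0 := M.c_mul_ρ_ne_zero k
  have h1 : Tendsto (fun z : ℂ => (M.ε k + z)⁻¹) (𝓝[≠] (-(M.ε k : ℂ))) (Bornology.cobounded ℂ) := by
    refine (tendsto_inv₀_nhdsNE_zero (α := ℂ)).comp ?_
    refine tendsto_nhdsWithin_of_tendsto_nhds_of_eventually_within _ ?_ ?_
    · have : ContinuousAt (fun z : ℂ => (M.ε k : ℂ) + z) (-(M.ε k : ℂ)) := by fun_prop
      have h := this.tendsto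
      simp only [add_neg_cancel] at h
      exact h.mono_left nhdsWithin_le_nhds
    · filter_upwards [self_mem_nhdsWithin] with z hz h
      exact hz (by simp only [Set.mem_singleton_iff] at h ⊢; linear_combination h)
  rw [← Metric.cobounded_eq_cocompact, ← tendsto_norm_atTop_iff_cobounded]
  have h2 := (tendsto_sub_mul_R (M := M) k).norm
  have h3 := (tendsto_norm_atTop_iff_cobounded.mpr h1).atTop_mul_pos
    (norm_pos_iff.mpr (neg_ne_zero.mpr h0)) h2
  refine h3.congr' ?_
  filter_upwards [self_mem_nhdsWithin] with z hz
  have : (M.ε k : ℂ) + z ≠ 0 := fun h =>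
    hz (by simp only [Set.mem_singleton_iff]; linear_combination h)
  rw [← norm_mul, inv_mul_cancel_left₀ this]

lemma tendsto_inv_const_sub_cocompact (a : ℂ) :
    Tendsto (fun z => (a - z)⁻¹) (cocompact ℂ) (𝓝 0) := by
  have h := tendsto_inv₀_cobounded (α := ℂ)
  rw [Metric.cobounded_eq_cocompact] at h
  exact h.comp (Homeomorph.subLeft a).isClosedEmbedding.tendsto_cocompact

/-! ### The fibres over `eₖ` -/

/-- The polynomial whose roots are the solutions of `R(z) = y`. -/
def fiberPoly (M : Model d) (y : ℂ) : Polynomial ℂ :=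
  (Polynomial.X - Polynomial.C y) * Lagrange.nodal Finset.univ (fun j => -(M.ε j : ℂ)) -
    ∑ k, Polynomial.C (M.c * M.ρ k : ℂ) *
      Lagrange.nodal (Finset.univ.erase k) (fun j => -(M.ε j : ℂ))

lemma eval_fiberPoly (y t : ℂ) : (M.fiberPoly y).eval t = (t - y) * ∏ j, (M.ε j + t) -
    ∑ k, M.c * M.ρ k * ∏ j ∈ Finset.univ.erase k, (M.ε j + t) := by
  simp [fiberPoly, Polynomial.eval_finsetSum, Lagrange.eval_nodal, sub_neg_eq_add, add_comm t]

lemma eval_fiberPoly_of_not_isPole {t : ℂ} (y : ℂ) (ht : ¬ M.IsPole t) :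
    (M.fiberPoly y).eval t = (M.R t - y) * ∏ j, (M.ε j + t) := by
  rw [eval_fiberPoly, R_eq]
  have h : ∀ k ∈ Finset.univ, M.c * M.ρ k * ∏ j ∈ Finset.univ.erase k, (M.ε j + t) =
      M.c * (M.ρ k / (M.ε k + t)) * ∏ j, (M.ε j + t) := by
    intro k hk
    rw [← Finset.mul_prod_erase _ _ hk]
    have := eps_add_ne ht k
    field_simp
  rw [Finset.sum_congr rfl h, ← Finset.sum_mul, ← Finset.mul_sum]
  ring

lemma eval_fiberPoly_pole (y : ℂ) (k : Fin d) : (M.fiberPoly y).eval (-(M.ε k : ℂ)) =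
    -(M.c * M.ρ k * ∏ j ∈ Finset.univ.erase k, ((M.ε j : ℂ) - M.ε k)) := by
  rw [eval_fiberPoly, Finset.prod_eq_zero (Finset.mem_univ k) (by ring), mul_zero, zero_sub,
    Finset.sum_eq_single k]
  · simp only [sub_eq_add_neg]
  · intro j _ hj
    rw [Finset.prod_eq_zero (i := k) (by simp [hj.symm]) (by ring), mul_zero]
  · simp

lemma prod_eps_sub_ne_zero (k : Fin d) :
    ∏ j ∈ Finset.univ.erase k, ((M.ε j : ℂ) - M.ε k) ≠ 0 := by
  refine Finset.prod_ne_zero_iff.mpr fun j hj => sub_ne_zero.mpr ?_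
  exact_mod_cast fun h => (Finset.ne_of_mem_erase hj) (M.ε_injective h)

lemma degree_fiberPoly_aux (y : ℂ) : (∑ k, Polynomial.C (M.c * M.ρ k : ℂ) *
      Lagrange.nodal (Finset.univ.erase k) (fun j => -(M.ε j : ℂ))).degree <
    ((Polynomial.X - Polynomial.C y) *
      Lagrange.nodal Finset.univ (fun j => -(M.ε j : ℂ))).degree := by
  rw [Polynomial.degree_mul, Polynomial.degree_X_sub_C, Lagrange.degree_nodal]
  refine lt_of_le_of_lt (Polynomial.degree_sum_le _ _) ?_
  rw [Finset.sup_lt_iff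
    (by simp only [Finset.card_univ, Fintype.card_fin]; exact WithBot.bot_lt_coe _)]
  intro k _
  rw [Polynomial.degree_C_mul (M.c_mul_ρ_ne_zero k), Lagrange.degree_nodal]
  have : (Finset.univ.erase k).card < 1 + (Finset.univ : Finset (Fin d)).card :=
    lt_of_le_of_lt (Finset.card_le_card (Finset.erase_subset _ _)) (by omega)
  exact_mod_cast this

lemma monic_fiberPoly (y : ℂ) : (M.fiberPoly y).Monic :=
  ((Polynomial.monic_X_sub_C y).mul Lagrange.nodal_monic).sub_of_left (degree_fiberPoly_aux y)

lemma natDegree_fiberPoly (y : ℂ) : (M.fiberPoly y).natDegree = d + 1 := by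
  rw [fiberPoly, Polynomial.natDegree_eq_of_degree_eq
    (Polynomial.degree_sub_eq_left_of_degree_lt (degree_fiberPoly_aux y)),
    (Polynomial.monic_X_sub_C y).natDegree_mul Lagrange.nodal_monic,
    Polynomial.natDegree_X_sub_C, Lagrange.natDegree_nodal]
  simp [add_comm]

lemma fiberPoly_ne_zero (y : ℂ) : M.fiberPoly y ≠ 0 := (monic_fiberPoly y).ne_zero

lemma not_isPole_of_isRoot {y t : ℂ} (h : (M.fiberPoly y).IsRoot t) : ¬ M.IsPole t := by
  rintro ⟨k, rfl⟩
  rw [Polynomial.IsRoot, eval_fiberPoly_pole, neg_eq_zero] at h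
  exact mul_ne_zero (M.c_mul_ρ_ne_zero k) (prod_eps_sub_ne_zero k) h

lemma prod_eps_add_ne_zero {t : ℂ} (ht : ¬ M.IsPole t) : ∏ j, ((M.ε j : ℂ) + t) ≠ 0 :=
  Finset.prod_ne_zero_iff.mpr fun j _ => eps_add_ne ht j

lemma isRoot_fiberPoly {y t : ℂ} : (M.fiberPoly y).IsRoot t ↔ ¬ M.IsPole t ∧ M.R t = y := by
  constructor
  · intro h
    have ht := not_isPole_of_isRoot h
    refine ⟨ht, ?_⟩
    rw [Polynomial.IsRoot, eval_fiberPoly_of_not_isPole y ht, mul_eq_zero,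
      or_iff_left (prod_eps_add_ne_zero ht), sub_eq_zero] at h
    exact h
  · rintro ⟨ht, h⟩
    rw [Polynomial.IsRoot, eval_fiberPoly_of_not_isPole y ht, h, sub_self, zero_mul]

variable (M) in
lemma finite_R_eq (y : ℂ) : {z | M.R z = y}.Finite := by
  refine Set.Finite.subset (M.finite_poles.union
    (Polynomial.finite_setOfPred_isRoot (fiberPoly_ne_zero (M := M) y))) fun z hz => ?_
  by_cases h : M.IsPole z
  · exact Or.inl h
  · exact Or.inr (isRoot_fiberPoly.mpr ⟨h, hz⟩)

lemma nodup_roots_fiberPoly (k : Fin d) : (M.fiberPoly (M.e k)).roots.Nodup := by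
  rw [Multiset.nodup_iff_count_le_one]
  intro t
  rw [Polynomial.count_roots]
  by_contra! h
  rw [Polynomial.one_lt_rootMultiplicity_iff_isRoot (fiberPoly_ne_zero _)] at h
  obtain ⟨hr, hd⟩ := h
  have ht := not_isPole_of_isRoot hr
  have hR : M.R t = M.e k := (isRoot_fiberPoly.mp hr).2
  have him : t.im = 0 := by
    rw [← im_R_eq_zero (M := M), hR, ofReal_im]
  have e : (fun z => (M.fiberPoly (M.e k)).eval z) =ᶠ[𝓝 t]
      fun z => (M.R z - M.e k) * ∏ j, (M.ε j + z) :=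
    (eventually_not_isPole ht).mono fun z hz => eval_fiberPoly_of_not_isPole _ hz
  have h1 : HasDerivAt (fun z => (M.R z - M.e k) * ∏ j, (M.ε j + z))
      (M.U t t * ∏ j, (M.ε j + t)) t := by
    have hp : DifferentiableAt ℂ (fun z : ℂ => ∏ j, ((M.ε j : ℂ) + z)) t := by fun_prop
    have := ((hasDerivAt_R ht).sub_const (M.e k : ℂ)).fun_mul hp.hasDerivAt
    refine this.congr_deriv ?_
    rw [hR, sub_self, zero_mul, add_zero]
  have h2 : (Polynomial.derivative (M.fiberPoly (M.e k))).eval t = M.U t t * ∏ j, (M.ε j + t) := by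
    rw [← Polynomial.deriv, e.deriv_eq, h1.deriv]
  rw [Polynomial.IsRoot, h2] at hd
  exact mul_ne_zero (deriv_R_ne_zero_of_real him) (prod_eps_add_ne_zero ht) hd

/-- The preimages of `eₖ = R(εₖ)` other than `εₖ`. -/
def fiber (M : Model d) (k : Fin d) : Finset ℂ :=
  (M.fiberPoly (M.e k)).roots.toFinset.erase (M.ε k)

lemma mem_fiber {k : Fin d} {v : ℂ} :
    v ∈ M.fiber k ↔ ¬ M.IsPole v ∧ M.R v = M.e k ∧ v ≠ M.ε k := by
  rw [fiber, Finset.mem_erase, Multiset.mem_toFinset, Polynomial.mem_roots (fiberPoly_ne_zero _),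
    isRoot_fiberPoly]
  tauto

lemma coe_fiber (k : Fin d) : (M.fiber k : Set ℂ) = M.otherPreimages (M.ε k) := by
  ext v
  rw [Finset.mem_coe, mem_fiber, otherPreimages, R_ε]
  rfl

lemma ε_mem_roots (k : Fin d) : (M.ε k : ℂ) ∈ (M.fiberPoly (M.e k)).roots.toFinset := by
  rw [Multiset.mem_toFinset, Polynomial.mem_roots (fiberPoly_ne_zero _), isRoot_fiberPoly]
  exact ⟨not_isPole_ε k, M.R_ε k⟩

lemma card_roots_fiberPoly (k : Fin d) :
    (M.fiberPoly (M.e k)).roots.card = d + 1 := by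
  rw [← natDegree_fiberPoly (M := M) (M.e k)]
  exact (IsAlgClosed.splits _).natDegree_eq_card_roots.symm

variable (M) in
lemma card_fiber (k : Fin d) : (M.fiber k).card = d := by
  rw [fiber, Finset.card_erase_of_mem (ε_mem_roots k),
    Multiset.toFinset_card_of_nodup (nodup_roots_fiberPoly k), card_roots_fiberPoly,
    Nat.add_sub_cancel]

/-- Factorization over the fibre of `eₖ`. -/
lemma eval_fiberPoly_eq_prod (k : Fin d) (t : ℂ) :
    (M.fiberPoly (M.e k)).eval t = (t - M.ε k) * ∏ v ∈ M.fiber k, (t - v) := by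
  have h := (IsAlgClosed.splits (M.fiberPoly (M.e k))).eq_prod_roots_of_monic (monic_fiberPoly _)
  have h2 : ∏ v ∈ (M.fiberPoly (M.e k)).roots.toFinset, (t - v) =
      ((M.fiberPoly (M.e k)).roots.map fun v => t - v).prod := by
    rw [Finset.prod, Multiset.toFinset_val, (nodup_roots_fiberPoly k).dedup]
  rw [fiber, Finset.mul_prod_erase _ (fun v => t - v) (ε_mem_roots k), h2]
  conv_lhs => rw [h]
  rw [Polynomial.eval_multiset_prod, Multiset.map_map]
  simp

section fiber

variable {k : Fin d} {v : ℂ}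

lemma fiber_not_isPole (hv : v ∈ M.fiber k) : ¬ M.IsPole v := (mem_fiber.mp hv).1

lemma fiber_R (hv : v ∈ M.fiber k) : M.R v = M.e k := (mem_fiber.mp hv).2.1

lemma fiber_ne (hv : v ∈ M.fiber k) : v ≠ M.ε k := (mem_fiber.mp hv).2.2

lemma fiber_im (hv : v ∈ M.fiber k) : v.im = 0 := by
  rw [← im_R_eq_zero (M := M), fiber_R hv, ofReal_im]

lemma fiber_re (hv : v ∈ M.fiber k) : v.re < 0 := by
  by_contra! h
  apply fiber_ne hv
  have h1 := eq_ofReal (fiber_im hv)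
  have h2 := fiber_R hv
  rw [h1, ← R_ε] at h2
  rw [h1, R_injOn_nonneg h (M.ε_pos k).le h2]

lemma fiber_neg_not_isPole (hv : v ∈ M.fiber k) : ¬ M.IsPole (-v) :=
  not_isPole_of_re (by simpa using (fiber_re hv).le)

lemma fiber_deriv_ne_zero (hv : v ∈ M.fiber k) : M.U v v ≠ 0 :=
  deriv_R_ne_zero_of_real (fiber_im hv)

lemma fiber_deriv_neg_ne_zero (hv : v ∈ M.fiber k) : M.U (-v) (-v) ≠ 0 :=
  deriv_R_ne_zero_of_real (by simpa using fiber_im hv)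

/-- A negative preimage of a real number is determined by the value of `R` at its negative. -/
lemma fiber_eq_neg_of_R_eq {x : ℂ} (hv : v ∈ M.fiber k) (hx : x.im = 0) (hx0 : 0 ≤ x.re)
    (h : M.R (-v) = M.R x) :
    v = -x := by
  have h1 : -v = ((-v).re : ℂ) := eq_ofReal (by simpa using fiber_im hv)
  have h2 := eq_ofReal hx
  rw [h1, h2] at h
  have h3 := R_injOn_nonneg (by simpa using (fiber_re hv).le) hx0 h
  rw [eq_neg_iff_add_eq_zero, ← neg_eq_zero, neg_add, ← sub_eq_add_neg, sub_eq_zero, h1, h2, h3]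

lemma fiber_R_neg_ne (hv : v ∈ M.fiber k) (j : Fin d) : M.R (-v) ≠ M.e j := by
  rw [← R_ε]
  intro h
  exact fiber_not_isPole hv
    ⟨j, fiber_eq_neg_of_R_eq hv (ofReal_im _) (by simpa using (M.ε_pos j).le) h⟩

lemma fiber_R_neg_ne_R_zero (hv : v ∈ M.fiber k) : M.R (-v) ≠ M.R 0 := by
  intro h
  have := fiber_eq_neg_of_R_eq hv (x := 0) rfl le_rfl h
  have h2 := fiber_re hv
  simp [this] at h2

end fiber

lemma R_neg_injOn_fiber (k : Fin d) : Set.InjOn (fun v => M.R (-v)) (M.fiber k) := by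
  intro v hv w hw h
  have := fiber_eq_neg_of_R_eq hv (x := -w) (by simpa using fiber_im hw)
    (by simpa using (fiber_re hw).le) h
  simpa using this

end Model

lemma RegularAt.comp_neg {f : ℂ → ℂ} {a : ℂ} (h : RegularAt f (-a)) :
    RegularAt (fun z => f (-z)) a := by
  obtain ⟨g, hg, e⟩ := h
  refine ⟨fun z => g (-z), hg.fun_comp analyticAt_id.neg, ?_⟩
  have ht : Tendsto (fun z : ℂ => -z) (𝓝[≠] a) (𝓝[≠] (-a)) := by
    refine tendsto_nhdsWithin_of_tendsto_nhds_of_eventually_within _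
      ((continuous_neg.tendsto a).mono_left nhdsWithin_le_nhds) ?_
    filter_upwards [self_mem_nhdsWithin] with z hz h
    exact hz (neg_injective h)
  exact ht.eventually e

namespace Model

variable {d : ℕ} {M : Model d}

/-! ### The symmetric kernel of the two-point function -/

/-- The factorization of `R(t) - eₙ`, divided by `t - εₙ`. -/
lemma prod_sub_fiber (n : Fin d) {t : ℂ} (ht : ¬ M.IsPole t) :
    ∏ v ∈ M.fiber n, (t - v) = M.U t (M.ε n) * ∏ l, (M.ε l + t) := by
  have key : ∀ t, ¬ M.IsPole t → t ≠ M.ε n →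
      ∏ v ∈ M.fiber n, (t - v) = M.U t (M.ε n) * ∏ l, (M.ε l + t) := by
    intro t ht hn
    have h1 := eval_fiberPoly_eq_prod (M := M) n t
    rw [eval_fiberPoly_of_not_isPole _ ht, ← R_ε, R_sub ht (not_isPole_ε n), mul_assoc] at h1
    exact (mul_left_cancel₀ (sub_ne_zero.mpr hn) h1).symm
  by_cases hn : t = M.ε n
  · have h1 : ContinuousAt (fun t => ∏ v ∈ M.fiber n, (t - v)) t := by fun_prop
    have h2 : ContinuousAt (fun t => M.U t (M.ε n) * ∏ l, (M.ε l + t)) t :=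
      (analyticAt_U analyticAt_id analyticAt_const ht (not_isPole_ε n)).continuousAt.mul
        (by fun_prop)
    refine tendsto_nhds_unique (f := fun t => ∏ v ∈ M.fiber n, (t - v)) (l := 𝓝[≠] t)
      (h1.tendsto.mono_left nhdsWithin_le_nhds)
      ((h2.tendsto.mono_left nhdsWithin_le_nhds).congr' ?_)
    filter_upwards [self_mem_nhdsWithin,
      nhdsWithin_le_nhds (eventually_not_isPole ht)] with s hs hs'
    exact (key s hs' (fun h => hs (by rw [h, hn]; rfl))).symm
  · exact key t ht hn

lemma prod_neg_sub_fiber (n j : Fin d) :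
    ((M.ε j : ℂ) + M.ε n) * ∏ v ∈ M.fiber n, (-(M.ε j : ℂ) - v) =
      M.c * M.ρ j * ∏ i ∈ Finset.univ.erase j, ((M.ε i : ℂ) - M.ε j) := by
  have h1 := eval_fiberPoly_eq_prod (M := M) n (-(M.ε j : ℂ))
  rw [eval_fiberPoly_pole] at h1
  linear_combination h1

/-- The residue of the rational function `h n` at `eⱼ`. -/
def H (M : Model d) (n j : Fin d) : ℂ :=
  (∏ v ∈ M.fiber n, (M.e j - M.R (-v))) / ∏ i ∈ Finset.univ.erase j, ((M.e j : ℂ) - M.e i)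

/-- The rational function `∏ᵥ (y - R(-v)) / ∏ⱼ (y - eⱼ)`, where `v` runs through the preimages
of `eₙ` other than `εₙ`. -/
def h (M : Model d) (n : Fin d) (y : ℂ) : ℂ :=
  (∏ v ∈ M.fiber n, (y - M.R (-v))) / ∏ j, (y - M.e j)

lemma h_eq (n : Fin d) {y : ℂ} (hy : ∀ k, y ≠ M.e k) :
    M.h n y = 1 + ∑ j, M.H n j / (y - M.e j) := by
  have hm : (∏ v ∈ M.fiber n, (Polynomial.X - Polynomial.C (M.R (-v)))).Monic :=
    Polynomial.monic_prod_X_sub_C _ _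
  have hd : (∏ v ∈ M.fiber n, (Polynomial.X - Polynomial.C (M.R (-v)))).natDegree =
      (Finset.univ : Finset (Fin d)).card := by
    rw [Polynomial.natDegree_finsetProd_X_sub_C_eq_card, M.card_fiber]
    simp
  have := eval_div_prod_eq Finset.univ (fun j => (M.e j : ℂ)) (fun i _ j _ hij => M.e_inj.mp hij)
    _ hm hd (y := y) (fun j _ => hy j)
  simpa [Polynomial.eval_prod, h, H] using this

lemma h_R_neg {n : Fin d} {v : ℂ} (hv : v ∈ M.fiber n) : M.h n (M.R (-v)) = 0 := by
  rw [h, Finset.prod_eq_zero (f := fun u => M.R (-v) - M.R (-u)) hv (sub_self _), zero_div]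

lemma U_ε_ne_zero (i j : Fin d) : M.U (M.ε i) (M.ε j) ≠ 0 := U_pos (M.ε_pos i).le (M.ε_pos j).le

lemma eps_add_eps_ne_zero (i j : Fin d) : (M.ε i : ℂ) + M.ε j ≠ 0 :=
  eps_add_ne (not_isPole_ε j) i

lemma prod_fiber_mul (n j : Fin d) :
    (∏ v ∈ M.fiber n, (M.e j - M.R (-v))) *
      ((∏ i, M.U (M.ε i) (M.ε n)) * (∏ i, ∏ l, ((M.ε l : ℂ) + M.ε i)) * (M.ε j + M.ε n)) =
    (-1) ^ d * (M.c * M.ρ j * ∏ i ∈ Finset.univ.erase j, ((M.ε i : ℂ) - M.ε j)) *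
      ∏ v ∈ M.fiber n, ∏ u ∈ M.fiber j, (-v - u) := by
  have h1 : ∀ v ∈ M.fiber n, (M.e j - M.R (-v)) * ∏ i, (M.ε i - v) =
      -1 * (-M.ε j - v) * ∏ u ∈ M.fiber j, (-v - u) := by
    intro v hv
    have := eval_fiberPoly_eq_prod (M := M) j (-v)
    rw [eval_fiberPoly_of_not_isPole _ (fiber_neg_not_isPole hv)] at this
    simp only [← sub_eq_add_neg] at this
    linear_combination -this
  have h2 := Finset.prod_congr rfl h1
  rw [Finset.prod_mul_distrib, Finset.prod_mul_distrib, Finset.prod_mul_distrib, Finset.prod_const,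
    M.card_fiber, Finset.prod_comm] at h2
  have h3 : ∏ i, ∏ v ∈ M.fiber n, ((M.ε i : ℂ) - v) =
      (∏ i, M.U (M.ε i) (M.ε n)) * ∏ i, ∏ l, ((M.ε l : ℂ) + M.ε i) := by
    rw [← Finset.prod_mul_distrib]
    exact Finset.prod_congr rfl fun i _ => prod_sub_fiber n (not_isPole_ε i)
  rw [h3] at h2
  rw [← prod_neg_sub_fiber n j]
  linear_combination ((M.ε j : ℂ) + M.ε n) * h2

lemma prod_e_sub (j : Fin d) : ∏ i ∈ Finset.univ.erase j, ((M.e j : ℂ) - M.e i) =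
    (-1) ^ (d - 1) * (∏ i ∈ Finset.univ.erase j, ((M.ε i : ℂ) - M.ε j)) *
      ∏ i ∈ Finset.univ.erase j, M.U (M.ε i) (M.ε j) := by
  have hc : (-1 : ℂ) ^ (d - 1) = ∏ i ∈ Finset.univ.erase j, (-1 : ℂ) := by simp
  rw [hc, ← Finset.prod_mul_distrib, ← Finset.prod_mul_distrib]
  refine Finset.prod_congr rfl fun i _ => ?_
  have := R_sub (M := M) (not_isPole_ε i) (not_isPole_ε j)
  rw [R_ε, R_ε] at this
  linear_combination -this

/-- The symmetry behind `𝒢⁽⁰⁾(z,w) = 𝒢⁽⁰⁾(w,z)`: up to a factor symmetric in `k` and `j`, both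
sides are the product of all `-v - u`, where `v` and `u` run through the two fibres. -/
lemma r_mul_H (k j : Fin d) : M.r k * M.H k j = M.r j * M.H j k := by
  have hU : ∀ j, ∏ i ∈ Finset.univ.erase j, M.U (M.ε i) (M.ε j) ≠ 0 := fun j =>
    Finset.prod_ne_zero_iff.mpr fun i _ => U_ε_ne_zero i j
  have hK : ∏ i, ∏ l, ((M.ε l : ℂ) + M.ε i) ≠ 0 := Finset.prod_ne_zero_iff.mpr fun i _ =>
    Finset.prod_ne_zero_iff.mpr fun l _ => eps_add_eps_ne_zero l i
  -- the left-hand factor of `r n * H n j` and the right-hand side are symmetric in `n` and `j`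
  have main : ∀ n j, (M.r n * M.H n j) * ((-1) ^ (d - 1) *
      (∏ i ∈ Finset.univ.erase n, M.U (M.ε i) (M.ε n)) *
      (∏ i ∈ Finset.univ.erase j, M.U (M.ε i) (M.ε j)) *
      (∏ i, ∏ l, ((M.ε l : ℂ) + M.ε i)) * (M.ε j + M.ε n)) =
      (-1) ^ d * M.c * M.ρ j * M.ρ n * ∏ v ∈ M.fiber n, ∏ u ∈ M.fiber j, (-v - u) := by
    intro n j
    have h1 := prod_fiber_mul (M := M) n j
    have h2 : M.H n j * ∏ i ∈ Finset.univ.erase j, ((M.e j : ℂ) - M.e i) =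
        ∏ v ∈ M.fiber n, (M.e j - M.R (-v)) := by
      rw [H, div_mul_cancel₀]
      refine Finset.prod_ne_zero_iff.mpr fun i hi => sub_ne_zero.mpr fun h => ?_
      exact Finset.ne_of_mem_erase hi (M.e_inj.mp h).symm
    rw [← h2, prod_e_sub, ← Finset.mul_prod_erase _ _ (Finset.mem_univ n)] at h1
    refine mul_left_cancel₀ (prod_eps_sub_ne_zero (M := M) j) ?_
    rw [← ρ_mul_deriv]
    linear_combination (M.ρ n : ℂ) * h1
  have h1 := main k j
  have h2 := main j k
  have hW : ∏ v ∈ M.fiber k, ∏ u ∈ M.fiber j, (-v - u) =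
      ∏ v ∈ M.fiber j, ∏ u ∈ M.fiber k, (-v - u) := by
    rw [Finset.prod_comm]
    exact Finset.prod_congr rfl fun v _ => Finset.prod_congr rfl fun u _ => by ring
  rw [hW] at h1
  refine mul_right_cancel₀ (mul_ne_zero (mul_ne_zero (mul_ne_zero (mul_ne_zero
    (pow_ne_zero (d - 1) (neg_ne_zero.mpr one_ne_zero)) (hU k)) (hU j)) hK)
    (eps_add_eps_ne_zero (M := M) j k)) ?_
  linear_combination h1 - h2

/-- The symmetric rational function `P` with
`𝒢⁽⁰⁾(z,w) = P(R(z),R(w)) / ((R(z) - R(-w)) (R(w) - R(-z)))`. -/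
def P (M : Model d) (x y : ℂ) : ℂ :=
  x + y + M.c * ∑ k, M.r k / (M.e k - x) + M.c * ∑ k, M.r k / (M.e k - y) -
    M.c * ∑ k, ∑ j, M.r k * M.H k j / ((x - M.e k) * (y - M.e j))

/-- The partial derivative of `P` in its first argument. -/
def P₁ (M : Model d) (x y : ℂ) : ℂ :=
  1 + M.c * ∑ k, M.r k / (M.e k - x) ^ 2 +
    M.c * ∑ k, ∑ j, M.r k * M.H k j / ((x - M.e k) ^ 2 * (y - M.e j))

lemma sum_H_swap (f : Fin d → Fin d → ℂ) :
    ∑ k, ∑ j, M.r k * M.H k j / f k j = ∑ k, ∑ j, M.r k * M.H k j / f j k := by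
  rw [Finset.sum_comm]
  exact Finset.sum_congr rfl fun k _ => Finset.sum_congr rfl fun j _ => by rw [r_mul_H]

variable (M) in
lemma P_symm (x y : ℂ) : M.P x y = M.P y x := by
  rw [P, P, sum_H_swap]
  have : ∀ k j, (x - M.e j) * (y - M.e k) = (y - M.e k) * (x - M.e j) := fun k j => mul_comm _ _
  simp only [this]
  ring

lemma hasDerivAt_P {f g : ℂ → ℂ} {f' g' a : ℂ} (hf : HasDerivAt f f' a) (hg : HasDerivAt g g' a)
    (h1 : ∀ k, f a ≠ M.e k) (h2 : ∀ k, g a ≠ M.e k) :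
    HasDerivAt (fun z => M.P (f z) (g z)) (M.P₁ (f a) (g a) * f' + M.P₁ (g a) (f a) * g') a := by
  have n1 : ∀ k, f a - M.e k ≠ 0 := fun k => sub_ne_zero.mpr (h1 k)
  have n2 : ∀ k, g a - M.e k ≠ 0 := fun k => sub_ne_zero.mpr (h2 k)
  have n1' : ∀ k, M.e k - f a ≠ 0 := fun k => sub_ne_zero.mpr (h1 k).symm
  have n2' : ∀ k, M.e k - g a ≠ 0 := fun k => sub_ne_zero.mpr (h2 k).symm
  have e1 : ∀ k ∈ Finset.univ, HasDerivAt (fun z => (M.r k : ℂ) / (M.e k - f z))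
      (M.r k / (M.e k - f a) ^ 2 * f') a := fun k _ =>
    ((hasDerivAt_const a (M.r k : ℂ)).fun_div (hf.const_sub (M.e k : ℂ)) (n1' k)).congr_deriv
      (by ring)
  have e2 : ∀ k ∈ Finset.univ, HasDerivAt (fun z => (M.r k : ℂ) / (M.e k - g z))
      (M.r k / (M.e k - g a) ^ 2 * g') a := fun k _ =>
    ((hasDerivAt_const a (M.r k : ℂ)).fun_div (hg.const_sub (M.e k : ℂ)) (n2' k)).congr_deriv
      (by ring)
  have e3 : ∀ k ∈ Finset.univ, HasDerivAt
      (fun z => ∑ j, M.r k * M.H k j / ((f z - M.e k) * (g z - M.e j)))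
      (∑ j, (-(M.r k * M.H k j / ((f a - M.e k) ^ 2 * (g a - M.e j))) * f' +
        -(M.r k * M.H k j / ((g a - M.e j) ^ 2 * (f a - M.e k))) * g')) a := by
    intro k _
    refine HasDerivAt.fun_sum fun j _ => ?_
    refine ((hasDerivAt_const a (M.r k * M.H k j)).fun_div
      ((hf.sub_const (M.e k : ℂ)).fun_mul (hg.sub_const (M.e j : ℂ)))
      (mul_ne_zero (n1 k) (n2 j))).congr_deriv ?_
    have := n1 k
    have := n2 j
    field_simp
    ring
  have e4 := (((hf.fun_add hg).fun_add ((HasDerivAt.fun_sum e1).const_mul (M.c : ℂ))).fun_add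
    ((HasDerivAt.fun_sum e2).const_mul (M.c : ℂ))).fun_sub
    ((HasDerivAt.fun_sum e3).const_mul (M.c : ℂ))
  refine e4.congr_deriv ?_
  have e5 := sum_H_swap (M := M) fun k j => (g a - M.e j) ^ 2 * (f a - M.e k)
  simp only [P₁, Finset.sum_add_distrib, ← Finset.sum_mul, Finset.sum_neg_distrib]
  rw [e5]
  ring

lemma analyticAt_P {f g : ℂ → ℂ} {a : ℂ} (hf : AnalyticAt ℂ f a) (hg : AnalyticAt ℂ g a)
    (h1 : ∀ k, f a ≠ M.e k) (h2 : ∀ k, g a ≠ M.e k) :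
    AnalyticAt ℂ (fun z => M.P (f z) (g z)) a := by
  unfold P
  have n1 : ∀ k, f a - M.e k ≠ 0 := fun k => sub_ne_zero.mpr (h1 k)
  have n2 : ∀ k, g a - M.e k ≠ 0 := fun k => sub_ne_zero.mpr (h2 k)
  have n1' : ∀ k, M.e k - f a ≠ 0 := fun k => sub_ne_zero.mpr (h1 k).symm
  have n2' : ∀ k, M.e k - g a ≠ 0 := fun k => sub_ne_zero.mpr (h2 k).symm
  refine (((hf.add hg).add (analyticAt_const.mul (Finset.analyticAt_fun_sum _ fun k _ =>
    analyticAt_const.div (analyticAt_const.sub hf) (n1' k)))).add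
    (analyticAt_const.mul (Finset.analyticAt_fun_sum _ fun k _ =>
    analyticAt_const.div (analyticAt_const.sub hg) (n2' k)))).sub
    (analyticAt_const.mul (Finset.analyticAt_fun_sum _ fun k _ => Finset.analyticAt_fun_sum _
    fun j _ => analyticAt_const.div ((hf.sub analyticAt_const).mul (hg.sub analyticAt_const))
    (mul_ne_zero (n1 k) (n2 j))))

lemma analyticAt_P₁ {f g : ℂ → ℂ} {a : ℂ} (hf : AnalyticAt ℂ f a) (hg : AnalyticAt ℂ g a)
    (h1 : ∀ k, f a ≠ M.e k) (h2 : ∀ k, g a ≠ M.e k) :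
    AnalyticAt ℂ (fun z => M.P₁ (f z) (g z)) a := by
  unfold P₁
  have n1 : ∀ k, f a - M.e k ≠ 0 := fun k => sub_ne_zero.mpr (h1 k)
  have n2 : ∀ k, g a - M.e k ≠ 0 := fun k => sub_ne_zero.mpr (h2 k)
  have n1' : ∀ k, M.e k - f a ≠ 0 := fun k => sub_ne_zero.mpr (h1 k).symm
  refine (analyticAt_const.add (analyticAt_const.mul (Finset.analyticAt_fun_sum _ fun k _ =>
    analyticAt_const.div ((analyticAt_const.sub hf).pow 2) (pow_ne_zero 2 (n1' k))))).add
    (analyticAt_const.mul (Finset.analyticAt_fun_sum _ fun k _ => Finset.analyticAt_fun_sum _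
    fun j _ => analyticAt_const.div (((hf.sub analyticAt_const).pow 2).mul
    (hg.sub analyticAt_const)) (mul_ne_zero (pow_ne_zero 2 (n1 k)) (n2 j))))

lemma meromorphicAt_P {f g : ℂ → ℂ} {a : ℂ} (hf : MeromorphicAt f a) (hg : MeromorphicAt g a) :
    MeromorphicAt (fun z => M.P (f z) (g z)) a := by
  unfold P
  have hc : ∀ u : ℂ, MeromorphicAt (fun _ : ℂ => u) a := fun u => MeromorphicAt.const u a
  exact (((hf.fun_add hg).fun_add ((hc _).fun_mul (MeromorphicAt.fun_sum fun k _ =>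
    (hc _).fun_div ((hc _).fun_sub hf)))).fun_add ((hc _).fun_mul (MeromorphicAt.fun_sum fun k _ =>
    (hc _).fun_div ((hc _).fun_sub hg)))).fun_sub ((hc _).fun_mul (MeromorphicAt.fun_sum fun k _ =>
    MeromorphicAt.fun_sum fun j _ => (hc _).fun_div ((hf.fun_sub (hc _)).fun_mul
      (hg.fun_sub (hc _)))))

/-- The points where `z`, `-z` are no poles of `R` and `R(z)`, `R(-z)` differ from all `eₖ`. -/
structure Gen (M : Model d) (z : ℂ) : Prop where
  np : ¬ M.IsPole z
  np_neg : ¬ M.IsPole (-z)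
  ne : ∀ k, M.R z ≠ M.e k
  ne_neg : ∀ k, M.R (-z) ≠ M.e k

lemma Gen.neg {z : ℂ} (h : M.Gen z) : M.Gen (-z) :=
  ⟨h.np_neg, by simpa using h.np, h.ne_neg, by simpa using h.ne⟩

lemma Gen.eventually {z : ℂ} (h : M.Gen z) : ∀ᶠ w in 𝓝 z, M.Gen w := by
  filter_upwards [eventually_not_isPole h.np, eventually_not_isPole_neg h.np_neg,
    eventually_all.mpr fun k => (analyticAt_R h.np).continuousAt.eventually_ne (h.ne k),
    eventually_all.mpr fun k => (analyticAt_R_neg h.np_neg).continuousAt.eventually_ne (h.ne_neg k)]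
    with w h1 h2 h3 h4
  exact ⟨h1, h2, h3, h4⟩

lemma gen_iff {z : ℂ} : M.Gen z ↔ ¬ M.IsPole z ∧ ¬ M.IsPole (-z) ∧
    (∀ k, z ∉ M.fiber k) ∧ ∀ k, -z ∉ M.fiber k := by
  have key : ∀ z, ¬ M.IsPole z → ¬ M.IsPole (-z) → ((∀ k, M.R z ≠ M.e k) ↔ ∀ k, z ∉ M.fiber k) := by
    intro z h1 h2
    refine forall_congr' fun k => not_congr ?_
    rw [mem_fiber]
    refine ⟨fun h => ⟨h1, h, ?_⟩, fun h => h.2.1⟩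
    rintro rfl
    exact h2 ⟨k, rfl⟩
  constructor
  · intro h
    exact ⟨h.np, h.np_neg, (key z h.np h.np_neg).mp h.ne,
      (key (-z) h.np_neg (by simpa using h.np)).mp h.ne_neg⟩
  · rintro ⟨h1, h2, h3, h4⟩
    exact ⟨h1, h2, (key z h1 h2).mpr h3, (key (-z) h2 (by simpa using h1)).mpr h4⟩

/-- The finite set of points violating `Gen`. -/
def badSet (M : Model d) : Finset ℂ :=
  (Finset.univ.image fun k => -(M.ε k : ℂ)) ∪ (Finset.univ.image fun k => (M.ε k : ℂ)) ∪
    (Finset.univ.biUnion M.fiber) ∪ (Finset.univ.biUnion M.fiber).image fun z => -z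

lemma not_mem_badSet {z : ℂ} : z ∉ M.badSet ↔ M.Gen z := by
  rw [gen_iff, badSet]
  simp only [Finset.mem_union, Finset.mem_image, Finset.mem_biUnion, Finset.mem_univ, true_and,
    not_or, not_exists, IsPole]
  constructor
  · rintro ⟨⟨⟨h1, h2⟩, h3⟩, h4⟩
    exact ⟨fun k h => h1 k h.symm, fun k h => h2 k (neg_injective h).symm, h3,
      fun k h => h4 (-z) ⟨⟨k, h⟩, neg_neg z⟩⟩
  · rintro ⟨h1, h2, h3, h4⟩
    refine ⟨⟨⟨fun k h => h1 k h.symm, fun k h => h2 k (by rw [h])⟩, h3⟩, ?_⟩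
    rintro w ⟨⟨k, hk⟩, rfl⟩
    exact h4 k (by simpa using hk)

lemma eventually_gen (z : ℂ) : ∀ᶠ w in 𝓝[≠] z, M.Gen w := by
  have h := (M.badSet.finite_toSet.subset (Set.sdiff_subset (t := {z}))).isClosed.isOpen_compl
  filter_upwards [nhdsWithin_le_nhds (h.mem_nhds (show z ∈ _ by simp)), self_mem_nhdsWithin]
    with w hw hwz
  refine not_mem_badSet.mp fun hw' => hw ⟨by exact_mod_cast hw', hwz⟩

lemma tendsto_div_sub {f : ℂ → ℂ} {f' a : ℂ} (hf : HasDerivAt f f' a) (hf' : f' ≠ 0) :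
    Tendsto (fun z => (z - a) / (f a - f z)) (𝓝[≠] a) (𝓝 (-f'⁻¹)) := by
  have h1 := (hasDerivAt_iff_tendsto_slope.mp hf).inv₀ hf'
  refine h1.neg.congr fun z => ?_
  rw [slope_def_field, inv_div, ← neg_sub (f z) (f a), div_neg]

/-- At the pole `-εⱼ` of `R`, the relation `ρⱼ R'(εⱼ) = rⱼ` cancels the pole of
`P(R(z), R(-z))`. -/
lemma regularAt_P_pole (j : Fin d) :
    RegularAt (fun z => M.P (M.R z) (M.R (-z))) (-(M.ε j : ℂ)) := by
  refine regularAt_of_mul_tendsto_zero (u := fun z => z - -(M.ε j : ℂ))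
    (meromorphicAt_P (meromorphicAt_R _) (meromorphicAt_R_neg _)) (by fun_prop) (sub_self _)
    (by simp) ?_
  have hY : ContinuousAt (fun z => M.R (-z)) (-(M.ε j : ℂ)) :=
    (analyticAt_R_neg (by simpa using not_isPole_ε j)).continuousAt
  have hY' : Tendsto (fun z => M.R (-z)) (𝓝[≠] (-(M.ε j : ℂ))) (𝓝 (M.e j)) := by
    have := hY.tendsto
    rw [neg_neg, R_ε] at this
    exact this.mono_left nhdsWithin_le_nhds
  have hu : Tendsto (fun z : ℂ => z - -(M.ε j : ℂ)) (𝓝[≠] (-(M.ε j : ℂ))) (𝓝 0) := by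
    have : ContinuousAt (fun z : ℂ => z - -(M.ε j : ℂ)) (-(M.ε j : ℂ)) := by fun_prop
    have h := this.tendsto
    rw [sub_self] at h
    exact h.mono_left nhdsWithin_le_nhds
  have huX : Tendsto (fun z => (z - -(M.ε j : ℂ)) * M.R z) (𝓝[≠] (-(M.ε j : ℂ)))
      (𝓝 (-(M.c * M.ρ j))) := by
    refine (tendsto_sub_mul_R j).congr fun z => ?_
    ring
  have hX : ∀ e : ℂ, Tendsto (fun z => (e - M.R z)⁻¹) (𝓝[≠] (-(M.ε j : ℂ))) (𝓝 0) := fun e =>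
    (tendsto_inv_const_sub_cocompact e).comp (tendsto_R_pole j)
  have hU := U_ε_ne_zero (M := M) j j
  have hd : HasDerivAt (fun z => M.R (-z)) (-M.U (M.ε j) (M.ε j)) (-(M.ε j : ℂ)) := by
    have := hasDerivAt_R_neg (M := M) (z := -(M.ε j : ℂ)) (by simpa using not_isPole_ε j)
    simpa using this
  have huY : ∀ k, Tendsto (fun z => (z - -(M.ε j : ℂ)) * (M.e k - M.R (-z))⁻¹)
      (𝓝[≠] (-(M.ε j : ℂ))) (𝓝 (if k = j then (M.U (M.ε j) (M.ε j))⁻¹ else 0)) := by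
    intro k
    split_ifs with hk
    · subst hk
      have := tendsto_div_sub hd (neg_ne_zero.mpr hU)
      simp only [neg_neg, R_ε, inv_neg] at this
      simpa [div_eq_mul_inv] using this
    · have h1 : Tendsto (fun z => (M.e k - M.R (-z))⁻¹) (𝓝[≠] (-(M.ε j : ℂ)))
          (𝓝 (M.e k - M.e j : ℂ)⁻¹) :=
        (tendsto_const_nhds.sub hY').inv₀ (sub_ne_zero.mpr fun h => hk (M.e_inj.mp h))
      simpa using hu.mul h1
  have h1 := (((huX.add (hu.mul hY')).add ((tendsto_finsetSum Finset.univ fun k _ =>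
    (hu.mul (hX (M.e k))).const_mul (M.r k : ℂ)).const_mul (M.c : ℂ))).add
    ((tendsto_finsetSum Finset.univ fun k _ => (huY k).const_mul (M.r k : ℂ)).const_mul
      (M.c : ℂ))).sub ((tendsto_finsetSum Finset.univ fun k _ => tendsto_finsetSum Finset.univ
      fun l _ => ((hX (M.e k)).mul (huY l)).const_mul (M.r k * M.H k l)).const_mul (M.c : ℂ))
  have h2 : -(M.c * M.ρ j : ℂ) + 0 * M.e j + M.c * ∑ k, (M.r k : ℂ) * (0 * 0) + M.c * ∑ k,
      (M.r k : ℂ) * (if k = j then (M.U (M.ε j) (M.ε j))⁻¹ else 0) - M.c * ∑ k, ∑ l,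
      (M.r k * M.H k l) * (0 * (if l = j then (M.U (M.ε j) (M.ε j))⁻¹ else 0)) = 0 := by
    simp only [zero_mul, mul_zero, Finset.sum_const_zero, mul_ite, Finset.sum_ite_eq',
      Finset.mem_univ, if_true, ← ρ_mul_deriv]
    field_simp
    ring
  rw [h2] at h1
  refine h1.congr fun z => ?_
  rw [P]
  have e1 : ∀ k l, ((M.e k : ℂ) - M.R z)⁻¹ * ((z - -(M.ε j : ℂ)) * (M.e l - M.R (-z))⁻¹) =
      (z - -(M.ε j : ℂ)) * ((M.R z - M.e k) * (M.R (-z) - M.e l))⁻¹ := by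
    intro k l
    rw [← neg_sub (M.R z), ← neg_sub (M.R (-z)), mul_inv, inv_neg, inv_neg]
    ring
  simp only [e1, div_eq_mul_inv, mul_sub, mul_add, Finset.mul_sum]
  congr 1
  · congr 1
    · congr 1
      exact Finset.sum_congr rfl fun k _ => by ring
    · exact Finset.sum_congr rfl fun k _ => by ring
  · exact Finset.sum_congr rfl fun k _ => Finset.sum_congr rfl fun l _ => by ring

/-- At a preimage `v ≠ εⱼ` of `eⱼ`, the zero of `h j` in `R(-v)` cancels the pole of
`P(R(z), R(-z))`. -/
lemma regularAt_P_fiber {j : Fin d} {v : ℂ} (hv : v ∈ M.fiber j) :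
    RegularAt (fun z => M.P (M.R z) (M.R (-z))) v := by
  refine regularAt_of_mul_tendsto_zero (u := fun z => z - v)
    (meromorphicAt_P (meromorphicAt_R _) (meromorphicAt_R_neg _)) (by fun_prop) (sub_self _)
    (by simp) ?_
  have hY : Tendsto (fun z => M.R (-z)) (𝓝[≠] v) (𝓝 (M.R (-v))) :=
    (analyticAt_R_neg (fiber_neg_not_isPole hv)).continuousAt.tendsto.mono_left nhdsWithin_le_nhds
  have hX : Tendsto M.R (𝓝[≠] v) (𝓝 (M.e j)) := by
    have := (analyticAt_R (fiber_not_isPole hv)).continuousAt.tendsto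
    rw [fiber_R hv] at this
    exact this.mono_left nhdsWithin_le_nhds
  have hu : Tendsto (fun z : ℂ => z - v) (𝓝[≠] v) (𝓝 0) := by
    have : ContinuousAt (fun z : ℂ => z - v) v := by fun_prop
    have h := this.tendsto
    rw [sub_self] at h
    exact h.mono_left nhdsWithin_le_nhds
  have hU := fiber_deriv_ne_zero hv
  have hY2 : ∀ k, Tendsto (fun z => (M.e k - M.R (-z))⁻¹) (𝓝[≠] v) (𝓝 (M.e k - M.R (-v))⁻¹) :=
    fun k => (tendsto_const_nhds.sub hY).inv₀ (sub_ne_zero.mpr (fiber_R_neg_ne hv k).symm)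
  have huX : ∀ k, Tendsto (fun z => (z - v) * (M.e k - M.R z)⁻¹)
      (𝓝[≠] v) (𝓝 (if k = j then -(M.U v v)⁻¹ else 0)) := by
    intro k
    split_ifs with hk
    · subst hk
      have := tendsto_div_sub (hasDerivAt_R (fiber_not_isPole hv)) hU
      rw [fiber_R hv] at this
      simpa [div_eq_mul_inv] using this
    · have h1 : Tendsto (fun z => (M.e k - M.R z)⁻¹) (𝓝[≠] v)
          (𝓝 (M.e k - M.e j : ℂ)⁻¹) :=
        (tendsto_const_nhds.sub hX).inv₀ (sub_ne_zero.mpr fun h => hk (M.e_inj.mp h))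
      simpa using hu.mul h1
  have h1 := ((((hu.mul hX).add (hu.mul hY)).add ((tendsto_finsetSum Finset.univ fun k _ =>
    (huX k).const_mul (M.r k : ℂ)).const_mul (M.c : ℂ))).add
    ((tendsto_finsetSum Finset.univ fun k _ => (hu.mul (hY2 k)).const_mul (M.r k : ℂ)).const_mul
      (M.c : ℂ))).sub ((tendsto_finsetSum Finset.univ fun k _ => tendsto_finsetSum Finset.univ
      fun l _ => ((huX k).mul (hY2 l)).const_mul (M.r k * M.H k l)).const_mul (M.c : ℂ))
  have h2 : 0 * (M.e j : ℂ) + 0 * M.R (-v) + M.c * ∑ k, (M.r k : ℂ) *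
      (if k = j then -(M.U v v)⁻¹ else 0) + M.c * ∑ k, (M.r k : ℂ) *
      (0 * (M.e k - M.R (-v))⁻¹) - M.c * ∑ k, ∑ l,
      (M.r k * M.H k l) * ((if k = j then -(M.U v v)⁻¹ else 0) * (M.e l - M.R (-v))⁻¹) = 0 := by
    have h3 := h_eq (M := M) j (fiber_R_neg_ne hv)
    rw [h_R_neg hv] at h3
    have h4 : ∀ k, ∑ l, (M.r k * M.H k l) * ((if k = j then -(M.U v v)⁻¹ else 0) *
        (M.e l - M.R (-v))⁻¹) = if k = j then ∑ l, M.r j * (M.U v v)⁻¹ *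
          (M.H j l / (M.R (-v) - M.e l)) else 0 := by
      intro k
      split_ifs with hk
      · subst hk
        refine Finset.sum_congr rfl fun l _ => ?_
        rw [← neg_sub (M.R (-v)), inv_neg]
        ring
      · simp
    simp only [h4]
    simp only [zero_mul, mul_zero, Finset.sum_const_zero, mul_ite, Finset.sum_ite_eq',
      Finset.mem_univ, if_true, ← Finset.mul_sum]
    linear_combination M.c * M.r j * (M.U v v)⁻¹ * h3
  rw [h2] at h1
  refine h1.congr fun z => ?_
  rw [P]
  have e1 : ∀ k l, ((z - v) * (M.e k - M.R z)⁻¹) * (M.e l - M.R (-z))⁻¹ =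
      (z - v) * ((M.R z - M.e k) * (M.R (-z) - M.e l))⁻¹ := by
    intro k l
    rw [← neg_sub (M.R z), ← neg_sub (M.R (-z)), mul_inv, inv_neg, inv_neg]
    ring
  simp only [e1, div_eq_mul_inv, mul_sub, mul_add, Finset.mul_sum]
  congr 1
  · congr 1
    · congr 1
      exact Finset.sum_congr rfl fun k _ => by ring
    · exact Finset.sum_congr rfl fun k _ => by ring
  · exact Finset.sum_congr rfl fun k _ => Finset.sum_congr rfl fun l _ => by ring

lemma tendsto_R_add_R_neg : Tendsto (fun z => M.R z + M.R (-z)) (cocompact ℂ) (𝓝 0) := by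
  have h0 := tendsto_inv₀_cobounded (α := ℂ)
  rw [Metric.cobounded_eq_cocompact] at h0
  have h1 : ∀ k ∈ Finset.univ, Tendsto (fun z : ℂ => (M.ρ k : ℂ) / (M.ε k + z))
      (cocompact ℂ) (𝓝 0) := by
    intro k _
    simpa [div_eq_mul_inv] using (h0.comp
      (Homeomorph.addLeft (M.ε k : ℂ)).isClosedEmbedding.tendsto_cocompact).const_mul (M.ρ k : ℂ)
  have h2 : Tendsto (fun z : ℂ => ∑ k, (M.ρ k : ℂ) / (M.ε k + z)) (cocompact ℂ) (𝓝 0) := by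
    simpa using tendsto_finsetSum _ h1
  have h3 := h2.comp (Homeomorph.neg ℂ).isClosedEmbedding.tendsto_cocompact
  have h4 := (h2.add h3).const_mul (-M.c : ℂ)
  simp only [add_zero, mul_zero] at h4
  refine h4.congr fun z => ?_
  rw [R_eq, R_eq]
  simp only [Function.comp, Homeomorph.coe_neg]
  ring

/-- The kernel `P` vanishes along the curve `(R(z), R(-z))`: the function `P(R(z), R(-z))` has
only removable singularities and tends to zero at infinity. -/
theorem P_R_R_neg {z : ℂ} (hz : M.Gen z) : M.P (M.R z) (M.R (-z)) = 0 := by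
  have hs : (fun z => M.P (M.R z) (M.R (-z))) = fun z => M.P (M.R (-z)) (M.R (- -z)) := by
    funext z
    rw [neg_neg, P_symm]
  have ha : ∀ z, M.Gen z → AnalyticAt ℂ (fun z => M.P (M.R z) (M.R (-z))) z := fun z hz =>
    analyticAt_P (analyticAt_R hz.np) (analyticAt_R_neg hz.np_neg) hz.ne hz.ne_neg
  have hneg : ∀ z, RegularAt (fun z => M.P (M.R z) (M.R (-z))) (-z) →
      RegularAt (fun z => M.P (M.R z) (M.R (-z))) z := by
    intro z h
    rw [hs]
    exact h.comp_neg
  refine eq_of_tendsto_cocompact (fun z => ?_) ?_ M.badSet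
    (fun z hz => ha z (not_mem_badSet.mp hz)) (not_mem_badSet.mpr hz)
  · by_cases h : M.Gen z
    · exact QuarticKontsevich.AnalyticAt.regularAt (ha z h)
    · rw [gen_iff] at h
      by_cases h1 : M.IsPole z
      · obtain ⟨k, rfl⟩ := h1
        exact regularAt_P_pole k
      by_cases h2 : M.IsPole (-z)
      · obtain ⟨k, hk⟩ := h2
        exact hneg z (hk ▸ regularAt_P_pole k)
      by_cases h3 : ∃ k, z ∈ M.fiber k
      · obtain ⟨k, hk⟩ := h3
        exact regularAt_P_fiber hk
      by_cases h4 : ∃ k, -z ∈ M.fiber k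
      · obtain ⟨k, hk⟩ := h4
        exact hneg z (regularAt_P_fiber hk)
      push Not at h3 h4
      exact absurd ⟨h1, h2, h3, h4⟩ h
  · have h1 : ∀ e : ℂ, Tendsto (fun z => (e - M.R z)⁻¹) (cocompact ℂ) (𝓝 0) := fun e =>
      (tendsto_inv_const_sub_cocompact e).comp M.tendsto_R_cocompact
    have h2 : ∀ e : ℂ, Tendsto (fun z => (e - M.R (-z))⁻¹) (cocompact ℂ) (𝓝 0) := fun e =>
      (tendsto_inv_const_sub_cocompact e).comp M.tendsto_R_neg_cocompact
    have h3 := ((tendsto_R_add_R_neg (M := M)).add ((tendsto_finsetSum Finset.univ fun k _ =>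
      (h1 (M.e k)).const_mul (M.r k : ℂ)).const_mul (M.c : ℂ))).add ((tendsto_finsetSum Finset.univ
      fun k _ => (h2 (M.e k)).const_mul (M.r k : ℂ)).const_mul (M.c : ℂ)) |>.sub
      ((tendsto_finsetSum Finset.univ fun k _ => tendsto_finsetSum Finset.univ
      fun l _ => ((h1 (M.e k)).mul (h2 (M.e l))).const_mul (M.r k * M.H k l)).const_mul (M.c : ℂ))
    simp only [mul_zero, Finset.sum_const_zero, add_zero, sub_zero] at h3
    refine h3.congr fun z => ?_
    rw [P]
    have e1 : ∀ k l, ((M.e k : ℂ) - M.R z)⁻¹ * (M.e l - M.R (-z))⁻¹ =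
        ((M.R z - M.e k) * (M.R (-z) - M.e l))⁻¹ := by
      intro k l
      rw [← neg_sub (M.R z), ← neg_sub (M.R (-z)), mul_inv, inv_neg, inv_neg]
      ring
    simp only [e1, div_eq_mul_inv]

/-- The function `Φ` with `𝒢⁽⁰⁾(z,w) = Φ(R(w),R(-w),R(z)) / (R(w) - R(-z))`. -/
def Φ (M : Model d) (x x' y : ℂ) : ℂ :=
  1 + M.c * ∑ k, M.r k * M.h k x / ((M.e k - x') * (M.e k - y))

lemma P_sub {x x' y : ℂ} (hx : ∀ k, x ≠ M.e k) (hx' : ∀ k, x' ≠ M.e k) (hy : ∀ k, y ≠ M.e k) :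
    M.P y x - M.P x' x = (y - x') * M.Φ x x' y := by
  have e1 : ∀ k, (M.r k : ℂ) / (M.e k - y) - M.r k / (M.e k - x') -
      ((∑ j, M.r k * M.H k j / ((y - M.e k) * (x - M.e j))) -
        ∑ j, M.r k * M.H k j / ((x' - M.e k) * (x - M.e j))) =
      (y - x') * (M.r k * M.h k x / ((M.e k - x') * (M.e k - y))) := by
    intro k
    have n1 : x' - M.e k ≠ 0 := sub_ne_zero.mpr (hx' k)
    have n2 : y - M.e k ≠ 0 := sub_ne_zero.mpr (hy k)
    have s1 : ∀ z : ℂ, ∑ j, M.r k * M.H k j / ((z - M.e k) * (x - M.e j)) =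
        M.r k / (z - M.e k) * (M.h k x - 1) := by
      intro z
      rw [h_eq k hx, add_sub_cancel_left, Finset.mul_sum]
      refine Finset.sum_congr rfl fun j _ => ?_
      rw [div_mul_div_comm]
    rw [s1, s1, ← neg_sub x', ← neg_sub y]
    field_simp
    ring
  have e2 := Finset.sum_congr rfl fun k (_ : k ∈ Finset.univ) => e1 k
  rw [Finset.sum_sub_distrib, Finset.sum_sub_distrib, Finset.sum_sub_distrib,
    ← Finset.mul_sum] at e2
  rw [P, P, Φ]
  linear_combination (M.c : ℂ) * e2

/-- On the curve, `Φ` is the quotient of `P` by one of its linear factors. -/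
lemma P_eq_mul_Φ {w y : ℂ} (hw : M.Gen w) (hy : ∀ k, y ≠ M.e k) :
    M.P y (M.R w) = (y - M.R (-w)) * M.Φ (M.R w) (M.R (-w)) y := by
  rw [← P_sub hw.ne hw.ne_neg hy, P_symm _ (M.R (-w)), P_R_R_neg hw, sub_zero]

lemma Φ_self {x x' : ℂ} (hx : ∀ k, x ≠ M.e k) : M.Φ x x' x' = M.P₁ x' x := by
  rw [Φ, P₁, add_assoc, ← mul_add, ← Finset.sum_add_distrib]
  congr 2
  refine Finset.sum_congr rfl fun k _ => ?_
  rw [h_eq k hx, mul_add, add_div, mul_one, ← sq, Finset.mul_sum, Finset.sum_div]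
  congr 1
  refine Finset.sum_congr rfl fun j _ => ?_
  rw [← neg_sub x', neg_sq, ← mul_div_assoc, div_div, mul_comm (x - _)]

end Model

lemma regularAt_div_sub {g : ℂ → ℂ} {a : ℂ} (hg : AnalyticAt ℂ g a) (h0 : g a = 0) :
    RegularAt (fun z => g z / (z - a)) a := by
  have := HasPolar.of_div_pow_one hg
  simpa [HasPolar, polar, h0] using this

lemma regularAt_div_sub_sq {g : ℂ → ℂ} {a : ℂ} (hg : AnalyticAt ℂ g a) (h0 : g a = 0)
    (h1 : deriv g a = 0) : RegularAt (fun z => g z / (z - a) ^ 2) a := by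
  have := HasPolar.of_div_pow_two hg
  simpa [HasPolar, polar, h0, h1] using this

namespace Model

variable {d : ℕ} {M : Model d}

lemma gen_zero : M.Gen 0 := by
  have h0 : ¬ M.IsPole 0 := not_isPole_of_re le_rfl
  have h1 : ∀ k, M.R 0 ≠ M.e k := by
    intro k h
    rw [← R_ε] at h
    have := R_injOn_nonneg (M := M) (x := 0) (y := M.ε k) le_rfl (M.ε_pos k).le (by simpa using h)
    exact (M.ε_pos k).ne this
  exact ⟨h0, by simpa using h0, h1, by simpa using h1⟩

lemma gen_of_im {z : ℂ} (h : z.im ≠ 0) : M.Gen z := by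
  have h1 : ∀ z : ℂ, z.im ≠ 0 → ∀ k, M.R z ≠ M.e k := by
    intro z hz k h
    exact hz (im_R_eq_zero.mp (by rw [h, ofReal_im]))
  have h' : (-z).im ≠ 0 := by simpa using h
  exact ⟨not_isPole_of_im h, not_isPole_of_im h', h1 z h, h1 (-z) h'⟩

/-! ### The fixed points of the reflection -/

section alpha

variable {α : Fin d → ℂ}

lemma IsFixedPointFamily.im (hα : M.IsFixedPointFamily α) (j : Fin d) : (α j).im = 0 := by
  by_contra h
  exact R_ne_R_neg h (hα.2.2 j).2.2

lemma IsFixedPointFamily.ne_zero (hα : M.IsFixedPointFamily α) (j : Fin d) : α j ≠ 0 := by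
  intro h
  exact hα.2.1 j j (by rw [h, neg_zero])

lemma IsFixedPointFamily.R_neg (hα : M.IsFixedPointFamily α) (j : Fin d) :
    M.R (-α j) = M.R (α j) := (hα.2.2 j).2.2.symm

lemma IsFixedPointFamily.gen (hα : M.IsFixedPointFamily α) (j : Fin d) : M.Gen (α j) := by
  obtain ⟨h1, h2, h3⟩ := hα.2.2 j
  have h4 : ∀ k, M.R (α j) ≠ M.e k := by
    intro k h
    have hm : α j ∈ M.fiber k := by
      refine mem_fiber.mpr ⟨h1, h, fun h' => h2 ⟨k, by rw [h']⟩⟩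
    exact fiber_R_neg_ne hm k (by rw [← h3, h])
  exact ⟨h1, h2, h4, by rwa [hα.R_neg]⟩

lemma IsFixedPointFamily.R_abs (hα : M.IsFixedPointFamily α) (j : Fin d) :
    M.R (α j) = M.R (|(α j).re| : ℝ) := by
  have h := eq_ofReal (hα.im j)
  rcases abs_choice (α j).re with h1 | h1
  · rw [h1, ← h]
  · rw [h1, ofReal_neg, ← h, hα.R_neg]

lemma IsFixedPointFamily.R_injective (hα : M.IsFixedPointFamily α) {i j : Fin d}
    (h : M.R (α i) = M.R (α j)) : i = j := by
  rw [hα.R_abs, hα.R_abs] at h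
  have h1 := R_injOn_nonneg (abs_nonneg _) (abs_nonneg _) h
  rcases abs_eq_abs.mp h1 with h2 | h2
  · apply hα.1
    rw [eq_ofReal (hα.im i), eq_ofReal (hα.im j), h2]
  · refine absurd ?_ (hα.2.1 i j)
    rw [eq_ofReal (hα.im i), eq_ofReal (hα.im j), h2, ofReal_neg]

lemma IsFixedPointFamily.R_ne_R_zero (hα : M.IsFixedPointFamily α) (j : Fin d) :
    M.R (α j) ≠ M.R 0 := by
  rw [hα.R_abs]
  intro h
  have h1 := R_injOn_nonneg (M := M) (y := 0) (abs_nonneg _) le_rfl (by simpa using h)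
  rw [abs_eq_zero] at h1
  exact hα.ne_zero j (by rw [eq_ofReal (hα.im j), h1, ofReal_zero])

/-- The derivatives of `R` in the two points `±α` differ. -/
lemma IsFixedPointFamily.U_ne (hα : M.IsFixedPointFamily α) (j : Fin d) :
    M.U (α j) (α j) - M.U (-α j) (-α j) ≠ 0 := by
  obtain ⟨h1, h2, -⟩ := hα.2.2 j
  set x := (α j).re with hx
  have hax : α j = x := eq_ofReal (hα.im j)
  have hx0 : x ≠ 0 := fun h => hα.ne_zero j (by rw [hax, h, ofReal_zero])
  have hp : ∀ k, M.ε k + x ≠ 0 := by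
    intro k h
    apply eps_add_ne h1 k
    rw [hax]
    exact_mod_cast h
  have hm : ∀ k, M.ε k - x ≠ 0 := by
    intro k h
    apply eps_add_ne h2 k
    rw [hax, ← sub_eq_add_neg]
    exact_mod_cast h
  have key : M.U (α j) (α j) - M.U (-α j) (-α j) =
      ((-4 * x * (M.c * ∑ k, M.ρ k * M.ε k / ((M.ε k + x) * (M.ε k - x)) ^ 2) : ℝ) : ℂ) := by
    have h3 : ∀ k, (M.ρ k : ℂ) / ((M.ε k + x) * (M.ε k + x)) -
        M.ρ k / ((M.ε k + -x) * (M.ε k + -x)) =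
        -4 * x * (M.ρ k * M.ε k / ((M.ε k + x) * (M.ε k - x)) ^ 2) := by
      intro k
      have e1 : (M.ε k + x : ℂ) ≠ 0 := by exact_mod_cast hp k
      have e2 : (M.ε k - x : ℂ) ≠ 0 := by exact_mod_cast hm k
      rw [← sub_eq_add_neg]
      field_simp
      ring
    have h4 := Finset.sum_congr rfl fun k (_ : k ∈ Finset.univ) => h3 k
    rw [Finset.sum_sub_distrib, ← Finset.mul_sum] at h4
    rw [U, U, hax]
    push_cast
    linear_combination (M.c : ℂ) * h4
  rw [key, ofReal_ne_zero]
  refine mul_ne_zero (mul_ne_zero (by norm_num) hx0) (mul_ne_zero (M.c_pos j).ne' (ne_of_gt ?_))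
  refine Finset.sum_pos (fun k _ => ?_) ⟨j, Finset.mem_univ j⟩
  have := mul_ne_zero (hp k) (hm k)
  have := M.ρ_pos k
  have := M.ε_pos k
  positivity

/-- Derivative of the relation `P(R(z), R(-z)) = 0`. -/
lemma P₁_mul_U {z : ℂ} (hz : M.Gen z) : M.P₁ (M.R z) (M.R (-z)) * M.U z z =
    M.P₁ (M.R (-z)) (M.R z) * M.U (-z) (-z) := by
  have h1 := hasDerivAt_P (hasDerivAt_R hz.np) (hasDerivAt_R_neg hz.np_neg) hz.ne hz.ne_neg
  have h2 : HasDerivAt (fun z => M.P (M.R z) (M.R (-z))) 0 z :=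
    (hasDerivAt_const z (0 : ℂ)).congr_of_eventuallyEq
      (hz.eventually.mono fun w hw => P_R_R_neg hw)
  linear_combination h1.unique h2

/-- `R(αⱼ)` is a zero of the diagonal `y ↦ P(y,y)`; by the next lemma it is a double zero. -/
lemma IsFixedPointFamily.P_eq_zero (hα : M.IsFixedPointFamily α) (j : Fin d) :
    M.P (M.R (α j)) (M.R (α j)) = 0 := by
  have := P_R_R_neg (hα.gen j)
  rwa [hα.R_neg] at this

lemma IsFixedPointFamily.P₁_eq_zero (hα : M.IsFixedPointFamily α) (j : Fin d) :
    M.P₁ (M.R (α j)) (M.R (α j)) = 0 := by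
  have h := P₁_mul_U (hα.gen j)
  rw [hα.R_neg] at h
  refine (mul_eq_zero.mp (?_ : _ * (M.U (α j) (α j) - M.U (-α j) (-α j)) = 0)).resolve_right
    (hα.U_ne j)
  linear_combination h

/-- The rational function `∏ⱼ (y - R(αⱼ)) / (y - eⱼ)`. -/
def S (M : Model d) (α : Fin d → ℂ) (y : ℂ) : ℂ := (∏ j, (y - M.R (α j))) / ∏ j, (y - M.e j)

/-- The residue of `1 / S` at `R(αⱼ)`. -/
def κ (M : Model d) (α : Fin d → ℂ) (j : Fin d) : ℂ :=
  (∏ i, (M.R (α j) - M.e i)) / ∏ i ∈ Finset.univ.erase j, (M.R (α j) - M.R (α i))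

lemma inv_S_eq (hα : M.IsFixedPointFamily α) {y : ℂ} (hy : ∀ j, y ≠ M.R (α j)) :
    (M.S α y)⁻¹ = 1 + ∑ j, M.κ α j / (y - M.R (α j)) := by
  have hm : (∏ j, (Polynomial.X - Polynomial.C (M.e j : ℂ))).Monic :=
    Polynomial.monic_prod_X_sub_C _ _
  have hd : (∏ j, (Polynomial.X - Polynomial.C (M.e j : ℂ))).natDegree =
      (Finset.univ : Finset (Fin d)).card := by
    rw [Polynomial.natDegree_finsetProd_X_sub_C_eq_card]
  have := eval_div_prod_eq Finset.univ (fun j => M.R (α j))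
    (fun i _ j _ hij => hα.R_injective hij) _ hm hd (y := y) (fun j _ => hy j)
  simpa [Polynomial.eval_prod, S, κ] using this

lemma S_ne_zero {y : ℂ} (hy : ∀ k, y ≠ M.e k) (hy' : ∀ j, y ≠ M.R (α j)) : M.S α y ≠ 0 :=
  div_ne_zero (Finset.prod_ne_zero_iff.mpr fun j _ => sub_ne_zero.mpr (hy' j))
    (Finset.prod_ne_zero_iff.mpr fun j _ => sub_ne_zero.mpr (hy j))

lemma analyticAt_S {y : ℂ} (hy : ∀ k, y ≠ M.e k) : AnalyticAt ℂ (M.S α) y := by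
  unfold S
  refine AnalyticAt.fun_div (by fun_prop) (by fun_prop)
    (Finset.prod_ne_zero_iff.mpr fun j _ => sub_ne_zero.mpr (hy j))

lemma regularAt_prod_div (a : Fin d → ℂ) (k : Fin d) (y : ℂ) :
    RegularAt (fun z => (∏ j, (z - a j)) / (z - a k)) y := by
  refine ⟨fun z => ∏ j ∈ Finset.univ.erase k, (z - a j), by fun_prop, ?_⟩
  have h : ∀ᶠ z in 𝓝[≠] y, z ≠ a k := by
    by_cases hy : y = a k
    · rw [← hy]
      exact self_mem_nhdsWithin
    · exact nhdsWithin_le_nhds (isOpen_ne.mem_nhds hy)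
  filter_upwards [h] with z hz
  rw [← Finset.mul_prod_erase _ _ (Finset.mem_univ k), mul_div_cancel_left₀ _ (sub_ne_zero.mpr hz)]

lemma regularAt_prod_sq_mul_P (y : ℂ) :
    RegularAt (fun z => (∏ j, (z - M.e j)) ^ 2 * M.P z z) y := by
  have hE : RegularAt (fun z => ∏ j, (z - (M.e j : ℂ))) y :=
    QuarticKontsevich.AnalyticAt.regularAt (by fun_prop)
  have hid : RegularAt (fun z => z) y := QuarticKontsevich.AnalyticAt.regularAt (by fun_prop)
  have hd := fun k => regularAt_prod_div (fun j => (M.e j : ℂ)) k y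
  have h := (((hE.mul hE).mul (hid.add hid)).sub ((RegularAt.const (2 * M.c : ℂ)).mul
    (hE.mul (RegularAt.sum (s := Finset.univ) fun k _ =>
      (RegularAt.const (M.r k : ℂ)).mul (hd k))))).sub
    ((RegularAt.const (M.c : ℂ)).mul (RegularAt.sum (s := Finset.univ) fun k _ =>
      RegularAt.sum (s := Finset.univ) fun j _ =>
      (RegularAt.const (M.r k * M.H k j)).mul ((hd k).mul (hd j))))
  refine h.congr (Eventually.of_forall fun z => ?_)
  beta_reduce
  rw [P]
  have e1 : ∀ k, (M.r k : ℂ) / (M.e k - z) = -(M.r k / (z - M.e k)) := fun k => by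
    rw [← neg_sub z, div_neg]
  simp only [e1, Finset.sum_neg_distrib]
  have e2 : ∑ k, (M.r k : ℂ) * ((∏ j, (z - (M.e j : ℂ))) / (z - M.e k)) =
      (∏ j, (z - (M.e j : ℂ))) * ∑ k, (M.r k : ℂ) / (z - M.e k) := by
    rw [Finset.mul_sum]
    exact Finset.sum_congr rfl fun k _ => by ring
  have e3 : ∑ k, ∑ j, M.r k * M.H k j * ((∏ i, (z - (M.e i : ℂ))) / (z - M.e k) *
      ((∏ i, (z - (M.e i : ℂ))) / (z - M.e j))) =
      (∏ j, (z - (M.e j : ℂ))) ^ 2 * ∑ k, ∑ j, M.r k * M.H k j / ((z - M.e k) * (z - M.e j)) := by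
    simp only [Finset.mul_sum]
    refine Finset.sum_congr rfl fun k _ => Finset.sum_congr rfl fun j _ => ?_
    rw [div_mul_div_comm]
    ring
  rw [e2, e3]
  ring

/-- The kernel on the diagonal. The quotient `P(y,y) / ((y - R(0)) S(y)²)` has only removable
singularities and tends to `2` at infinity. -/
theorem P_diag (hα : M.IsFixedPointFamily α) {y : ℂ} (hy : ∀ k, y ≠ M.e k) :
    M.P y y = 2 * (y - M.R 0) * M.S α y ^ 2 := by
  have hA : ∀ y, (∀ j, y ≠ M.R (α j)) → ∏ j, (y - M.R (α j)) ≠ 0 := fun y hy =>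
    Finset.prod_ne_zero_iff.mpr fun j _ => sub_ne_zero.mpr (hy j)
  have hE : ∀ y : ℂ, (∀ j, y ≠ M.e j) → ∏ j, (y - (M.e j : ℂ)) ≠ 0 := fun y hy =>
    Finset.prod_ne_zero_iff.mpr fun j _ => sub_ne_zero.mpr (hy j)
  have hP : ∀ y : ℂ, (∀ j, y ≠ M.e j) → AnalyticAt ℂ (fun y => M.P y y) y := fun y hy =>
    analyticAt_P analyticAt_id analyticAt_id hy hy
  have hP0 : M.P (M.R 0) (M.R 0) = 0 := by
    have := P_R_R_neg (M := M) gen_zero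
    rwa [neg_zero] at this
  by_cases h0 : y = M.R 0
  · rw [h0, sub_self, hP0]
    ring
  by_cases ha : ∃ j, y = M.R (α j)
  · obtain ⟨j, rfl⟩ := ha
    rw [hα.P_eq_zero, S, Finset.prod_eq_zero (Finset.mem_univ j) (sub_self _)]
    ring
  push Not at ha
  set f : ℂ → ℂ := fun y => (M.P y y * (∏ j, (y - (M.e j : ℂ))) ^ 2) /
    ((∏ j, (y - M.R (α j))) ^ 2 * (y - M.R 0)) with hf
  have hfa : ∀ y : ℂ, (∀ j, y ≠ M.e j) → (∀ j, y ≠ M.R (α j)) → y ≠ M.R 0 →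
      AnalyticAt ℂ f y := by
    intro y h1 h2 h3
    exact ((hP y h1).mul (by fun_prop)).div (by fun_prop)
      (mul_ne_zero (pow_ne_zero 2 (hA y h2)) (sub_ne_zero.mpr h3))
  have hreg : ∀ y, RegularAt f y := by
    intro y
    by_cases h3 : y = M.R 0
    · subst h3
      have h1 := regularAt_div_sub (hP (M.R 0) gen_zero.ne) hP0
      have h2 : RegularAt (fun y => (∏ j, (y - (M.e j : ℂ))) ^ 2 / (∏ j, (y - M.R (α j))) ^ 2)
          (M.R 0) := QuarticKontsevich.AnalyticAt.regularAt (AnalyticAt.fun_div (by fun_prop)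
            (by fun_prop) (pow_ne_zero 2 (hA _ fun j => (hα.R_ne_R_zero j).symm)))
      refine (h1.mul h2).congr (Eventually.of_forall fun y => ?_)
      simp only [hf]
      rw [div_mul_div_comm, mul_comm (y - M.R 0)]
    by_cases h2 : ∃ j, y = M.R (α j)
    · obtain ⟨j, rfl⟩ := h2
      have hne := (hα.gen j).ne
      have hd : deriv (fun y => M.P y y) (M.R (α j)) = 0 := by
        rw [(hasDerivAt_P (f := fun z => z) (g := fun z => z) (hasDerivAt_id' _)
          (hasDerivAt_id' _) hne hne).deriv]
        simp [hα.P₁_eq_zero]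
      have h1 := regularAt_div_sub_sq (hP _ hne) (hα.P_eq_zero j) hd
      have h2 : RegularAt (fun y => (∏ j, (y - (M.e j : ℂ))) ^ 2 /
          ((∏ i ∈ Finset.univ.erase j, (y - M.R (α i))) ^ 2 * (y - M.R 0))) (M.R (α j)) := by
        refine QuarticKontsevich.AnalyticAt.regularAt (AnalyticAt.fun_div (by fun_prop)
            (by fun_prop) (mul_ne_zero (pow_ne_zero 2 (Finset.prod_ne_zero_iff.mpr fun i hi =>
              sub_ne_zero.mpr fun h => ?_)) (sub_ne_zero.mpr h3)))
        exact Finset.ne_of_mem_erase hi (hα.R_injective h).symm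
      refine (h1.mul h2).congr (Eventually.of_forall fun y => ?_)
      simp only [hf]
      rw [← Finset.mul_prod_erase Finset.univ (fun j => y - M.R (α j)) (Finset.mem_univ j),
        div_mul_div_comm]
      ring
    · push Not at h2
      have h1 : RegularAt (fun y => ((∏ j, (y - M.R (α j))) ^ 2 * (y - M.R 0))⁻¹) y :=
        QuarticKontsevich.AnalyticAt.regularAt (AnalyticAt.fun_inv (by fun_prop)
          (mul_ne_zero (pow_ne_zero 2 (hA y h2)) (sub_ne_zero.mpr h3)))
      refine ((regularAt_prod_sq_mul_P (M := M) y).mul h1).congr (Eventually.of_forall fun y => ?_)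
      simp only [hf]
      rw [div_eq_mul_inv, mul_comm (M.P y y)]
  have hinv : ∀ e : ℂ, Tendsto (fun y => (y - e)⁻¹) (cocompact ℂ) (𝓝 0) := by
    intro e
    have := (tendsto_inv_const_sub_cocompact e).neg
    rw [neg_zero] at this
    refine this.congr fun y => ?_
    rw [← inv_neg, neg_sub]
  have hS : Tendsto (fun y => 1 + ∑ j, M.κ α j / (y - M.R (α j))) (cocompact ℂ) (𝓝 1) := by
    have := (tendsto_finsetSum Finset.univ fun j _ =>
      (hinv (M.R (α j))).const_mul (M.κ α j)).const_add (1 : ℂ)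
    simpa [div_eq_mul_inv] using this
  have hlim : Tendsto f (cocompact ℂ) (𝓝 2) := by
    have h1 := ((tendsto_finsetSum Finset.univ fun k _ =>
      (hinv (M.e k)).const_mul (-M.r k : ℂ)).const_mul (2 * M.c : ℂ)).sub
      ((tendsto_finsetSum Finset.univ fun k _ => tendsto_finsetSum Finset.univ
      fun l _ => ((hinv (M.e k)).mul (hinv (M.e l))).const_mul (M.r k * M.H k l)).const_mul
        (M.c : ℂ))
    have h2 := ((((h1.const_add (2 * M.R 0)).mul (hinv (M.R 0))).const_add 2).mul (hS.pow 2))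
    simp only [mul_zero, add_zero, one_pow, mul_one] at h2
    refine h2.congr' ?_
    filter_upwards [((Finset.univ.image fun j => M.R (α j)) ∪ {M.R 0} :
      Finset ℂ).finite_toSet.isCompact.compl_mem_cocompact] with y hy
    simp only [Finset.coe_union, Finset.coe_image, Finset.coe_univ, Set.image_univ,
      Finset.coe_singleton, Set.union_singleton, Set.mem_compl_iff, Set.mem_insert_iff,
      Set.mem_range, not_or, not_exists] at hy
    have h5 : y - M.R 0 ≠ 0 := sub_ne_zero.mpr hy.1
    rw [← inv_S_eq hα fun j h => hy.2 j h.symm]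
    have h6 : (M.S α y)⁻¹ = (∏ j, (y - (M.e j : ℂ))) / ∏ j, (y - M.R (α j)) := by
      rw [S, inv_div]
    have h7 : M.P y y = 2 * y + ((2 * M.c * ∑ k, -(M.r k : ℂ) * (y - M.e k)⁻¹) -
        M.c * ∑ k, ∑ l, M.r k * M.H k l * ((y - M.e k)⁻¹ * (y - M.e l)⁻¹)) := by
      rw [P]
      have e1 : ∀ k, (M.r k : ℂ) / (M.e k - y) = -M.r k * (y - M.e k)⁻¹ := fun k => by
        rw [← neg_sub y, div_neg, div_eq_mul_inv, neg_mul]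
      simp only [e1, div_eq_mul_inv, mul_inv]
      ring
    have h8 : f y = M.P y y / (y - M.R 0) * ((M.S α y)⁻¹) ^ 2 := by
      rw [h6, div_pow, div_mul_div_comm, hf]
      simp only
      rw [mul_comm (y - M.R 0)]
    rw [h8, h7]
    field_simp
    ring
  have hfy := eq_of_tendsto_cocompact hreg hlim ((Finset.univ.image fun k => (M.e k : ℂ)) ∪
    (Finset.univ.image fun j => M.R (α j)) ∪ {M.R 0}) (z := y) (fun z hz => ?_) ?_
  · have h1 := hA y ha
    have h2 := hE y hy
    have h3 := sub_ne_zero.mpr h0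
    rw [hf] at hfy
    simp only at hfy
    rw [div_eq_iff (by positivity)] at hfy
    rw [S]
    field_simp
    linear_combination hfy
  · simp only [Finset.mem_union, Finset.mem_image, Finset.mem_univ, true_and, Finset.mem_singleton,
      not_or, not_exists] at hz
    exact hfa z (fun j h => hz.1.1 j h.symm) (fun j h => hz.1.2 j h.symm) hz.2
  · simp only [Finset.mem_union, Finset.mem_image, Finset.mem_univ, true_and, Finset.mem_singleton,
      not_or, not_exists]
    exact ⟨⟨fun j h => hy j h.symm, fun j h => ha j h.symm⟩, h0⟩

lemma P₁_diag (hα : M.IsFixedPointFamily α) {y s : ℂ} (hy : ∀ k, y ≠ M.e k)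
    (hs : HasDerivAt (M.S α) s y) :
    M.P₁ y y = M.S α y ^ 2 + 2 * (y - M.R 0) * M.S α y * s := by
  have h1 := hasDerivAt_P (hasDerivAt_id y) (hasDerivAt_id y) hy hy
  have h2 := (((hasDerivAt_id y).sub_const (M.R 0)).const_mul 2).mul (hs.pow 2)
  have h3 : HasDerivAt (fun z => M.P z z) _ y := h2.congr_of_eventuallyEq (by
    have : ∀ᶠ z in 𝓝 y, ∀ k, z ≠ (M.e k : ℂ) := eventually_all.mpr fun k =>
      isOpen_ne.mem_nhds (hy k)
    filter_upwards [this] with z hz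
    exact P_diag hα hz)
  have h4 := h1.unique h3
  simp only [id, mul_one, Pi.pow_apply, Nat.cast_ofNat, Nat.add_one_sub_one, pow_one] at h4
  linear_combination h4 / 2

lemma inv_S_eq_mul (hα : M.IsFixedPointFamily α) {y : ℂ} (hy : ∀ j, y ≠ M.R (α j)) (k : Fin d) :
    (M.S α y)⁻¹ = (M.e k - y) * ∑ j, M.κ α j / ((M.e k - M.R (α j)) * (y - M.R (α j))) := by
  have h0 : (0 : ℂ) = 1 + ∑ j, M.κ α j / (M.e k - M.R (α j)) := by
    rw [← inv_S_eq hα fun j h => (hα.gen j).ne k h.symm, S,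
      Finset.prod_eq_zero (f := fun j => (M.e k : ℂ) - M.e j) (Finset.mem_univ k) (sub_self _),
      div_zero, inv_zero]
  rw [inv_S_eq hα hy, ← sub_zero (1 + _), h0, add_sub_add_left_eq_sub,
    ← Finset.sum_sub_distrib, Finset.mul_sum]
  refine Finset.sum_congr rfl fun j _ => ?_
  have := sub_ne_zero.mpr (hy j)
  have : (M.e k : ℂ) - M.R (α j) ≠ 0 := sub_ne_zero.mpr ((hα.gen j).ne k).symm
  field_simp
  ring

/-- The partial fraction expansion of `Φ / S`; the poles of `Φ` in `eₖ` cancel against the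
zeros of `1 / S`. -/
lemma Φ_div_S (hα : M.IsFixedPointFamily α) {x x' y : ℂ} (hy : ∀ k, y ≠ M.e k)
    (hy' : ∀ j, y ≠ M.R (α j)) :
    M.Φ x x' y * (M.S α y)⁻¹ = 1 + ∑ j, M.κ α j * M.Φ x x' (M.R (α j)) / (y - M.R (α j)) := by
  have h1 : ∀ k, M.r k * M.h k x / ((M.e k - x') * (M.e k - y)) * (M.S α y)⁻¹ =
      ∑ j, M.κ α j * (M.r k * M.h k x / ((M.e k - x') * (M.e k - M.R (α j)))) /
        (y - M.R (α j)) := by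
    intro k
    have hk : (M.e k : ℂ) - y ≠ 0 := sub_ne_zero.mpr (hy k).symm
    rw [inv_S_eq_mul hα hy' k, mul_left_comm, ← mul_assoc, ← mul_div_assoc,
      mul_comm (M.e k - x' : ℂ), mul_div_mul_left _ _ hk, Finset.mul_sum]
    refine Finset.sum_congr rfl fun j _ => ?_
    simp only [div_eq_mul_inv, mul_inv]
    ring
  have h2 := Finset.sum_congr rfl fun k (_ : k ∈ Finset.univ) => h1 k
  rw [← Finset.sum_mul, Finset.sum_comm] at h2
  have h3 : ∀ j, M.κ α j * M.Φ x x' (M.R (α j)) / (y - M.R (α j)) =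
      M.κ α j / (y - M.R (α j)) + M.c * ∑ k, M.κ α j *
        (M.r k * M.h k x / ((M.e k - x') * (M.e k - M.R (α j)))) / (y - M.R (α j)) := by
    intro j
    rw [Φ, ← Finset.sum_div, ← Finset.mul_sum]
    ring
  rw [Finset.sum_congr rfl fun j _ => h3 j, Finset.sum_add_distrib, ← add_assoc, ← inv_S_eq hα hy',
    ← Finset.mul_sum, ← h2, Φ]
  ring

end alpha

/-! ### Evaluation of the two-point function -/

lemma continuousAt_h {k : Fin d} {x : ℂ} (hx : ∀ k, x ≠ M.e k) : ContinuousAt (M.h k) x := by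
  unfold h
  exact ContinuousAt.div (by fun_prop) (by fun_prop)
    (Finset.prod_ne_zero_iff.mpr fun j _ => sub_ne_zero.mpr (hx j))

lemma analyticAt_h {k : Fin d} {x : ℂ} (hx : ∀ k, x ≠ M.e k) : AnalyticAt ℂ (M.h k) x := by
  unfold h
  exact AnalyticAt.fun_div (by fun_prop) (by fun_prop)
    (Finset.prod_ne_zero_iff.mpr fun j _ => sub_ne_zero.mpr (hx j))

lemma analyticAt_Φ {f g l : ℂ → ℂ} {a : ℂ} (hf : AnalyticAt ℂ f a) (hg : AnalyticAt ℂ g a)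
    (hl : AnalyticAt ℂ l a) (h1 : ∀ k, f a ≠ M.e k) (h2 : ∀ k, g a ≠ M.e k)
    (h3 : ∀ k, l a ≠ M.e k) : AnalyticAt ℂ (fun z => M.Φ (f z) (g z) (l z)) a := by
  unfold Φ
  refine analyticAt_const.add (analyticAt_const.mul (Finset.analyticAt_fun_sum _ fun k _ => ?_))
  exact (analyticAt_const.mul ((analyticAt_h h1).fun_comp hf)).div
    ((analyticAt_const.sub hg).mul (analyticAt_const.sub hl))
    (mul_ne_zero (sub_ne_zero.mpr (h2 k).symm) (sub_ne_zero.mpr (h3 k).symm))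

lemma twoPointFormula_eq (p : ℂ × ℂ) : M.twoPointFormula p =
    M.Φ (M.R p.2) (M.R (-p.2)) (M.R p.1) / (M.R p.2 - M.R (-p.1)) := by
  rw [twoPointFormula, Φ, coe_c]
  simp only [R_ε, ← coe_fiber, finprod_mem_coe_finset]
  congr 1
  rw [sub_eq_add_neg, ← mul_neg, ← Finset.sum_neg_distrib]
  congr 2
  refine Finset.sum_congr rfl fun k _ => ?_
  rw [← h, ← neg_sub (M.e k : ℂ) (M.R p.1), neg_mul, div_neg, neg_mul, neg_neg, div_mul_eq_mul_div,
    mul_comm (M.e k - M.R p.1)]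

lemma mem_twoPointDomain {z w : ℂ} (hz : M.Gen z) (hw : M.Gen w) (h : M.R w ≠ M.R (-z)) :
    (z, w) ∈ M.twoPointDomain :=
  ⟨hz.np, hz.np_neg, hw.np, hw.np_neg, fun k => by rw [R_ε]; exact hz.ne k,
    fun k => by rw [R_ε]; exact hw.ne k, fun k => by rw [R_ε]; exact (hw.ne_neg k).symm, h⟩

lemma G_eq {z w : ℂ} (hz : M.Gen z) (hw : M.Gen w) (h : M.R w ≠ M.R (-z)) :
    M.G z w = M.Φ (M.R w) (M.R (-w)) (M.R z) / (M.R w - M.R (-z)) := by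
  have h1 : ContinuousAt (fun p : ℂ × ℂ => M.R p.1) (z, w) :=
    ContinuousAt.comp (g := M.R) (analyticAt_R hz.np).continuousAt continuousAt_fst
  have h2 : ContinuousAt (fun p : ℂ × ℂ => M.R p.2) (z, w) :=
    ContinuousAt.comp (g := M.R) (analyticAt_R hw.np).continuousAt continuousAt_snd
  have h3 : ContinuousAt (fun p : ℂ × ℂ => M.R (-p.1)) (z, w) :=
    ContinuousAt.comp (g := fun z => M.R (-z)) (analyticAt_R_neg hz.np_neg).continuousAt
      continuousAt_fst
  have h4 : ContinuousAt (fun p : ℂ × ℂ => M.R (-p.2)) (z, w) :=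
    ContinuousAt.comp (g := fun z => M.R (-z)) (analyticAt_R_neg hw.np_neg).continuousAt
      continuousAt_snd
  have h5 : ContinuousAt M.twoPointFormula (z, w) := by
    have : M.twoPointFormula = fun p => _ := funext twoPointFormula_eq
    rw [this]
    refine ContinuousAt.div ?_ (h2.sub h3) (sub_ne_zero.mpr h)
    unfold Φ
    refine continuousAt_const.add (continuousAt_const.mul
      (tendsto_finsetSum _ fun k _ => ContinuousAt.div (continuousAt_const.mul
        (ContinuousAt.comp (g := M.h k) (continuousAt_h hw.ne) h2))
        ((continuousAt_const.sub h4).mul (continuousAt_const.sub h1))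
        (mul_ne_zero (sub_ne_zero.mpr (hw.ne_neg k).symm) (sub_ne_zero.mpr (hz.ne k).symm))))
  rw [G, extendFrom_eq (subset_closure (mem_twoPointDomain hz hw h))
    (h5.tendsto.mono_left nhdsWithin_le_nhds), twoPointFormula_eq]

lemma r_ne_zero (k : Fin d) : (M.r k : ℂ) ≠ 0 := by
  exact_mod_cast (M.r_pos k).ne'

/-- The summands of `Φ(R(w),R(-w),y)` have finite limits as `w → εₙ`. -/
lemma tendsto_h_div (k n : Fin d) :
    Tendsto (fun w => M.h k (M.R w) / (M.e k - M.R (-w))) (𝓝[≠] (M.ε n : ℂ))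
      (𝓝 (-(M.H k n / (M.c * M.r n)))) := by
  have hu : Tendsto (fun z : ℂ => z - M.ε n) (𝓝[≠] (M.ε n : ℂ)) (𝓝 0) := by
    have : ContinuousAt (fun z : ℂ => z - M.ε n) (M.ε n) := by fun_prop
    have h := this.tendsto
    rw [sub_self] at h
    exact h.mono_left nhdsWithin_le_nhds
  have hX : Tendsto M.R (𝓝[≠] (M.ε n : ℂ)) (𝓝 (M.e n)) := by
    have := (analyticAt_R (M := M) (not_isPole_ε n)).continuousAt.tendsto
    rw [R_ε] at this
    exact this.mono_left nhdsWithin_le_nhds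
  have hU := U_ε_ne_zero (M := M) n n
  have huX : ∀ j, Tendsto (fun z => (z - M.ε n) * (M.R z - M.e j)⁻¹)
      (𝓝[≠] (M.ε n : ℂ)) (𝓝 (if j = n then (M.U (M.ε n) (M.ε n))⁻¹ else 0)) := by
    intro k
    split_ifs with hk
    · subst hk
      have := (tendsto_div_sub (hasDerivAt_R (M := M) (not_isPole_ε k)) hU).neg
      rw [R_ε, neg_neg] at this
      refine this.congr fun z => ?_
      rw [← div_neg, neg_sub, div_eq_mul_inv]
    · have h1 : Tendsto (fun z => (M.R z - M.e k)⁻¹) (𝓝[≠] (M.ε n : ℂ))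
          (𝓝 (M.e n - M.e k : ℂ)⁻¹) :=
        (hX.sub tendsto_const_nhds).inv₀ (sub_ne_zero.mpr fun h => hk (M.e_inj.mp h).symm)
      simpa using hu.mul h1
  have hneg : Tendsto (fun w : ℂ => -w) (𝓝[≠] (M.ε n : ℂ)) (𝓝[≠] (-(M.ε n : ℂ))) := by
    refine tendsto_nhdsWithin_of_tendsto_nhds_of_eventually_within _
      ((continuous_neg.tendsto _).mono_left nhdsWithin_le_nhds) ?_
    filter_upwards [self_mem_nhdsWithin] with z hz h
    exact hz (neg_injective h)
  have h1 := (tendsto_sub_mul_R n).comp hneg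
  have h2 : Tendsto (fun w => (w - M.ε n) * (M.e k - M.R (-w))) (𝓝[≠] (M.ε n : ℂ))
      (𝓝 (0 * M.e k + -(M.c * M.ρ n))) := by
    refine ((hu.mul_const (M.e k : ℂ)).add h1).congr fun w => ?_
    simp only [Function.comp]
    ring
  have h3 : Tendsto (fun w => (w - M.ε n) * M.h k (M.R w)) (𝓝[≠] (M.ε n : ℂ))
      (𝓝 (0 + ∑ j, M.H k j * (if j = n then (M.U (M.ε n) (M.ε n))⁻¹ else 0))) := by
    refine (hu.add (tendsto_finsetSum Finset.univ fun j _ =>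
      (huX j).const_mul (M.H k j))).congr' ?_
    filter_upwards [eventually_gen (M := M) (M.ε n)] with w hw
    rw [h_eq k hw.ne, mul_add, mul_one, Finset.mul_sum]
    congr 1
    refine Finset.sum_congr rfl fun j _ => ?_
    ring
  have h4 := h3.div h2 (by simpa using M.c_mul_ρ_ne_zero n)
  have h5 : (0 + ∑ j, M.H k j * (if j = n then (M.U (M.ε n) (M.ε n))⁻¹ else 0)) /
      (0 * M.e k + -(M.c * M.ρ n)) = -(M.H k n / (M.c * M.r n)) := by
    have := M.c_mul_ρ_ne_zero n
    simp only [mul_ite, mul_zero, Finset.sum_ite_eq', Finset.mem_univ, if_true, zero_mul, zero_add,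
      ← ρ_mul_deriv]
    rw [div_neg, ← div_eq_mul_inv, div_div]
    congr 2
    ring
  rw [h5] at h4
  refine h4.congr' ?_
  filter_upwards [self_mem_nhdsWithin] with w hw
  exact mul_div_mul_left _ _ (sub_ne_zero.mpr hw)

/-- At `w = εₙ` the two-point function has a removable singularity: the zero of
`1 / (eₖ - R(-w))` compensates the pole of `h k` in `R(w) = eₙ`. -/
lemma G_ε {t : ℂ} (ht : M.Gen t) (n : Fin d) :
    M.G t (M.ε n) = M.h n (M.R t) / (M.e n - M.R (-t)) := by
  have hcl : (t, (M.ε n : ℂ)) ∈ closure M.twoPointDomain := by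
    have h1 : Tendsto (fun w : ℂ => (t, w)) (𝓝[≠] (M.ε n : ℂ)) (𝓝 (t, (M.ε n : ℂ))) :=
      (Continuous.tendsto (by fun_prop) _).mono_left nhdsWithin_le_nhds
    refine mem_closure_of_tendsto h1 ?_
    have h2 := (analyticAt_R (M := M) (not_isPole_ε n)).continuousAt.eventually_ne
      (y := M.R (-t)) (by rw [R_ε]; exact (ht.ne_neg n).symm)
    filter_upwards [eventually_gen (M := M) (M.ε n), nhdsWithin_le_nhds h2] with w hw hw2
    exact mem_twoPointDomain ht hw hw2
  have hf : Tendsto Prod.fst (𝓝[M.twoPointDomain] (t, (M.ε n : ℂ))) (𝓝 t) :=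
    (continuous_fst.tendsto _).mono_left nhdsWithin_le_nhds
  have hs : Tendsto Prod.snd (𝓝[M.twoPointDomain] (t, (M.ε n : ℂ))) (𝓝 (M.ε n : ℂ)) :=
    (continuous_snd.tendsto _).mono_left nhdsWithin_le_nhds
  have hs' : Tendsto Prod.snd (𝓝[M.twoPointDomain] (t, (M.ε n : ℂ))) (𝓝[≠] (M.ε n : ℂ)) := by
    refine tendsto_nhdsWithin_of_tendsto_nhds_of_eventually_within _ hs ?_
    filter_upwards [self_mem_nhdsWithin] with p hp h
    exact hp.2.2.2.2.2.1 n (by rw [show p.2 = M.ε n from h])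
  have hx : Tendsto (fun p : ℂ × ℂ => M.R p.1) (𝓝[M.twoPointDomain] (t, (M.ε n : ℂ)))
      (𝓝 (M.R t)) := (analyticAt_R ht.np).continuousAt.tendsto.comp hf
  have hx' : Tendsto (fun p : ℂ × ℂ => M.R (-p.1)) (𝓝[M.twoPointDomain] (t, (M.ε n : ℂ)))
      (𝓝 (M.R (-t))) := (analyticAt_R_neg ht.np_neg).continuousAt.tendsto.comp hf
  have hw : Tendsto (fun p : ℂ × ℂ => M.R p.2) (𝓝[M.twoPointDomain] (t, (M.ε n : ℂ)))
      (𝓝 (M.e n)) := by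
    have := (analyticAt_R (M := M) (not_isPole_ε n)).continuousAt.tendsto.comp hs
    rwa [R_ε] at this
  have h1 := ((tendsto_finsetSum Finset.univ fun k _ => (((tendsto_h_div (M := M) k n).comp
    hs').const_mul (M.r k : ℂ)).mul ((tendsto_const_nhds (x := (M.e k : ℂ)).sub hx).inv₀
      (sub_ne_zero.mpr (ht.ne k).symm))).const_mul (M.c : ℂ)).const_add 1
  have h2 := h1.div (hw.sub hx') (sub_ne_zero.mpr (ht.ne_neg n).symm)
  have h3 : 1 + M.c * ∑ k, M.r k * -(M.H k n / (M.c * M.r n)) * (M.e k - M.R t)⁻¹ =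
      M.h n (M.R t) := by
    rw [h_eq n ht.ne, Finset.mul_sum]
    congr 1
    refine Finset.sum_congr rfl fun k _ => ?_
    have := M.c_ne_zero n
    have := r_ne_zero (M := M) n
    have h4 := r_mul_H (M := M) k n
    rw [← neg_sub (M.R t), inv_neg, div_eq_mul_inv]
    field_simp
    rw [h4]
  rw [h3] at h2
  rw [G]
  refine extendFrom_eq hcl (h2.congr fun p => ?_)
  rw [twoPointFormula_eq, Φ]
  simp only [Pi.div_apply, Function.comp]
  congr 3
  refine Finset.sum_congr rfl fun k _ => ?_
  simp only [div_eq_mul_inv, mul_inv]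
  ring

/-- `𝔊₀` in terms of the kernel `P`. -/
lemma G₀_eq {q : ℂ} (hq : M.Gen q) (hU : M.U (-q) (-q) ≠ 0) :
    M.G₀ q = M.P₁ (M.R q) (M.R (-q)) / M.U (-q) (-q) := by
  have hg : AnalyticAt ℂ (fun v => M.Φ (M.R v) (M.R (-v)) (M.R q) / M.U v (-q)) (-q) := by
    refine (analyticAt_Φ (analyticAt_R hq.np_neg) (analyticAt_R_neg (by simpa using hq.np))
      analyticAt_const hq.ne_neg (by simpa using hq.ne) hq.ne).fun_div
      (analyticAt_U analyticAt_id analyticAt_const hq.np_neg hq.np_neg) hU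
  have hU' : ∀ᶠ v in 𝓝 (-q), M.U v (-q) ≠ 0 :=
    (analyticAt_U (M := M) (f := fun v => v) (g := fun _ => -q) analyticAt_id analyticAt_const
      hq.np_neg hq.np_neg).continuousAt.eventually_ne hU
  have h := residue_div_sub hg
  simp only [neg_neg] at h
  rw [Φ_self hq.ne_neg] at h
  rw [← h, G₀]
  refine residue_congr (hg.meromorphicAt.fun_div (by fun_prop)) ?_
  filter_upwards [self_mem_nhdsWithin, nhdsWithin_le_nhds hU',
    nhdsWithin_le_nhds hq.neg.eventually] with v hv hv' hgen
  have h1 := R_sub hgen.np hq.np_neg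
  have h2 : M.R v ≠ M.R (-q) := by
    rw [← sub_ne_zero, h1]
    exact mul_ne_zero (sub_ne_zero.mpr hv) hv'
  rw [G_eq hq hgen h2, h1, div_div, mul_comm (v - -q)]

/-- In contrast to `𝔊₀`, both sides vanish at ramification points. -/
lemma G₀_mul_U {q : ℂ} (hq : M.Gen q) (hU : M.U (-q) (-q) ≠ 0) :
    M.G₀ q * M.U q q = M.P₁ (M.R (-q)) (M.R q) := by
  rw [G₀_eq hq hU, div_mul_eq_mul_div, P₁_mul_U hq, mul_div_cancel_right₀ _ hU]

end Model

namespace Model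

variable {d : ℕ} {M : Model d}

/-! ### The planar function with a marked point -/

/-- Points `q` for which all expressions entering the residue formula are nonsingular. -/
structure Generic (M : Model d) (α : Fin d → ℂ) (q : ℂ) : Prop extends M.Gen q where
  U_ne : M.U q q ≠ 0
  U_neg_ne : M.U (-q) (-q) ≠ 0
  D_ne : M.R q ≠ M.R (-q)
  fiber_ne : ∀ n, ∀ v ∈ M.fiber n, M.R q ≠ M.R (-v)
  α_ne : ∀ j, M.R q ≠ M.R (α j)
  α_ne_neg : ∀ j, M.R (-q) ≠ M.R (α j)

/-- The kernel `ω_{0,2}(q,t) / (R(q) - R(t))`. -/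
def K (M : Model d) (q t : ℂ) : ℂ := ω₀₂ q t / (M.R q - M.R t)

lemma meromorphicAt_K (q t : ℂ) : MeromorphicAt (M.K q) t := by
  unfold K ω₀₂
  have := meromorphicAt_R (M := M) t
  fun_prop

lemma meromorphicAt_K_div (q t : ℂ) (n : Fin d) :
    MeromorphicAt (fun t => M.K q t / (M.e n - M.R (-t))) t := by
  have := meromorphicAt_K (M := M) q t
  have := meromorphicAt_R_neg (M := M) t
  fun_prop

lemma analyticAt_K {q t : ℂ} (ht : ¬ M.IsPole t) (h : M.R q ≠ M.R t) (h' : q ≠ -t) :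
    AnalyticAt ℂ (M.K q) t := by
  unfold K ω₀₂
  have := analyticAt_R ht
  have h1 : (q - t) ^ 2 ≠ 0 := pow_ne_zero 2 (sub_ne_zero.mpr fun h0 => h (by rw [h0]))
  have h2 : (q + t) ^ 2 ≠ 0 := pow_ne_zero 2 fun h0 => h' (by linear_combination h0)
  have h3 : M.R q - M.R t ≠ 0 := sub_ne_zero.mpr h
  fun_prop (disch := assumption)

/-- The partial fraction expansion of `1 / h`. -/
lemma inv_h_eq (n : Fin d) {y : ℂ} (hy : ∀ v ∈ M.fiber n, y ≠ M.R (-v)) :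
    (M.h n y)⁻¹ = 1 + ∑ v ∈ M.fiber n, (∏ j, (M.R (-v) - M.e j)) /
      (∏ u ∈ (M.fiber n).erase v, (M.R (-v) - M.R (-u))) / (y - M.R (-v)) := by
  have hm : (∏ j, (Polynomial.X - Polynomial.C (M.e j : ℂ))).Monic :=
    Polynomial.monic_prod_X_sub_C _ _
  have hd : (∏ j, (Polynomial.X - Polynomial.C (M.e j : ℂ))).natDegree = (M.fiber n).card := by
    rw [Polynomial.natDegree_finsetProd_X_sub_C_eq_card, M.card_fiber]
    simp
  have := eval_div_prod_eq (M.fiber n) (fun v => M.R (-v)) (R_neg_injOn_fiber n) _ hm hd hy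
  simpa [Polynomial.eval_prod, h] using this

lemma h_ne_zero {n : Fin d} {y : ℂ} (hy : ∀ v ∈ M.fiber n, y ≠ M.R (-v)) (hy' : ∀ k, y ≠ M.e k) :
    M.h n y ≠ 0 :=
  div_ne_zero (Finset.prod_ne_zero_iff.mpr fun v hv => sub_ne_zero.mpr (hy v hv))
    (Finset.prod_ne_zero_iff.mpr fun j _ => sub_ne_zero.mpr (hy' j))

lemma meromorphicAt_h (n : Fin d) (y : ℂ) : MeromorphicAt (M.h n) y := by
  unfold h
  fun_prop

lemma tendsto_inv_sub_cocompact (e : ℂ) : Tendsto (fun y => (y - e)⁻¹) (cocompact ℂ) (𝓝 0) := by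
  have := (tendsto_inv_const_sub_cocompact e).neg
  rw [neg_zero] at this
  refine this.congr fun y => ?_
  rw [← inv_neg, neg_sub]

/-- The residue theorem in the plane of `r = R(t)` for the part of the integrand with the
boundary derivative. -/
lemma sum_residue_div_h (n : Fin d) (x A B : ℂ) (hx : ∀ v ∈ M.fiber n, x ≠ M.R (-v)) :
    residue (fun r => (A / (x - r) ^ 2 - B / (x - r) ^ 3) * (M.h n r)⁻¹) x +
      ∑ v ∈ M.fiber n, residue (fun r => (A / (x - r) ^ 2 - B / (x - r) ^ 3) * (M.h n r)⁻¹)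
        (M.R (-v)) = 0 := by
  set ψ : ℂ → ℂ := fun r => (A / (x - r) ^ 2 - B / (x - r) ^ 3) * (M.h n r)⁻¹ with hψ
  have hnot : x ∉ (M.fiber n).image fun v => M.R (-v) := by
    simp only [Finset.mem_image, not_exists, not_and]
    exact fun v hv h => hx v hv h.symm
  have hmem : ∀ y, y ∉ insert x ((M.fiber n).image fun v => M.R (-v)) →
      y ≠ x ∧ ∀ v ∈ M.fiber n, y ≠ M.R (-v) := by
    intro y hy
    simp only [Finset.mem_insert, Finset.mem_image, not_or, not_exists, not_and] at hy
    exact ⟨hy.1, fun v hv h => hy.2 v hv h.symm⟩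
  have ha : ∀ y, y ∉ insert x ((M.fiber n).image fun v => M.R (-v)) → AnalyticAt ℂ ψ y := by
    intro y hy
    obtain ⟨h1, h2⟩ := hmem y hy
    have h3 : AnalyticAt ℂ (fun r => (M.h n r)⁻¹) y := by
      simp only [h, inv_div]
      exact AnalyticAt.fun_div (by fun_prop) (by fun_prop)
        (Finset.prod_ne_zero_iff.mpr fun v hv => sub_ne_zero.mpr (h2 v hv))
    have h4 : x - y ≠ 0 := sub_ne_zero.mpr h1.symm
    have h5 := pow_ne_zero 2 h4
    have h6 := pow_ne_zero 3 h4
    have h7 : AnalyticAt ℂ (fun r => A / (x - r) ^ 2 - B / (x - r) ^ 3) y := by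
      fun_prop (disch := assumption)
    exact h7.mul h3
  have hm : ∀ s ∈ insert x ((M.fiber n).image fun v => M.R (-v)), MeromorphicAt ψ s := by
    intro s _
    have := meromorphicAt_h (M := M) n s
    simp only [hψ]
    fun_prop
  have hl : Tendsto (fun r => r * ψ r) (cocompact ℂ) (𝓝 0) := by
    have h1 := tendsto_inv_const_sub_cocompact x
    have h2 : Tendsto (fun r => r * (x - r)⁻¹) (cocompact ℂ) (𝓝 (-1)) := by
      have h3 := (h1.const_mul x).sub (tendsto_const_nhds (x := (1 : ℂ)))
      rw [mul_zero, zero_sub] at h3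
      refine h3.congr' ?_
      filter_upwards [(isCompact_singleton (x := x)).compl_mem_cocompact] with r hr
      have : x - r ≠ 0 := sub_ne_zero.mpr fun h => hr h.symm
      field_simp
      ring
    have h3 : Tendsto (fun r => (M.h n r)⁻¹) (cocompact ℂ) (𝓝 1) := by
      have h4 := (tendsto_finsetSum (M.fiber n) fun v _ =>
        (tendsto_inv_sub_cocompact (M.R (-v))).const_mul ((∏ j, (M.R (-v) - M.e j)) /
          (∏ u ∈ (M.fiber n).erase v, (M.R (-v) - M.R (-u))))).const_add (1 : ℂ)
      simp only [mul_zero, Finset.sum_const_zero, add_zero] at h4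
      refine h4.congr' ?_
      filter_upwards
        [((M.fiber n).image fun v => M.R (-v)).finite_toSet.isCompact.compl_mem_cocompact]
        with r hr
      rw [inv_h_eq]
      · simp only [div_eq_mul_inv]
      · intro v hv h
        exact hr (by rw [h]; exact_mod_cast Finset.mem_image_of_mem _ hv)
    have h5 := ((h2.mul (h1.const_mul A)).sub (h2.mul ((h1.pow 2).const_mul B))).mul h3
    simp only [mul_zero, mul_one, sub_zero, ne_eq, OfNat.ofNat_ne_zero, not_false_eq_true,
      zero_pow] at h5
    refine h5.congr fun r => ?_
    simp only [hψ, div_eq_mul_inv, ← inv_pow]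
    ring
  have := sum_residue_eq_zero _ hm (insert x ((M.fiber n).image fun v => M.R (-v)))
    (fun z hz => QuarticKontsevich.AnalyticAt.regularAt (ha z hz)) ha hl
  rw [Finset.sum_insert hnot, Finset.sum_image (R_neg_injOn_fiber n)] at this
  exact this

/-- The integrand of `𝒯⁽⁰⁾(q‖q,εₙ|)` splits into an explicit part and a part depending on `t`
only through `R(t)`. -/
lemma markedIntegrand_eq {α : Fin d → ℂ} {q : ℂ} (hq : M.Generic α q) (n : Fin d) :
    ∃ A B : ℂ, ∀ t, M.Gen t → M.U t t ≠ 0 → (∀ v ∈ M.fiber n, M.R t ≠ M.R (-v)) →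
      M.R t ≠ M.R q →
      M.markedIntegrand q q (M.ε n) t = (M.U q q)⁻¹ * (M.K q t / (M.e n - M.R (-t))) +
        (A / (M.R q - M.R t) ^ 2 - B / (M.R q - M.R t) ^ 3) * (M.h n (M.R t))⁻¹ * deriv M.R t := by
  set g : ℂ → ℂ := fun u => M.h n (M.R u) / (M.e n - M.R (-u)) with hg
  have hga : AnalyticAt ℂ g q := ((analyticAt_h hq.ne).fun_comp (analyticAt_R hq.np)).fun_div
    (analyticAt_const.sub (analyticAt_R_neg hq.np_neg)) (sub_ne_zero.mpr (hq.ne_neg n).symm)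
  refine ⟨deriv g q / M.U q q, g q, fun t ht hUt hht hne => ?_⟩
  have e1 : (fun u => M.G u (M.ε n) / (M.R u - M.R t)) =ᶠ[𝓝 q] fun u => g u / (M.R u - M.R t) := by
    filter_upwards [hq.toGen.eventually] with u hu
    rw [G_ε hu]
  have hx : M.R q - M.R t ≠ 0 := sub_ne_zero.mpr hne.symm
  have hd := hga.differentiableAt.hasDerivAt.fun_div ((hasDerivAt_R hq.np).sub_const (M.R t)) hx
  rw [markedIntegrand, e1.deriv_eq, hd.deriv, G_ε ht, R_ε, Ω₂, deriv_R hq.np, deriv_R ht.np, K]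
  have h1 : (M.e n : ℂ) - M.R (-t) ≠ 0 := sub_ne_zero.mpr (ht.ne_neg n).symm
  have h2 := h_ne_zero hht ht.ne
  have h3 := hq.U_ne
  field_simp

lemma eventually_R_ne (p y : ℂ) : ∀ᶠ t in 𝓝[≠] p, M.R t ≠ y := by
  have h := ((M.finite_R_eq y).subset (Set.sdiff_subset (t := {p}))).isClosed.isOpen_compl
  filter_upwards [nhdsWithin_le_nhds (h.mem_nhds (show p ∈ _ by simp)), self_mem_nhdsWithin]
    with w hw hwz hw'
  exact hw ⟨hw', hwz⟩

/-- The residue of `K(q,t) / (eₙ - R(-t))` at the simple pole `t = -v` with `R(v) = eₙ`. -/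
lemma residue_K_div_fiber {q v : ℂ} {n : Fin d} (hv : v ∈ M.fiber n) (hR : M.R q ≠ M.R (-v))
    (hqv : q ≠ v) :
    residue (fun t => M.K q t / (M.e n - M.R (-t))) (-v) = M.K q (-v) / M.U v v := by
  have hpv := fiber_not_isPole hv
  have hKa : AnalyticAt ℂ (M.K q) (-v) :=
    analyticAt_K (fiber_neg_not_isPole hv) hR (by rwa [neg_neg])
  have hUa : AnalyticAt ℂ (fun t => M.U v (-t)) (-v) :=
    analyticAt_U analyticAt_const (by fun_prop) hpv (by simpa using hpv)
  have hUv : M.U v (- -v) ≠ 0 := by simpa using fiber_deriv_ne_zero hv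
  have hg := hKa.fun_div hUa hUv
  have h := residue_div_sub hg
  rw [neg_neg] at h
  rw [← h]
  refine residue_congr (hg.meromorphicAt.fun_div (by fun_prop)) ?_
  have h1 : ∀ᶠ t in 𝓝 (-v), ¬ M.IsPole (-t) := eventually_not_isPole_neg (by simpa using hpv)
  filter_upwards [nhdsWithin_le_nhds h1] with t ht
  rw [← fiber_R hv, R_sub hpv ht, div_div, sub_neg_eq_add, sub_neg_eq_add, add_comm v,
    mul_comm (t + v)]

/-- `𝔱_{0,1}(q‖q,εₙ|)` as a sum of residues of `K(q,t) / (eₙ - R(-t))`; the residue at `t = q`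
remains unevaluated. The residues of the part with the boundary derivative add up to zero. -/
theorem t₀₁_eq {α : Fin d → ℂ} {q : ℂ} (hq : M.Generic α q) (n : Fin d) :
    M.t₀₁ q q (M.ε n) = M.h n (M.R q) / (M.e n - M.R (-q)) *
      (residue (fun t => M.K q t / (M.e n - M.R (-t))) q +
        ∑ v ∈ M.fiber n, M.K q (-v) / M.U v v) := by
  obtain ⟨A, B, hAB⟩ := markedIntegrand_eq hq n
  set ψ : ℂ → ℂ := fun r => (A / (M.R q - r) ^ 2 - B / (M.R q - r) ^ 3) * (M.h n r)⁻¹ with hψ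
  have hψm : ∀ s, MeromorphicAt ψ s := by
    intro s
    have := meromorphicAt_h (M := M) n s
    simp only [hψ]
    fun_prop
  have key : ∀ p, ¬ M.IsPole p → M.U p p ≠ 0 → residue (M.markedIntegrand q q (M.ε n)) p =
      (M.U q q)⁻¹ * residue (fun t => M.K q t / (M.e n - M.R (-t))) p + residue ψ (M.R p) := by
    intro p hp hU
    have hd : deriv M.R p ≠ 0 := by rwa [deriv_R hp]
    have h1 := meromorphicAt_K_div (M := M) q p n
    have h2 : MeromorphicAt (fun t => ψ (M.R t) * deriv M.R t) p :=
      ((hψm (M.R p)).comp_analyticAt (analyticAt_R hp)).fun_mul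
        (analyticAt_R hp).deriv.meromorphicAt
    rw [← residue_comp (analyticAt_R hp) hd (hψm _), ← residue_const_mul h1, ← residue_add
      ((MeromorphicAt.const _ _).fun_mul h1) h2]
    refine residue_congr (((MeromorphicAt.const _ _).fun_mul h1).fun_add h2) ?_
    have hUt : ∀ᶠ t in 𝓝 p, M.U t t ≠ 0 :=
      (analyticAt_U (M := M) (f := fun v => v) (g := fun v => v) analyticAt_id analyticAt_id
        hp hp).continuousAt.eventually_ne hU
    filter_upwards [eventually_gen p, nhdsWithin_le_nhds hUt, eventually_R_ne p (M.R q),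
      (M.fiber n).eventually_all.mpr fun v _ => eventually_R_ne p (M.R (-v))] with t h3 h4 h5 h6
    exact hAB t h3 h4 h6 h5
  have hsum := sum_residue_div_h n (M.R q) A B (hq.fiber_ne n)
  rw [t₀₁, T, ← coe_fiber, finsum_mem_coe_finset, G_ε hq.toGen, key q hq.np hq.U_ne,
    Finset.sum_congr rfl fun v hv => key (-v) (fiber_neg_not_isPole hv)
      (fiber_deriv_neg_ne_zero hv), Finset.sum_add_distrib, ← Finset.mul_sum,
    Finset.sum_congr rfl fun v hv => residue_K_div_fiber hv (hq.fiber_ne n v hv)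
      (fun h => (gen_iff.mp hq.toGen).2.2.1 n (h ▸ hv)), deriv_R hq.np]
  have h1 : (M.lam : ℂ) ≠ 0 := by exact_mod_cast M.lam_pos.ne'
  have h3 := hq.U_ne
  rw [add_add_add_comm, hsum, add_zero]
  field_simp

end Model

namespace Model

variable {d : ℕ} {M : Model d}

/-! ### The planar `(1+1)`-point function -/

/-- The derivative of `Φ` in its last argument. -/
def Φ₂ (M : Model d) (x x' y : ℂ) : ℂ :=
  M.c * ∑ k, M.r k * M.h k x / ((M.e k - x') * (M.e k - y) ^ 2)

lemma hasDerivAt_Φ {x x' y : ℂ} (hx' : ∀ k, x' ≠ M.e k) (hy : ∀ k, y ≠ M.e k) :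
    HasDerivAt (M.Φ x x') (M.Φ₂ x x' y) y := by
  unfold Φ Φ₂
  refine (((HasDerivAt.fun_sum fun k _ => ?_).const_mul _).const_add 1)
  have h1 : (M.e k : ℂ) - x' ≠ 0 := sub_ne_zero.mpr (hx' k).symm
  have h2 : (M.e k : ℂ) - y ≠ 0 := sub_ne_zero.mpr (hy k).symm
  refine ((hasDerivAt_const y (M.r k * M.h k x)).fun_div (((hasDerivAt_id y).const_sub
    (M.e k : ℂ)).const_mul (M.e k - x')) (mul_ne_zero h1 h2)).congr_deriv ?_
  simp only [id]
  field_simp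
  ring

lemma eventually_ne_e {y : ℂ} (hy : ∀ k, y ≠ M.e k) : ∀ᶠ z in 𝓝 y, ∀ k, z ≠ (M.e k : ℂ) :=
  eventually_all.mpr fun k => isOpen_ne.mem_nhds (hy k)

lemma Φ_add_mul_Φ₂ {w y : ℂ} (hw : M.Gen w) (hy : ∀ k, y ≠ M.e k) :
    M.Φ (M.R w) (M.R (-w)) y + (y - M.R (-w)) * M.Φ₂ (M.R w) (M.R (-w)) y =
      M.P₁ y (M.R w) := by
  have h1 := hasDerivAt_P (f := fun z => z) (g := fun _ => M.R w) (hasDerivAt_id' y)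
    (hasDerivAt_const y _) hy hw.ne
  have h2 := ((hasDerivAt_id' y).sub_const (M.R (-w))).fun_mul
    (hasDerivAt_Φ (x := M.R w) hw.ne_neg hy)
  have h3 := h2.congr_of_eventuallyEq (f₁ := fun z => M.P z (M.R w)) (by
    filter_upwards [eventually_ne_e hy] with z hz
    exact P_eq_mul_Φ hw hz)
  linear_combination -h1.unique h3

/-- Second divided differences of `Φ`. -/
lemma Φ_divided_difference {x x' y₀ y₁ y₂ : ℂ} (h0 : ∀ k, y₀ ≠ M.e k) (h1 : ∀ k, y₁ ≠ M.e k)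
    (h2 : ∀ k, y₂ ≠ M.e k) (h01 : y₀ ≠ y₁) (h02 : y₀ ≠ y₂) (h12 : y₁ ≠ y₂) :
    M.c * ∑ k, M.r k * M.h k x / ((M.e k - x') * ((M.e k - y₀) * (M.e k - y₁) * (M.e k - y₂))) =
      M.Φ x x' y₀ / ((y₀ - y₁) * (y₀ - y₂)) + M.Φ x x' y₁ / ((y₁ - y₀) * (y₁ - y₂)) +
        M.Φ x x' y₂ / ((y₂ - y₀) * (y₂ - y₁)) := by
  have e01 := sub_ne_zero.mpr h01
  have e02 := sub_ne_zero.mpr h02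
  have e12 := sub_ne_zero.mpr h12
  have e10 := sub_ne_zero.mpr h01.symm
  have e20 := sub_ne_zero.mpr h02.symm
  have e21 := sub_ne_zero.mpr h12.symm
  have key : ∀ k, M.r k * M.h k x / ((M.e k - x') * ((M.e k - y₀) * (M.e k - y₁) * (M.e k - y₂))) =
      M.r k * M.h k x / ((M.e k - x') * (M.e k - y₀)) * ((y₀ - y₁) * (y₀ - y₂))⁻¹ +
      M.r k * M.h k x / ((M.e k - x') * (M.e k - y₁)) * ((y₁ - y₀) * (y₁ - y₂))⁻¹ +
      M.r k * M.h k x / ((M.e k - x') * (M.e k - y₂)) * ((y₂ - y₀) * (y₂ - y₁))⁻¹ := by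
    intro k
    have k0 : (M.e k : ℂ) - y₀ ≠ 0 := sub_ne_zero.mpr (h0 k).symm
    have k1 : (M.e k : ℂ) - y₁ ≠ 0 := sub_ne_zero.mpr (h1 k).symm
    have k2 : (M.e k : ℂ) - y₂ ≠ 0 := sub_ne_zero.mpr (h2 k).symm
    have : ((M.e k - y₀) * (M.e k - y₁) * (M.e k - y₂) : ℂ)⁻¹ =
        (M.e k - y₀ : ℂ)⁻¹ * ((y₀ - y₁) * (y₀ - y₂))⁻¹ +
        (M.e k - y₁ : ℂ)⁻¹ * ((y₁ - y₀) * (y₁ - y₂))⁻¹ +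
        (M.e k - y₂ : ℂ)⁻¹ * ((y₂ - y₀) * (y₂ - y₁))⁻¹ := by
      rw [← neg_sub y₀ y₁, ← neg_sub y₀ y₂, ← neg_sub y₁ y₂]
      field_simp
      ring
    simp only [div_eq_mul_inv]
    rw [mul_inv, this]
    simp only [mul_inv]
    ring
  rw [Finset.sum_congr rfl fun k _ => key k, Finset.sum_add_distrib, Finset.sum_add_distrib,
    ← Finset.sum_mul, ← Finset.sum_mul, ← Finset.sum_mul]
  have hone : ((y₀ - y₁) * (y₀ - y₂))⁻¹ + ((y₁ - y₀) * (y₁ - y₂))⁻¹ +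
      ((y₂ - y₀) * (y₂ - y₁))⁻¹ = 0 := by
    rw [← neg_sub y₀ y₁, ← neg_sub y₀ y₂, ← neg_sub y₁ y₂]
    field_simp
    ring
  rw [Φ, Φ, Φ]
  simp only [div_eq_mul_inv] at *
  linear_combination -hone

/-- Confluent second divided differences of `Φ`. -/
lemma Φ_divided_difference' {x x' y₀ y₁ : ℂ} (h0 : ∀ k, y₀ ≠ M.e k) (h1 : ∀ k, y₁ ≠ M.e k)
    (h01 : y₀ ≠ y₁) :
    M.c * ∑ k, M.r k * M.h k x / ((M.e k - x') * ((M.e k - y₀) ^ 2 * (M.e k - y₁))) =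
      (M.Φ₂ x x' y₀ * (y₀ - y₁) - M.Φ x x' y₀ + M.Φ x x' y₁) / (y₀ - y₁) ^ 2 := by
  have e01 := sub_ne_zero.mpr h01
  have key : ∀ k, M.r k * M.h k x / ((M.e k - x') * ((M.e k - y₀) ^ 2 * (M.e k - y₁))) =
      M.r k * M.h k x / ((M.e k - x') * (M.e k - y₀) ^ 2) * (y₀ - y₁)⁻¹ -
      M.r k * M.h k x / ((M.e k - x') * (M.e k - y₀)) * ((y₀ - y₁) ^ 2)⁻¹ +
      M.r k * M.h k x / ((M.e k - x') * (M.e k - y₁)) * ((y₀ - y₁) ^ 2)⁻¹ := by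
    intro k
    have k0 : (M.e k : ℂ) - y₀ ≠ 0 := sub_ne_zero.mpr (h0 k).symm
    have k1 : (M.e k : ℂ) - y₁ ≠ 0 := sub_ne_zero.mpr (h1 k).symm
    have : ((M.e k - y₀) ^ 2 * (M.e k - y₁) : ℂ)⁻¹ =
        ((M.e k - y₀ : ℂ) ^ 2)⁻¹ * (y₀ - y₁)⁻¹ - (M.e k - y₀ : ℂ)⁻¹ * ((y₀ - y₁) ^ 2)⁻¹ +
        (M.e k - y₁ : ℂ)⁻¹ * ((y₀ - y₁) ^ 2)⁻¹ := by
      field_simp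
      ring
    simp only [div_eq_mul_inv]
    rw [mul_inv, this]
    simp only [mul_inv]
    ring
  rw [Finset.sum_congr rfl fun k _ => key k, Finset.sum_add_distrib, Finset.sum_sub_distrib,
    ← Finset.sum_mul, ← Finset.sum_mul, ← Finset.sum_mul, Φ, Φ, Φ₂]
  field_simp
  ring

section alpha

variable {α : Fin d → ℂ}

lemma hasDerivAt_sum_div (u : Fin d → ℂ) {y : ℂ} (hy : ∀ j, y ≠ M.R (α j)) :
    HasDerivAt (fun y => 1 + ∑ j, u j / (y - M.R (α j)))
      (-∑ j, u j / (y - M.R (α j)) ^ 2) y := by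
  rw [← Finset.sum_neg_distrib]
  refine (HasDerivAt.fun_sum fun j _ => ?_).const_add 1
  refine ((hasDerivAt_const y (u j)).fun_div ((hasDerivAt_id y).sub_const (M.R (α j)))
    (sub_ne_zero.mpr (hy j))).congr_deriv ?_
  simp only [id]
  ring

lemma eventually_ne_α {y : ℂ} (hy : ∀ j, y ≠ M.R (α j)) : ∀ᶠ z in 𝓝 y, ∀ j, z ≠ M.R (α j) :=
  eventually_all.mpr fun j => isOpen_ne.mem_nhds (hy j)

lemma sum_κ_div_sq (hα : M.IsFixedPointFamily α) {y s : ℂ} (hy : ∀ k, y ≠ M.e k)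
    (hy' : ∀ j, y ≠ M.R (α j)) (hs : HasDerivAt (M.S α) s y) :
    ∑ j, M.κ α j / (y - M.R (α j)) ^ 2 = s / M.S α y ^ 2 := by
  have h1 := hs.fun_inv (S_ne_zero hy hy')
  have h2 := (hasDerivAt_sum_div (M.κ α) hy').congr_of_eventuallyEq
    (f₁ := fun y => (M.S α y)⁻¹) (by
      filter_upwards [eventually_ne_α hy'] with z hz
      exact inv_S_eq hα hz)
  linear_combination -h2.unique h1

lemma sum_κ_mul_Φ (hα : M.IsFixedPointFamily α) {w : ℂ} (hw : M.Gen w)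
    (hD : M.R w ≠ M.R (-w)) (hw' : ∀ j, M.R w ≠ M.R (α j)) :
    ∑ j, M.κ α j * M.Φ (M.R w) (M.R (-w)) (M.R (α j)) / (M.R w - M.R (α j)) ^ 2 =
      M.S α (M.R w) * (M.R w + M.R (-w) - 2 * M.R 0) / (M.R w - M.R (-w)) ^ 2 := by
  have hs := (analyticAt_S (α := α) hw.ne).differentiableAt.hasDerivAt
  have hS := S_ne_zero hw.ne hw'
  have h1 := (hasDerivAt_Φ (x := M.R w) hw.ne_neg hw.ne).fun_mul (hs.fun_inv hS)
  have h2 := (hasDerivAt_sum_div (fun j => M.κ α j * M.Φ (M.R w) (M.R (-w)) (M.R (α j)))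
    hw').congr_of_eventuallyEq (f₁ := fun y => M.Φ (M.R w) (M.R (-w)) y * (M.S α y)⁻¹) (by
      filter_upwards [eventually_ne_α hw', eventually_ne_e hw.ne] with z hz hz'
      exact Φ_div_S hα hz' hz)
  have h3 := h2.unique h1
  have h4 := P_eq_mul_Φ hw hw.ne
  rw [P_diag hα hw.ne] at h4
  have h5 := Φ_add_mul_Φ₂ hw hw.ne
  rw [P₁_diag hα hw.ne hs] at h5
  have hD' := sub_ne_zero.mpr hD
  rw [neg_eq_iff_eq_neg] at h3
  rw [h3]
  set s := deriv (M.S α) (M.R w)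
  set a := M.Φ (M.R w) (M.R (-w)) (M.R w)
  set b := M.Φ₂ (M.R w) (M.R (-w)) (M.R w)
  have h6 : a = 2 * (M.R w - M.R 0) * M.S α (M.R w) ^ 2 / (M.R w - M.R (-w)) := by
    rw [h4, mul_div_cancel_left₀ _ hD']
  have h7 : b = (M.S α (M.R w) ^ 2 + 2 * (M.R w - M.R 0) * M.S α (M.R w) * s - a) /
      (M.R w - M.R (-w)) := by
    rw [← h5]
    field_simp
    ring
  rw [h7, h6]
  field_simp
  ring

lemma residue_deriv_R_div {F : ℂ → ℂ} {q : ℂ} (hq : ¬ M.IsPole q) (hU : M.U q q ≠ 0)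
    (hF : AnalyticAt ℂ F q) :
    residue (fun t => deriv M.R t * F t / (M.R q - M.R t)) q = -F q := by
  have hUa : AnalyticAt ℂ (fun t => M.U q t) q :=
    analyticAt_U analyticAt_const analyticAt_id hq hq
  have hg := ((analyticAt_R hq).deriv.fun_mul hF).fun_div hUa.fun_neg (neg_ne_zero.mpr hU)
  have h := residue_div_sub hg
  have h1 : deriv M.R q * F q / -M.U q q = -F q := by
    rw [deriv_R hq]
    field_simp
  rw [h1] at h
  rw [← h]
  refine residue_congr (hg.meromorphicAt.fun_div (by fun_prop)) ?_
  filter_upwards [nhdsWithin_le_nhds (eventually_not_isPole hq)] with t ht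
  rw [R_sub hq ht, div_div, neg_mul_comm, neg_sub, mul_comm (q - t)]

lemma residue_deriv_R_div_sq {F : ℂ → ℂ} {q : ℂ} (hq : ¬ M.IsPole q) (hU : M.U q q ≠ 0)
    (hF : AnalyticAt ℂ F q) (hF0 : F q = 0) :
    residue (fun t => deriv M.R t * F t / (M.R q - M.R t) ^ 2) q = deriv F q / M.U q q := by
  have hUa : AnalyticAt ℂ (fun t => M.U q t) q :=
    analyticAt_U analyticAt_const analyticAt_id hq hq
  have hg1 := (analyticAt_R hq).deriv.fun_div (hUa.fun_pow 2) (pow_ne_zero 2 hU)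
  have hg := hg1.fun_mul hF
  have h := residue_div_sub_sq hg
  have h2 := hg1.differentiableAt.hasDerivAt.fun_mul hF.differentiableAt.hasDerivAt
  have h1 : deriv (fun t => deriv M.R t / M.U q t ^ 2 * F t) q = deriv F q / M.U q q := by
    rw [h2.deriv, hF0, deriv_R hq]
    field_simp
    ring
  rw [h1] at h
  rw [← h]
  refine residue_congr (hg.meromorphicAt.fun_div (by fun_prop)) ?_
  filter_upwards [nhdsWithin_le_nhds (eventually_not_isPole hq)] with t ht
  rw [R_sub hq ht, mul_pow, ← neg_sub t q, neg_sq, div_mul_eq_mul_div, div_div,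
    mul_comm ((t - q) ^ 2)]

/-- The residue at `αⱼ` of a form with a simple pole coming from `1 / S(R(t))`. -/
lemma residue_inv_S (hα : M.IsFixedPointFamily α) (j : Fin d) {F : ℂ → ℂ}
    (hF : AnalyticAt ℂ F (α j)) :
    residue (fun t => deriv M.R t * (M.S α (M.R t))⁻¹ * F t) (α j) = M.κ α j * F (α j) := by
  have hp := (hα.gen j).np
  have hU : M.U (α j) (α j) ≠ 0 := deriv_R_ne_zero_of_real (hα.im j)
  have hUa : AnalyticAt ℂ (fun t => M.U t (α j)) (α j) :=
    analyticAt_U analyticAt_id analyticAt_const hp hp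
  have hR := analyticAt_R hp
  have hne : ∏ i ∈ Finset.univ.erase j, (M.R (α j) - M.R (α i)) ≠ 0 :=
    Finset.prod_ne_zero_iff.mpr fun i hi => sub_ne_zero.mpr fun h =>
      Finset.ne_of_mem_erase hi (hα.R_injective h).symm
  have hE : AnalyticAt ℂ (fun t => (∏ i, (M.R t - M.e i)) /
      ∏ i ∈ Finset.univ.erase j, (M.R t - M.R (α i))) (α j) :=
    (Finset.analyticAt_fun_prod _ fun i _ => hR.sub analyticAt_const).fun_div
      (Finset.analyticAt_fun_prod _ fun i _ => hR.sub analyticAt_const) hne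
  have hg := ((hR.deriv.fun_mul hE).fun_mul hF).fun_div hUa hU
  have h := residue_div_sub hg
  have h1 : deriv M.R (α j) * ((∏ i, (M.R (α j) - M.e i)) /
      ∏ i ∈ Finset.univ.erase j, (M.R (α j) - M.R (α i))) * F (α j) / M.U (α j) (α j) =
      M.κ α j * F (α j) := by
    rw [deriv_R hp, κ, mul_assoc, mul_div_cancel_left₀ _ hU]
  rw [h1] at h
  rw [← h]
  refine residue_congr (hg.meromorphicAt.fun_div (by fun_prop)) ?_
  filter_upwards [nhdsWithin_le_nhds (eventually_not_isPole hp)] with t ht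
  rw [S, inv_div, ← Finset.mul_prod_erase Finset.univ (fun i => M.R t - M.R (α i))
    (Finset.mem_univ j), R_sub ht hp]
  simp only [div_eq_mul_inv, mul_inv]
  ring

lemma twoBoundaryIntegrand_eq (z w t : ℂ) : M.twoBoundaryIntegrand α z w t =
    deriv M.R t * (M.S α (M.R t))⁻¹ *
      ((M.G t w - M.G w w) / ((M.R z - M.R t) * (M.R w - M.R t))) := by
  rw [twoBoundaryIntegrand, S, inv_div]
  simp only [R_ε, div_eq_mul_inv, mul_inv]
  ring

lemma t₀₀_eq_residues (z w : ℂ) : M.t₀₀ α z w = M.S α (M.R z) / (M.R z - M.R (-z)) *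
    (residue (M.twoBoundaryIntegrand α z w) z +
      ∑ j, residue (M.twoBoundaryIntegrand α z w) (α j)) := by
  have h1 : (M.lam : ℂ) ≠ 0 := by exact_mod_cast M.lam_pos.ne'
  rw [t₀₀, G₁₁, S, Finset.prod_div_distrib]
  simp only [R_ε]
  field_simp

lemma analyticAt_inv_S_R {q : ℂ} (hq : M.Gen q) (hq' : ∀ j, M.R q ≠ M.R (α j)) :
    AnalyticAt ℂ (fun t => (M.S α (M.R t))⁻¹) q :=
  ((analyticAt_S hq.ne).fun_comp (analyticAt_R hq.np)).fun_inv (S_ne_zero hq.ne hq')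

/-- `𝔱_{0,0}(q|εₙ)` in closed form. The contribution of `𝒢⁽⁰⁾(εₙ,εₙ)` cancels in the sum of the
residues. -/
theorem t₀₀_ε (hα : M.IsFixedPointFamily α) {q : ℂ} (hq : M.Generic α q) (n : Fin d) :
    M.t₀₀ α q (M.ε n) = 1 / (M.R q - M.R (-q)) *
      (-(M.h n (M.R q) / ((M.e n - M.R (-q)) * (M.e n - M.R q))) + M.S α (M.R q) *
        ∑ j, M.κ α j * M.h n (M.R (α j)) /
          ((M.e n - M.R (α j)) ^ 2 * (M.R q - M.R (α j)))) := by
  set G0 := M.G (M.ε n) (M.ε n) with hG0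
  set g : ℂ → ℂ := fun t => M.h n (M.R t) / (M.e n - M.R (-t)) with hg
  have hga : ∀ t, M.Gen t → AnalyticAt ℂ g t := fun t ht =>
    ((analyticAt_h ht.ne).fun_comp (analyticAt_R ht.np)).fun_div
      (analyticAt_const.sub (analyticAt_R_neg ht.np_neg)) (sub_ne_zero.mpr (ht.ne_neg n).symm)
  have hS := S_ne_zero hq.ne hq.α_ne
  have hr1 : residue (M.twoBoundaryIntegrand α q (M.ε n)) q =
      -((M.S α (M.R q))⁻¹ * ((g q - G0) / (M.e n - M.R q))) := by
    have hF : AnalyticAt ℂ (fun t => (M.S α (M.R t))⁻¹ * ((g t - G0) / (M.e n - M.R t))) q :=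
      (analyticAt_inv_S_R hq.toGen hq.α_ne).fun_mul (((hga q hq.toGen).fun_sub
        analyticAt_const).fun_div (analyticAt_const.fun_sub (analyticAt_R hq.np))
        (sub_ne_zero.mpr (hq.ne n).symm))
    rw [← residue_deriv_R_div hq.np hq.U_ne hF]
    have hd := (analyticAt_R hq.np).deriv.meromorphicAt
    have hR := meromorphicAt_R (M := M) q
    refine residue_congr ((hd.fun_mul hF.meromorphicAt).fun_div (by fun_prop)) ?_
    filter_upwards [nhdsWithin_le_nhds hq.toGen.eventually] with t ht
    rw [twoBoundaryIntegrand_eq, G_ε ht, R_ε]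
    simp only [hg, div_eq_mul_inv, mul_inv]
    ring
  have hr2 : ∀ j, residue (M.twoBoundaryIntegrand α q (M.ε n)) (α j) =
      M.κ α j * ((M.h n (M.R (α j)) / (M.e n - M.R (α j)) - G0) /
        ((M.R q - M.R (α j)) * (M.e n - M.R (α j)))) := by
    intro j
    have hj := hα.gen j
    have hF : AnalyticAt ℂ (fun t => (g t - G0) / ((M.R q - M.R t) * (M.e n - M.R t))) (α j) :=
      ((hga _ hj).fun_sub analyticAt_const).fun_div ((analyticAt_const.fun_sub
        (analyticAt_R hj.np)).fun_mul (analyticAt_const.fun_sub (analyticAt_R hj.np)))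
        (mul_ne_zero (sub_ne_zero.mpr (hq.α_ne j)) (sub_ne_zero.mpr (hj.ne n).symm))
    have h := residue_inv_S hα j hF
    simp only [hg, hα.R_neg] at h
    rw [← h]
    have hd := (analyticAt_R hj.np).deriv.meromorphicAt
    have hiS : MeromorphicAt (fun t => (M.S α (M.R t))⁻¹) (α j) :=
      ((analyticAt_S hj.ne).fun_comp (analyticAt_R hj.np)).meromorphicAt.fun_inv
    refine residue_congr ((hd.fun_mul hiS).fun_mul hF.meromorphicAt) ?_
    filter_upwards [nhdsWithin_le_nhds hj.eventually] with t ht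
    rw [twoBoundaryIntegrand_eq, G_ε ht, R_ε]
  have hsum : ∑ j, M.κ α j * ((M.h n (M.R (α j)) / (M.e n - M.R (α j)) - G0) /
        ((M.R q - M.R (α j)) * (M.e n - M.R (α j)))) =
      ∑ j, M.κ α j * M.h n (M.R (α j)) / ((M.e n - M.R (α j)) ^ 2 * (M.R q - M.R (α j))) -
        G0 * ∑ j, M.κ α j / ((M.e n - M.R (α j)) * (M.R q - M.R (α j))) := by
    rw [Finset.mul_sum, ← Finset.sum_sub_distrib]
    refine Finset.sum_congr rfl fun j _ => ?_
    simp only [div_eq_mul_inv, mul_inv, ← inv_pow]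
    ring
  have hen : (M.e n : ℂ) - M.R q ≠ 0 := sub_ne_zero.mpr (hq.ne n).symm
  have hSk : ∑ j, M.κ α j / ((M.e n - M.R (α j)) * (M.R q - M.R (α j))) =
      (M.S α (M.R q))⁻¹ / (M.e n - M.R q) := by
    rw [inv_S_eq_mul hα hq.α_ne n, mul_div_cancel_left₀ _ hen]
  rw [t₀₀_eq_residues, hr1, Finset.sum_congr rfl fun j _ => hr2 j, hsum, hSk, hg]
  have h1 : (M.e n : ℂ) - M.R (-q) ≠ 0 := sub_ne_zero.mpr (hq.ne_neg n).symm
  have h2 := sub_ne_zero.mpr hq.D_ne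
  field_simp
  ring

/-- `𝔱_{0,0}(q|q)` in closed form. At `t = q` the integrand has only a simple pole because
`𝒢⁽⁰⁾(t,q) - 𝒢⁽⁰⁾(q,q)` vanishes there. -/
theorem t₀₀_self (hα : M.IsFixedPointFamily α) {q : ℂ} (hq : M.Generic α q) :
    M.t₀₀ α q q = 1 / (M.R q - M.R (-q)) *
      ((M.Φ₂ (M.R q) (M.R (-q)) (M.R q) / (M.R q - M.R (-q)) -
          M.Φ (M.R q) (M.R (-q)) (M.R q) * M.U (-q) (-q) /
            (M.U q q * (M.R q - M.R (-q)) ^ 2)) +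
        M.S α (M.R q) * (∑ j, M.κ α j * M.Φ (M.R q) (M.R (-q)) (M.R (α j)) /
            (M.R q - M.R (α j)) ^ 3 -
          M.Φ (M.R q) (M.R (-q)) (M.R q) / (M.R q - M.R (-q)) *
            ∑ j, M.κ α j / (M.R q - M.R (α j)) ^ 2)) := by
  set g : ℂ → ℂ := fun t => M.Φ (M.R q) (M.R (-q)) (M.R t) / (M.R q - M.R (-t)) with hg
  have hD := sub_ne_zero.mpr hq.D_ne
  have hU := hq.U_ne
  have hS := S_ne_zero hq.ne hq.α_ne
  have hga : ∀ t, M.Gen t → M.R q ≠ M.R (-t) → AnalyticAt ℂ g t := fun t ht h =>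
    (analyticAt_Φ analyticAt_const analyticAt_const (analyticAt_R ht.np) hq.ne hq.ne_neg
      ht.ne).fun_div (analyticAt_const.sub (analyticAt_R_neg ht.np_neg)) (sub_ne_zero.mpr h)
  have hgd : deriv g q = M.U q q * (M.Φ₂ (M.R q) (M.R (-q)) (M.R q) / (M.R q - M.R (-q)) -
      M.Φ (M.R q) (M.R (-q)) (M.R q) * M.U (-q) (-q) /
            (M.U q q * (M.R q - M.R (-q)) ^ 2)) := by
    have h1 := ((hasDerivAt_Φ (x := M.R q) hq.ne_neg hq.ne).comp q (hasDerivAt_R hq.np)).fun_div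
      ((hasDerivAt_R_neg hq.np_neg).const_sub (M.R q)) hD
    simp only [Function.comp] at h1
    rw [hg, h1.deriv]
    field_simp
  have hG : ∀ t, M.Gen t → M.R q ≠ M.R (-t) → M.G t q = g t := fun t ht h => G_eq ht hq.toGen h
  have hr1 : residue (M.twoBoundaryIntegrand α q q) q =
      (M.S α (M.R q))⁻¹ * deriv g q / M.U q q := by
    have hiS := analyticAt_inv_S_R hq.toGen hq.α_ne
    have hgq := hga q hq.toGen hq.D_ne
    have hF : AnalyticAt ℂ (fun t => (M.S α (M.R t))⁻¹ * (g t - g q)) q :=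
      hiS.fun_mul (hgq.fun_sub analyticAt_const)
    have h1 := hiS.differentiableAt.hasDerivAt.fun_mul
      (hgq.differentiableAt.hasDerivAt.sub_const (g q))
    have h2 : deriv (fun t => (M.S α (M.R t))⁻¹ * (g t - g q)) q =
        (M.S α (M.R q))⁻¹ * deriv g q := by
      rw [h1.deriv, sub_self, mul_zero, zero_add]
    rw [← h2, ← residue_deriv_R_div_sq hq.np hq.U_ne hF (by simp)]
    have hd := (analyticAt_R hq.np).deriv.meromorphicAt
    have hR := meromorphicAt_R (M := M) q
    refine residue_congr ((hd.fun_mul hF.meromorphicAt).fun_div (by fun_prop)) ?_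
    have hev := (analyticAt_R_neg hq.np_neg).continuousAt.eventually_ne hq.D_ne.symm
    filter_upwards [nhdsWithin_le_nhds hq.toGen.eventually, nhdsWithin_le_nhds hev] with t ht ht'
    rw [twoBoundaryIntegrand_eq, hG t ht ht'.symm, hG q hq.toGen hq.D_ne]
    simp only [div_eq_mul_inv, mul_inv, sq]
    ring
  have hr2 : ∀ j, residue (M.twoBoundaryIntegrand α q q) (α j) =
      M.κ α j * ((M.Φ (M.R q) (M.R (-q)) (M.R (α j)) / (M.R q - M.R (α j)) - g q) /
        ((M.R q - M.R (α j)) * (M.R q - M.R (α j)))) := by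
    intro j
    have hj := hα.gen j
    have hne := sub_ne_zero.mpr (hq.α_ne j)
    have hF : AnalyticAt ℂ (fun t => (g t - g q) / ((M.R q - M.R t) * (M.R q - M.R t))) (α j) :=
      ((hga _ hj (by rw [hα.R_neg]; exact hq.α_ne j)).fun_sub analyticAt_const).fun_div
        ((analyticAt_const.fun_sub (analyticAt_R hj.np)).fun_mul (analyticAt_const.fun_sub
        (analyticAt_R hj.np))) (mul_ne_zero hne hne)
    have h := residue_inv_S hα j hF
    have hgj : g (α j) = M.Φ (M.R q) (M.R (-q)) (M.R (α j)) / (M.R q - M.R (α j)) := by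
      simp only [hg, hα.R_neg]
    rw [hgj] at h
    rw [← h]
    have hd := (analyticAt_R hj.np).deriv.meromorphicAt
    have hiS : MeromorphicAt (fun t => (M.S α (M.R t))⁻¹) (α j) :=
      ((analyticAt_S hj.ne).fun_comp (analyticAt_R hj.np)).meromorphicAt.fun_inv
    refine residue_congr ((hd.fun_mul hiS).fun_mul hF.meromorphicAt) ?_
    have hev := (analyticAt_R_neg hj.np_neg).continuousAt.eventually_ne (y := M.R q)
      (by rw [hα.R_neg]; exact (hq.α_ne j).symm)
    filter_upwards [nhdsWithin_le_nhds hj.eventually, nhdsWithin_le_nhds hev] with t ht ht'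
    rw [twoBoundaryIntegrand_eq, hG t ht ht'.symm, hG q hq.toGen hq.D_ne]
  have hsum : ∑ j, M.κ α j * ((M.Φ (M.R q) (M.R (-q)) (M.R (α j)) / (M.R q - M.R (α j)) - g q) /
        ((M.R q - M.R (α j)) * (M.R q - M.R (α j)))) =
      ∑ j, M.κ α j * M.Φ (M.R q) (M.R (-q)) (M.R (α j)) / (M.R q - M.R (α j)) ^ 3 -
        g q * ∑ j, M.κ α j / (M.R q - M.R (α j)) ^ 2 := by
    rw [Finset.mul_sum, ← Finset.sum_sub_distrib]
    refine Finset.sum_congr rfl fun j _ => ?_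
    simp only [div_eq_mul_inv, mul_inv, ← inv_pow]
    ring
  rw [t₀₀_eq_residues, hr1, Finset.sum_congr rfl fun j _ => hr2 j, hsum, hgd, hg]
  set σ₁ := ∑ j, M.κ α j * M.Φ (M.R q) (M.R (-q)) (M.R (α j)) / (M.R q - M.R (α j)) ^ 3
  set σ₂ := ∑ j, M.κ α j / (M.R q - M.R (α j)) ^ 2
  field_simp

/-- The part of the integrand of `ω_{1,1}` that consists of planar functions with two
boundaries. -/
def C (M : Model d) (α : Fin d → ℂ) (q : ℂ) : ℂ :=
  M.c * ∑ n, M.r n * M.t₀₀ α q (M.ε n) / ((M.e n - M.R q) * (M.e n - M.R (-q))) - M.t₀₀ α q q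

/-- The functions with two boundaries in closed form. The sums over the points `αⱼ` are
evaluated with the partial fractions of `Φ / S` (`sum_κ_mul_Φ`). -/
theorem C_eq (hα : M.IsFixedPointFamily α) {q : ℂ} (hq : M.Generic α q) :
    M.C α q = M.P (M.R q) (M.R q) * (2 * M.U q q + M.U (-q) (-q)) /
        (M.U q q * (M.R q - M.R (-q)) ^ 4) - M.P₁ (M.R q) (M.R q) / (M.R q - M.R (-q)) ^ 3 -
      M.P₁ (M.R (-q)) (M.R q) / (M.R q - M.R (-q)) ^ 3 +
      M.S α (M.R q) * M.S α (M.R (-q)) * (M.R q + M.R (-q) - 2 * M.R 0) /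
        (M.R q - M.R (-q)) ^ 4 := by
  have hD := sub_ne_zero.mpr hq.D_ne
  have hU := hq.U_ne
  have hS := S_ne_zero hq.ne hq.α_ne
  have hs := (analyticAt_S (α := α) hq.ne).differentiableAt.hasDerivAt
  have h1 := Φ_divided_difference' (x := M.R q) (x' := M.R (-q)) hq.ne hq.ne_neg hq.D_ne
  rw [Φ_self hq.ne] at h1
  -- after an exchange of the sums, the one over `n` is a second divided difference of `Φ`
  have h2 : M.c * ∑ n, M.r n * (∑ j, M.κ α j * M.h n (M.R (α j)) /
      ((M.e n - M.R (α j)) ^ 2 * (M.R q - M.R (α j)))) /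
        ((M.e n - M.R q) * (M.e n - M.R (-q))) =
      (∑ j, M.κ α j * M.Φ (M.R q) (M.R (-q)) (M.R (α j)) / (M.R q - M.R (α j)) ^ 3) +
      (M.S α (M.R (-q)) * (M.R q + M.R (-q) - 2 * M.R 0) -
        M.S α (M.R q) * (M.R q + M.R (-q) - 2 * M.R 0)) / (M.R q - M.R (-q)) ^ 3 := by
    have a1 := sum_κ_mul_Φ hα hq.toGen hq.D_ne hq.α_ne
    have a2 := sum_κ_mul_Φ hα hq.neg (by rw [neg_neg]; exact hq.D_ne.symm) hq.α_ne_neg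
    rw [neg_neg] at a2
    have a3 : ∀ j, M.κ α j / (M.R q - M.R (α j)) * (M.c * ∑ n, M.r n * M.h n (M.R (α j)) /
        ((M.e n - M.R (α j)) * ((M.e n - M.R (α j)) * (M.e n - M.R q) * (M.e n - M.R (-q))))) =
        M.κ α j * M.Φ (M.R q) (M.R (-q)) (M.R (α j)) / (M.R q - M.R (α j)) ^ 3 -
        1 / (M.R q - M.R (-q)) *
          (M.κ α j * M.Φ (M.R q) (M.R (-q)) (M.R (α j)) / (M.R q - M.R (α j)) ^ 2) +
        1 / (M.R q - M.R (-q)) *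
          (M.κ α j * M.Φ (M.R (-q)) (M.R q) (M.R (α j)) / (M.R (-q) - M.R (α j)) ^ 2) := by
      intro j
      have hj := hα.gen j
      have e1 := sub_ne_zero.mpr (hq.α_ne j)
      have e2 := sub_ne_zero.mpr (hq.α_ne_neg j)
      have e3 : M.R (α j) - M.R q ≠ 0 := sub_ne_zero.mpr (hq.α_ne j).symm
      have e4 : M.R (α j) - M.R (-q) ≠ 0 := sub_ne_zero.mpr (hq.α_ne_neg j).symm
      have e5 : M.R (-q) - M.R q ≠ 0 := sub_ne_zero.mpr hq.D_ne.symm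
      have b1 := P_eq_mul_Φ hj hq.ne
      have b2 := P_eq_mul_Φ hj hq.ne_neg
      rw [hα.R_neg] at b1 b2
      rw [P_symm, P_eq_mul_Φ hq.toGen hj.ne] at b1
      rw [P_symm, P_eq_mul_Φ hq.neg hj.ne, neg_neg] at b2
      rw [Φ_divided_difference hj.ne hq.ne hq.ne_neg (hq.α_ne j).symm (hq.α_ne_neg j).symm hq.D_ne,
        Φ_self hj.ne, hα.P₁_eq_zero, zero_div, zero_add,
        eq_div_of_mul_eq e1 ((mul_comm _ _).trans b1.symm),
        eq_div_of_mul_eq e2 ((mul_comm _ _).trans b2.symm)]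
      set φ := M.Φ (M.R q) (M.R (-q)) (M.R (α j))
      set φ' := M.Φ (M.R (-q)) (M.R q) (M.R (α j))
      rw [← neg_sub (M.R q) (M.R (-q)), ← neg_sub (M.R q) (M.R (α j))]
      field_simp
      ring
    have a4 : M.c * ∑ n, M.r n * (∑ j, M.κ α j * M.h n (M.R (α j)) /
      ((M.e n - M.R (α j)) ^ 2 * (M.R q - M.R (α j)))) /
        ((M.e n - M.R q) * (M.e n - M.R (-q))) =
        ∑ j, M.κ α j / (M.R q - M.R (α j)) * (M.c * ∑ n, M.r n * M.h n (M.R (α j)) /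
        ((M.e n - M.R (α j)) * ((M.e n - M.R (α j)) * (M.e n - M.R q) * (M.e n - M.R (-q))))) := by
      simp only [Finset.mul_sum, Finset.sum_div]
      rw [Finset.sum_comm]
      refine Finset.sum_congr rfl fun j _ => Finset.sum_congr rfl fun n _ => ?_
      simp only [div_eq_mul_inv, mul_inv, ← inv_pow]
      ring
    rw [a4, Finset.sum_congr rfl fun j _ => a3 j, Finset.sum_add_distrib, Finset.sum_sub_distrib,
      ← Finset.mul_sum, ← Finset.mul_sum, a1, a2, ← neg_sub (M.R q) (M.R (-q)), neg_sq]
    field_simp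
    ring
  have h3 : M.c * ∑ n, M.r n * M.t₀₀ α q (M.ε n) / ((M.e n - M.R q) * (M.e n - M.R (-q))) =
      1 / (M.R q - M.R (-q)) * (-(M.c * ∑ k, M.r k * M.h k (M.R q) / ((M.e k - M.R (-q)) *
        ((M.e k - M.R q) ^ 2 * (M.e k - M.R (-q))))) + M.S α (M.R q) *
        (M.c * ∑ n, M.r n * (∑ j, M.κ α j * M.h n (M.R (α j)) /
      ((M.e n - M.R (α j)) ^ 2 * (M.R q - M.R (α j)))) /
        ((M.e n - M.R q) * (M.e n - M.R (-q))))) := by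
    simp only [Finset.mul_sum, ← Finset.sum_neg_distrib, ← Finset.sum_add_distrib]
    refine Finset.sum_congr rfl fun n _ => ?_
    rw [t₀₀_ε hα hq]
    simp only [← Finset.mul_sum]
    set σ₁ := ∑ j, M.κ α j * M.h n (M.R (α j)) / ((M.e n - M.R (α j)) ^ 2 * (M.R q - M.R (α j)))
    simp only [div_eq_mul_inv, mul_inv, ← inv_pow]
    ring
  have h4 := P_eq_mul_Φ hq.toGen hq.ne
  have h4' := h4
  rw [P_diag hα hq.ne] at h4'
  have h5 := Φ_add_mul_Φ₂ hq.toGen hq.ne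
  have h6 := P₁_diag hα hq.ne hs
  rw [C, h3, h1, h2, t₀₀_self hα hq, sum_κ_div_sq hα hq.ne hq.α_ne hs]
  set s := deriv (M.S α) (M.R q)
  set a := M.Φ (M.R q) (M.R (-q)) (M.R q)
  set b := M.Φ₂ (M.R q) (M.R (-q)) (M.R q)
  set σ₁ := ∑ j, M.κ α j * M.Φ (M.R q) (M.R (-q)) (M.R (α j)) / (M.R q - M.R (α j)) ^ 3
  set x := M.R q
  set x' := M.R (-q)
  set f := M.P₁ x' x
  have h7 : a = 2 * (x - M.R 0) * M.S α x ^ 2 / (x - x') := by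
    rw [h4', mul_div_cancel_left₀ _ hD]
  have h8 : b = (M.P₁ x x - a) / (x - x') := by
    rw [← h5]
    field_simp
    ring
  rw [h4, h8, h6, h7]
  field_simp
  ring

end alpha

end Model

namespace Model

variable {d : ℕ} {M : Model d}

/-! ### Ramification points and the local sheets -/

lemma analyticAt_Ξ {f g h : ℂ → ℂ} {a : ℂ} (hf : AnalyticAt ℂ f a) (hg : AnalyticAt ℂ g a)
    (hh : AnalyticAt ℂ h a) (h1 : ¬ M.IsPole (f a)) (h2 : ¬ M.IsPole (g a))
    (h3 : ¬ M.IsPole (h a)) : AnalyticAt ℂ (fun z => M.Ξ (f z) (g z) (h z)) a := by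
  unfold Ξ
  refine analyticAt_const.mul (Finset.analyticAt_fun_sum _ fun k _ => ?_)
  exact analyticAt_const.fun_div (((analyticAt_const.add hf).mul (analyticAt_const.add hg)).mul
    (analyticAt_const.add hh)) (mul_ne_zero (mul_ne_zero (eps_add_ne h1 k) (eps_add_ne h2 k))
    (eps_add_ne h3 k))

lemma hasDerivAt_U {f g : ℂ → ℂ} {f' g' a : ℂ} (hf : HasDerivAt f f' a) (hg : HasDerivAt g g' a)
    (h1 : ¬ M.IsPole (f a)) (h2 : ¬ M.IsPole (g a)) :
    HasDerivAt (fun z => M.U (f z) (g z))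
      (-M.Ξ (g a) (f a) (f a) * f' - M.Ξ (f a) (g a) (g a) * g') a := by
  unfold U Ξ
  have e : ∀ k ∈ Finset.univ, HasDerivAt
      (fun z => (M.ρ k : ℂ) / ((M.ε k + f z) * (M.ε k + g z)))
      (-(M.ρ k / ((M.ε k + g a) * (M.ε k + f a) * (M.ε k + f a)) * f' +
        M.ρ k / ((M.ε k + f a) * (M.ε k + g a) * (M.ε k + g a)) * g')) a := by
    intro k _
    have n1 := eps_add_ne h1 k
    have n2 := eps_add_ne h2 k
    refine ((hasDerivAt_const a (M.ρ k : ℂ)).fun_div ((hf.const_add (M.ε k : ℂ)).fun_mul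
      (hg.const_add (M.ε k : ℂ))) (mul_ne_zero n1 n2)).congr_deriv ?_
    field_simp
    ring
  refine (((HasDerivAt.fun_sum e).const_mul (M.c : ℂ)).const_add 1).congr_deriv ?_
  rw [Finset.sum_neg_distrib, Finset.sum_add_distrib, ← Finset.sum_mul, ← Finset.sum_mul]
  ring

/-- A simple ramification point of `R` off the real axis. -/
structure Ram (M : Model d) (b : ℂ) : Prop where
  im_ne : b.im ≠ 0
  U_eq : M.U b b = 0
  Ξ_ne : M.Ξ b b b ≠ 0

lemma deriv_R_neg_ne {b : ℂ} (hi : b.im ≠ 0) (hU : M.U b b = 0) : M.U (-b) (-b) ≠ 0 :=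
  (U_ne_zero_or (mul_self_pos.mpr hi)).resolve_left (not_not.mpr hU)

/-- A local solution `σ` of `U(z,σ(z)) = 0`, i.e. a second solution of `R(σ(z)) = R(z)`,
near a ramification point `b`. -/
structure IsSheet (M : Model d) (b : ℂ) (σ : ℂ → ℂ) : Prop where
  analyticAt : AnalyticAt ℂ σ b
  map_self : σ b = b
  eventually_U : ∀ᶠ z in 𝓝 b, M.U z (σ z) = 0

open scoped ContDiff in
/-- The implicit function theorem for `U(z,s) = 0` at `(b,b)`, where `∂U/∂s = R''(b)/2`. -/
lemma exists_isSheet {b : ℂ} (hb : M.Ram b) : ∃ σ, M.IsSheet b σ := by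
  have hp : ¬ M.IsPole b := not_isPole_of_im hb.im_ne
  have ha : AnalyticAt ℂ (fun p : ℂ × ℂ => M.U p.1 p.2) (b, b) := by
    unfold U
    refine analyticAt_const.fun_add (analyticAt_const.fun_mul
      (Finset.analyticAt_fun_sum _ fun k _ => ?_))
    exact analyticAt_const.fun_div ((analyticAt_const.fun_add analyticAt_fst).fun_mul
      (analyticAt_const.fun_add analyticAt_snd)) (mul_ne_zero (eps_add_ne hp k) (eps_add_ne hp k))
  have hc : ContDiffAt ℂ ω (fun p : ℂ × ℂ => M.U p.1 p.2) (b, b) := ha.contDiffAt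
  have hd : fderiv ℂ (fun p : ℂ × ℂ => M.U p.1 p.2) (b, b) (0, 1) = -M.Ξ b b b := by
    have h1 := ha.differentiableAt.hasFDerivAt.comp_hasDerivAt b
      ((hasDerivAt_const b b).prodMk (hasDerivAt_id b))
    have h2 := hasDerivAt_U (M := M) (hasDerivAt_const b b) (hasDerivAt_id' b) hp hp
    have := h1.unique h2
    rw [this]
    ring
  have hi : (fderiv ℂ (fun p : ℂ × ℂ => M.U p.1 p.2) (b, b) ∘L .inr ℂ ℂ ℂ).IsInvertible := by
    refine ⟨ContinuousLinearEquiv.unitsEquivAut ℂ (Units.mk0 _ (neg_ne_zero.mpr hb.Ξ_ne)),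
      ContinuousLinearMap.ext_ring ?_⟩
    simp [hd]
  have hn : (ω : WithTop ℕ∞) ≠ 0 := by simp
  refine ⟨hc.implicitFunction hn hi, ?_, hc.implicitFunction_apply_self hn hi, ?_⟩
  · exact (hc.contDiffAt_implicitFunction hn hi).analyticAt
  · have := hc.eventually_apply_implicitFunction hn hi
    simp only [hb.U_eq] at this
    exact this

lemma isSheet_of_involution {b : ℂ} (hb : M.Ram b) {σ : ℂ → ℂ}
    (h : IsLocalGaloisInvolution M.R b σ) : M.IsSheet b σ := by
  obtain ⟨h1, h2, h3, h4⟩ := h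
  have hp : ¬ M.IsPole b := not_isPole_of_im hb.im_ne
  refine ⟨h1, h2, ?_⟩
  have h5 : ∀ᶠ z in 𝓝[≠] b, σ z - z ≠ 0 := by
    refine ((h1.sub analyticAt_id).eventually_eq_zero_or_eventually_ne_zero).resolve_left ?_
    intro h
    exact h4 (h.mono fun z hz => sub_eq_zero.mp hz)
  have h6 : ∀ᶠ z in 𝓝 b, ¬ M.IsPole (σ z) :=
    h1.continuousAt.eventually (by rw [h2]; exact eventually_not_isPole hp)
  have h7 : ∀ᶠ z in 𝓝[≠] b, M.U z (σ z) = 0 := by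
    filter_upwards [h5, nhdsWithin_le_nhds h3, nhdsWithin_le_nhds h6,
      nhdsWithin_le_nhds (eventually_not_isPole hp)] with z e1 e2 e3 e4
    have := R_sub e4 e3
    rw [e2, sub_self, eq_comm, mul_eq_zero] at this
    exact this.resolve_left fun h => e1 (by linear_combination -h)
  rw [eventually_nhdsWithin_iff] at h7
  filter_upwards [h7] with z hz
  by_cases hzb : z = b
  · rw [hzb, h2, hb.U_eq]
  · exact hz hzb

namespace IsSheet

variable {b : ℂ} {σ : ℂ → ℂ}

lemma eventually_comp (hσ : M.IsSheet b σ) {p : ℂ → Prop} (hp : ∀ᶠ z in 𝓝 b, p z) :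
    ∀ᶠ z in 𝓝 b, p (σ z) :=
  hσ.analyticAt.continuousAt.eventually (by rwa [hσ.map_self])

lemma eventually_not_isPole (hb : M.Ram b) (hσ : M.IsSheet b σ) :
    ∀ᶠ z in 𝓝 b, ¬ M.IsPole z ∧ ¬ M.IsPole (-z) ∧ ¬ M.IsPole (σ z) ∧ ¬ M.IsPole (-σ z) := by
  have hg := gen_of_im (M := M) hb.im_ne
  filter_upwards [hg.eventually, hσ.eventually_comp hg.eventually] with z h1 h2
  exact ⟨h1.np, h1.np_neg, h2.np, h2.np_neg⟩

lemma deriv_eq (hb : M.Ram b) (hσ : M.IsSheet b σ) : deriv σ b = -1 := by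
  have hp : ¬ M.IsPole b := not_isPole_of_im hb.im_ne
  have h1 := hasDerivAt_U (M := M) (hasDerivAt_id' b) hσ.analyticAt.differentiableAt.hasDerivAt hp
    (by rwa [hσ.map_self])
  have h2 : HasDerivAt (fun z => M.U z (σ z)) 0 b :=
    (hasDerivAt_const b (0 : ℂ)).congr_of_eventuallyEq hσ.eventually_U
  have h3 := h1.unique h2
  rw [hσ.map_self] at h3
  have h4 := hb.Ξ_ne
  have : M.Ξ b b b * (deriv σ b + 1) = 0 := by linear_combination -h3
  exact eq_neg_of_add_eq_zero_left ((mul_eq_zero.mp this).resolve_left h4)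

lemma eventually_ne (hb : M.Ram b) (hσ : M.IsSheet b σ) : ∀ᶠ z in 𝓝[≠] b, σ z ≠ z := by
  have h := (hσ.analyticAt.differentiableAt.hasDerivAt.sub (hasDerivAt_id b)).eventually_ne
    (c := 0) (by rw [hσ.deriv_eq hb]; norm_num)
  filter_upwards [h] with z hz h0
  exact hz (sub_eq_zero.mpr h0)

lemma eventually_R (hb : M.Ram b) (hσ : M.IsSheet b σ) : ∀ᶠ z in 𝓝 b, M.R (σ z) = M.R z := by
  filter_upwards [hσ.eventually_U, hσ.eventually_not_isPole hb] with z h1 h2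
  have := R_sub h2.1 h2.2.2.1
  rw [h1, mul_zero, sub_eq_zero] at this
  exact this.symm

lemma eventually_deriv (hb : M.Ram b) (hσ : M.IsSheet b σ) :
    ∀ᶠ z in 𝓝 b, M.U (σ z) (σ z) * deriv σ z = M.U z z := by
  filter_upwards [(hσ.eventually_R hb).eventually_nhds, hσ.eventually_not_isPole hb,
    hσ.analyticAt.eventually_analyticAt] with z h1 h2 h3
  have h4 := (hasDerivAt_R h2.2.2.1).comp z h3.differentiableAt.hasDerivAt
  exact (h4.congr_of_eventuallyEq (f₁ := M.R) (h1.mono fun w hw => hw.symm)).unique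
    (hasDerivAt_R h2.1)

lemma eventually_involutive (hb : M.Ram b) (hσ : M.IsSheet b σ) :
    ∀ᶠ z in 𝓝 b, σ (σ z) = z := by
  have hp : ¬ M.IsPole b := not_isPole_of_im hb.im_ne
  have hσσ : AnalyticAt ℂ (fun z => σ (σ z)) b := by
    have : AnalyticAt ℂ σ (σ b) := by rw [hσ.map_self]; exact hσ.analyticAt
    exact this.fun_comp hσ.analyticAt
  have hX : AnalyticAt ℂ (fun z => M.Ξ (σ z) z (σ (σ z))) b :=
    analyticAt_Ξ hσ.analyticAt analyticAt_id hσσ (by rwa [hσ.map_self]) hp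
      (by rwa [hσ.map_self, hσ.map_self])
  have hX' := hX.continuousAt.eventually_ne (y := 0) (by simpa [hσ.map_self] using hb.Ξ_ne)
  filter_upwards [hX', hσ.eventually_U, hσ.eventually_comp hσ.eventually_U,
    hσ.eventually_not_isPole hb, hσ.eventually_comp (hσ.eventually_not_isPole hb)]
    with z h1 h2 h3 h4 h5
  have := U_sub h4.2.2.1 h4.1 h5.2.2.1
  rw [h3, M.U_comm, h2, sub_self, eq_comm, mul_eq_zero] at this
  exact sub_eq_zero.mp (this.resolve_right h1)

/-- `R'` vanishes near `b` only in `b`. -/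
lemma _root_.QuarticKontsevich.Model.Ram.eventually_U_ne (hb : M.Ram b) :
    ∀ᶠ z in 𝓝[≠] b, M.U z z ≠ 0 := by
  have hp : ¬ M.IsPole b := not_isPole_of_im hb.im_ne
  refine (hasDerivAt_U (M := M) (hasDerivAt_id' b) (hasDerivAt_id' b) hp hp).eventually_ne ?_
  have := hb.Ξ_ne
  intro h
  exact this (by linear_combination -h / 2)

lemma tendsto_punctured (hb : M.Ram b) (hσ : M.IsSheet b σ) : Tendsto σ (𝓝[≠] b) (𝓝[≠] b) := by
  refine tendsto_nhdsWithin_of_tendsto_nhds_of_eventually_within _ ?_ ?_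
  · have := hσ.analyticAt.continuousAt.tendsto
    rw [hσ.map_self] at this
    exact this.mono_left nhdsWithin_le_nhds
  · have h := hσ.analyticAt.differentiableAt.hasDerivAt.eventually_ne (c := b)
      (by rw [hσ.deriv_eq hb]; norm_num)
    exact h

lemma eventually_R_neg_ne (hb : M.Ram b) (hσ : M.IsSheet b σ) :
    ∀ᶠ z in 𝓝[≠] b, M.R (-z) ≠ M.R (-σ z) := by
  have hp : ¬ M.IsPole (-b) := (gen_of_im hb.im_ne).np_neg
  have h1 : AnalyticAt ℂ (fun z => M.U (-z) (-σ z)) b :=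
    analyticAt_U (by fun_prop) hσ.analyticAt.fun_neg hp (by rwa [hσ.map_self])
  have h2 := h1.continuousAt.eventually_ne (y := 0)
    (by simpa [hσ.map_self] using deriv_R_neg_ne hb.im_ne hb.U_eq)
  filter_upwards [nhdsWithin_le_nhds h2, nhdsWithin_le_nhds (hσ.eventually_not_isPole hb),
    hσ.eventually_ne hb] with z e1 e2 e3 e4
  have := R_sub e2.2.1 e2.2.2.2
  rw [e4, sub_self, eq_comm, mul_eq_zero] at this
  exact e3 (by linear_combination this.resolve_right e1)

end IsSheet

/-- The coefficient of the one-form with the same principal part as the integrand of `ω_{1,1}`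
at a ramification point. -/
def F (M : Model d) (σ : ℂ → ℂ) (z : ℂ) : ℂ :=
  ω₀₂ z (σ z) / (M.U (σ z) (σ z) * (M.R (-z) - M.R (-σ z)))

namespace IsSheet

variable {b : ℂ} {σ : ℂ → ℂ}

lemma meromorphicAt_F (hb : M.Ram b) (hσ : M.IsSheet b σ) : MeromorphicAt (M.F σ) b := by
  have hg := gen_of_im (M := M) hb.im_ne
  have h1 := hσ.analyticAt.meromorphicAt
  have h2 : MeromorphicAt (fun z => M.U (σ z) (σ z)) b :=
    (analyticAt_U hσ.analyticAt hσ.analyticAt (by rw [hσ.map_self]; exact hg.np)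
      (by rw [hσ.map_self]; exact hg.np)).meromorphicAt
  have h3 : MeromorphicAt (fun z => M.R (-z)) b := meromorphicAt_R_neg b
  have h4 : MeromorphicAt (fun z => M.R (-σ z)) b := by
    refine AnalyticAt.meromorphicAt (AnalyticAt.fun_comp (g := fun z => M.R (-z)) ?_ hσ.analyticAt)
    rw [hσ.map_self]
    exact analyticAt_R_neg hg.np_neg
  unfold F ω₀₂
  fun_prop

/-- As a one-form, `F` is odd under the involution `σ`. -/
lemma F_odd (hb : M.Ram b) (hσ : M.IsSheet b σ) :
    ∀ᶠ z in 𝓝[≠] b, M.F σ (σ z) * deriv σ z = -M.F σ z := by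
  filter_upwards [nhdsWithin_le_nhds (hσ.eventually_involutive hb),
    nhdsWithin_le_nhds (hσ.eventually_deriv hb), (hσ.tendsto_punctured hb).eventually
    hb.eventually_U_ne, hb.eventually_U_ne, hσ.eventually_R_neg_ne hb] with z h1 h2 h3 h4 h5
  have h6 : deriv σ z ≠ 0 := fun h => h4 (by rw [← h2, h, mul_zero])
  have h7 := sub_ne_zero.mpr h5
  have h8 : M.R (-σ z) - M.R (-z) ≠ 0 := sub_ne_zero.mpr h5.symm
  have h9 : ω₀₂ (σ z) z = ω₀₂ z (σ z) := by
    rw [ω₀₂, ω₀₂, add_comm z, ← neg_sub z, neg_sq]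
  rw [F, F, h1, h9, ← h2, ← neg_sub (M.R (-z)), mul_neg, div_neg, neg_mul, neg_inj]
  field_simp

/-- The residue of a form that is odd under a local change of coordinates vanishes. -/
lemma residue_F (hb : M.Ram b) (hσ : M.IsSheet b σ) : residue (M.F σ) b = 0 := by
  have hm := hσ.meromorphicAt_F hb
  have h1 := residue_comp hσ.analyticAt (by rw [hσ.deriv_eq hb]; norm_num)
    (f := M.F σ) (by rwa [hσ.map_self])
  have h2 : residue (fun z => M.F σ (σ z) * deriv σ z) b = residue (fun z => -1 * M.F σ z) b :=
    residue_congr ((MeromorphicAt.const _ _).fun_mul hm) (by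
      filter_upwards [hσ.F_odd hb] with z hz
      rw [hz, neg_one_mul])
  rw [h2, residue_const_mul hm, hσ.map_self] at h1
  linear_combination -h1 / 2

/-- The Taylor expansion of `(σ(z) - b) / (z - b)`, found by comparing the coefficients of
`R(σ(z)) = R(z)`. -/
lemma hasJet_slope (hb : M.Ram b) (hσ : M.IsSheet b σ) :
    HasJet (fun z => (σ z - b) / (z - b)) b (-1) (-(M.xCoeff 1 b) / 3)
      (-(M.xCoeff 1 b / 3) ^ 2) := by
  have hp : ¬ M.IsPole b := not_isPole_of_im hb.im_ne
  have hA2 : iteratedDeriv 2 M.R b ≠ 0 := by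
    rw [iteratedDeriv_succ, iteratedDeriv_one, deriv_deriv_R hp]
    exact mul_ne_zero (by norm_num) hb.Ξ_ne
  obtain ⟨t₁, t₂, hθ⟩ : ∃ t₁ t₂, HasJet (fun z => (σ z - b) / (z - b)) b (-1) t₁ t₂ := by
    obtain ⟨g, hg, e⟩ := exists_taylor hσ.analyticAt 4
    refine ⟨iteratedDeriv 2 σ b / 2, iteratedDeriv 3 σ b / 6, g, hg, ?_⟩
    filter_upwards [nhdsWithin_le_nhds e, self_mem_nhdsWithin] with z hz hzb
    have : z - b ≠ 0 := sub_ne_zero.mpr hzb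
    rw [hz]
    simp [Finset.sum_range_succ, hσ.map_self, hσ.deriv_eq hb, Nat.factorial]
    field_simp
    ring
  obtain ⟨g, hg, e⟩ := exists_taylor (analyticAt_R hp) 5
  have hgσ : AnalyticAt ℂ (fun z => g (σ z)) b := by
    have : AnalyticAt ℂ g (σ b) := by rwa [hσ.map_self]
    exact this.fun_comp hσ.analyticAt
  have hs := HasJet.sub_self (a := b)
  set A2 := iteratedDeriv 2 M.R b
  set A3 := iteratedDeriv 3 M.R b with hA3
  set A4 := iteratedDeriv 4 M.R b
  have j1 := (((HasJet.const (a := b) (A2 / 2)).mul (hθ.mul hθ)).add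
    ((HasJet.const (a := b) (A3 / 6)).mul (hs.mul (hθ.mul (hθ.mul hθ))))).add
    ((HasJet.const (a := b) (A4 / 24)).mul ((hs.mul hs).mul ((hθ.mul hθ).mul (hθ.mul hθ)))) |>.add
    ((hs.mul (hs.mul hs)).mul ((HasJet.of_analyticAt hgσ).mul
      (hθ.mul ((hθ.mul hθ).mul (hθ.mul hθ)))))
  have j2 := (((HasJet.const (a := b) (A2 / 2))).add
    ((HasJet.const (a := b) (A3 / 6)).mul hs)).add
    ((HasJet.const (a := b) (A4 / 24)).mul (hs.mul hs)) |>.add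
    ((hs.mul (hs.mul hs)).mul (HasJet.of_analyticAt hg))
  have hd0 : iteratedDeriv 1 M.R b = 0 := by rw [iteratedDeriv_one, deriv_R hp, hb.U_eq]
  have j3 := j2.congr (g := fun z => A2 / 2 * (((σ z - b) / (z - b)) * ((σ z - b) / (z - b))) +
    A3 / 6 * ((z - b) * (((σ z - b) / (z - b)) * (((σ z - b) / (z - b)) *
      ((σ z - b) / (z - b))))) + A4 / 24 * ((z - b) * (z - b) * ((((σ z - b) / (z - b)) *
      ((σ z - b) / (z - b))) * (((σ z - b) / (z - b)) * ((σ z - b) / (z - b))))) +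
      ((z - b) * ((z - b) * (z - b))) * (g (σ z) * (((σ z - b) / (z - b)) *
      ((((σ z - b) / (z - b)) * ((σ z - b) / (z - b))) * (((σ z - b) / (z - b)) *
      ((σ z - b) / (z - b))))))) (by
    filter_upwards [nhdsWithin_le_nhds e, nhdsWithin_le_nhds (hσ.eventually_comp e),
      nhdsWithin_le_nhds (hσ.eventually_R hb), self_mem_nhdsWithin] with z h1 h2 h3 h4
    have h5 : z - b ≠ 0 := sub_ne_zero.mpr h4
    rw [h3, h1] at h2
    simp only [Finset.sum_range_succ, Finset.sum_range_zero, hd0, Nat.factorial] at h2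
    push_cast at h2
    field_simp
    linear_combination -288 * h2)
  obtain ⟨-, e1, e2⟩ := j1.unique j3
  have ht1 : t₁ = -(M.xCoeff 1 b) / 3 := by
    have e1' : A3 = -3 * A2 * t₁ := by linear_combination -3 * e1
    have : M.xCoeff 1 b = A3 / A2 := rfl
    rw [this, e1']
    field_simp
  refine hθ.cast rfl ht1 ?_
  have e1' : A3 = -3 * A2 * t₁ := by linear_combination -3 * e1
  have : A2 * (t₂ + t₁ ^ 2) = 0 := by
    rw [e1'] at e2
    linear_combination -e2
  have ht2 := (mul_eq_zero.mp this).resolve_left hA2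
  rw [neg_div] at ht1
  have : M.xCoeff 1 b / 3 = -t₁ := by rw [ht1, neg_neg]
  rw [this]
  linear_combination ht2

end IsSheet

end Model

/-! ### Taylor expansions at a ramification point -/

/-- The principal part of `f` in terms of the Taylor expansion of `(z - a)⁴ f(z)`, which is
known to second order only: the last coefficient is the residue. -/
lemma HasJet.hasPolar {f : ℂ → ℂ} {a j₀ j₁ j₂ : ℂ}
    (h : HasJet (fun z => (z - a) ^ 4 * f z) a j₀ j₁ j₂) :
    HasPolar f a 4 (fun k => if k = 3 then j₀ else if k = 2 then j₁ else if k = 1 then j₂ else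
      residue f a) := by
  obtain ⟨g, hg, e⟩ := h
  have h1 := (HasPolar.of_div_pow_one hg).extend (m := 4) (by norm_num)
  have h2 : HasPolar f a 4 (fun k => if k = 3 then j₀ else if k = 2 then j₁ else
      if k = 1 then j₂ else g a) := by
    refine RegularAt.congr h1 ?_
    filter_upwards [e, self_mem_nhdsWithin] with z hz hza
    have hne : z - a ≠ 0 := sub_ne_zero.mpr hza
    have : f z = (j₀ + j₁ * (z - a) + j₂ * (z - a) ^ 2 + (z - a) ^ 3 * g z) / (z - a) ^ 4 := by
      rw [eq_div_iff (pow_ne_zero 4 hne), ← hz, mul_comm]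
    rw [this]
    simp [polar, Finset.sum_range_succ]
    field_simp
    ring
  have h3 := h2.residue_eq
  simp only [OfNat.zero_ne_ofNat, zero_ne_one, if_false] at h3
  rw [h3]
  exact h2

namespace Model

variable {d : ℕ} {M : Model d}

namespace IsSheet

variable {b : ℂ} {σ : ℂ → ℂ}

/-- The Taylor expansion of `R'(σ(z)) / (z - b)`. -/
lemma hasJet_U (hb : M.Ram b) (hσ : M.IsSheet b σ) {t₁ t₂ : ℂ}
    (hθ : HasJet (fun z => (σ z - b) / (z - b)) b (-1) t₁ t₂) :
    HasJet (fun z => M.U (σ z) (σ z) / (z - b)) b (-iteratedDeriv 2 M.R b)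
      (iteratedDeriv 2 M.R b * t₁ + iteratedDeriv 3 M.R b / 2)
      (iteratedDeriv 2 M.R b * t₂ - iteratedDeriv 3 M.R b * t₁ - iteratedDeriv 4 M.R b / 6) := by
  have hp : ¬ M.IsPole b := not_isPole_of_im hb.im_ne
  obtain ⟨g, hg, e⟩ := exists_taylor (analyticAt_R hp).deriv 4
  have hgσ : AnalyticAt ℂ (fun z => g (σ z)) b := by
    have : AnalyticAt ℂ g (σ b) := by rwa [hσ.map_self]
    exact this.fun_comp hσ.analyticAt
  have hs := HasJet.sub_self (a := b)
  have hd0 : deriv M.R b = 0 := by rw [deriv_R hp, hb.U_eq]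
  have j := (((HasJet.const (a := b) (iteratedDeriv 2 M.R b)).mul hθ).add
    ((HasJet.const (a := b) (iteratedDeriv 3 M.R b / 2)).mul (hs.mul (hθ.mul hθ)))).add
    ((HasJet.const (a := b) (iteratedDeriv 4 M.R b / 6)).mul
      ((hs.mul hs).mul (hθ.mul (hθ.mul hθ)))) |>.add
    ((hs.mul (hs.mul hs)).mul ((HasJet.of_analyticAt hgσ).mul ((hθ.mul hθ).mul (hθ.mul hθ))))
  refine (j.congr ?_).cast (by ring) (by ring) (by ring)
  filter_upwards [nhdsWithin_le_nhds (hσ.eventually_comp e),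
    nhdsWithin_le_nhds (hσ.eventually_not_isPole hb), self_mem_nhdsWithin] with z h1 h2 h3
  have h4 : z - b ≠ 0 := sub_ne_zero.mpr h3
  rw [deriv_R h2.2.2.1] at h1
  simp only [Finset.sum_range_succ, Finset.sum_range_zero, ← iteratedDeriv_succ', Nat.factorial,
    iteratedDeriv_one, zero_add, hd0] at h1
  push_cast at h1
  rw [h1]
  field_simp
  ring

/-- The Taylor expansion of `(R(-z) - R(-σ(z))) / (z - b)`. -/
lemma hasJet_R_neg (hb : M.Ram b) (hσ : M.IsSheet b σ) {t₁ t₂ : ℂ}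
    (hθ : HasJet (fun z => (σ z - b) / (z - b)) b (-1) t₁ t₂) :
    HasJet (fun z => (M.R (-z) - M.R (-σ z)) / (z - b)) b (-2 * deriv M.R (-b))
      (deriv M.R (-b) * t₁)
      (deriv M.R (-b) * t₂ + iteratedDeriv 2 M.R (-b) * t₁ - iteratedDeriv 3 M.R (-b) / 3) := by
  have hp : ¬ M.IsPole (-b) := (gen_of_im hb.im_ne).np_neg
  obtain ⟨g, hg, e⟩ := exists_taylor (analyticAt_R_neg hp) 4
  have hgσ : AnalyticAt ℂ (fun z => g (σ z)) b := by
    have : AnalyticAt ℂ g (σ b) := by rwa [hσ.map_self]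
    exact this.fun_comp hσ.analyticAt
  have hs := HasJet.sub_self (a := b)
  have h1 := HasJet.const (a := b) 1
  have j := (((HasJet.const (a := b) (-deriv M.R (-b))).mul (h1.sub hθ)).add
    ((HasJet.const (a := b) (iteratedDeriv 2 M.R (-b) / 2)).mul (hs.mul (h1.sub (hθ.mul hθ))))).add
    ((HasJet.const (a := b) (-iteratedDeriv 3 M.R (-b) / 6)).mul
      ((hs.mul hs).mul (h1.sub (hθ.mul (hθ.mul hθ))))) |>.add
    ((hs.mul (hs.mul hs)).mul ((HasJet.of_analyticAt hg).sub
      ((HasJet.of_analyticAt hgσ).mul ((hθ.mul hθ).mul (hθ.mul hθ)))))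
  refine (j.congr ?_).cast (by ring) (by ring) (by ring)
  filter_upwards [nhdsWithin_le_nhds e, nhdsWithin_le_nhds (hσ.eventually_comp e),
    self_mem_nhdsWithin] with z h1 h2 h3
  have h4 : z - b ≠ 0 := sub_ne_zero.mpr h3
  simp only [Finset.sum_range_succ, Finset.sum_range_zero, iteratedDeriv_comp_neg, Nat.factorial,
    iteratedDeriv_one, zero_add, smul_eq_mul] at h1 h2
  rw [h1, h2]
  push_cast
  field_simp
  ring

/-- The Taylor expansion of `(z - b)² ω_{0,2}(z,σ(z))`. -/
lemma hasJet_ω₀₂ (hb : M.Ram b) (hσ : M.IsSheet b σ) {t₁ t₂ : ℂ}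
    (hθ : HasJet (fun z => (σ z - b) / (z - b)) b (-1) t₁ t₂) :
    HasJet (fun z => (z - b) ^ 2 * ω₀₂ z (σ z)) b (1 / 4) (t₁ / 4)
      (t₂ / 4 + 3 * t₁ ^ 2 / 16 + 1 / (4 * b ^ 2)) := by
  have hb0 : b ≠ 0 := by
    rintro rfl
    exact hb.im_ne rfl
  have hs := HasJet.sub_self (a := b)
  have h1 := (HasJet.const (a := b) 1).sub hθ
  have h2 := (HasJet.const (a := b) (2 * b)).add (hs.add (hs.mul hθ))
  have j := ((h1.mul h1).inv (by norm_num)).add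
    ((hs.mul hs).mul ((h2.mul h2).inv (by simpa using hb0)))
  refine (j.congr ?_).cast (by norm_num) (by ring) (by field_simp; ring)
  filter_upwards [self_mem_nhdsWithin, hσ.eventually_ne hb] with z h3 h5
  have h4 : z - b ≠ 0 := sub_ne_zero.mpr h3
  have h6 : 1 - (σ z - b) / (z - b) = (z - σ z) / (z - b) := by field_simp; ring
  have h7 : 2 * b + (z - b + (z - b) * ((σ z - b) / (z - b))) = z + σ z := by field_simp; ring
  rw [h6, h7, ω₀₂, mul_add]
  congr 1
  · rw [div_mul_div_comm, inv_div]
    ring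
  · ring

/-- The principal part of `F` in a ramification point. The coefficient of `(z - b)⁻¹` is the
residue, which vanishes, so that three Taylor coefficients suffice. -/
lemma hasPolar_F (hb : M.Ram b) (hσ : M.IsSheet b σ) :
    HasPolar (M.F σ) b 4 (fun k => (deriv M.R (-b) * iteratedDeriv 2 M.R b)⁻¹ *
      if k = 3 then 1 / 8 else if k = 2 then -M.xCoeff 1 b / 24 else if k = 1 then
      -(M.xCoeff 2 b / 48 - M.xCoeff 1 b ^ 2 / 48 - M.xCoeff 1 b * M.yCoeff 1 b / 48 +
        M.yCoeff 2 b / 48 - 1 / (8 * b ^ 2)) else 0) := by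
  have hp : ¬ M.IsPole b := not_isPole_of_im hb.im_ne
  have hp' : ¬ M.IsPole (-b) := (gen_of_im hb.im_ne).np_neg
  have hb0 : b ≠ 0 := by
    rintro rfl
    exact hb.im_ne rfl
  have hA2 : iteratedDeriv 2 M.R b ≠ 0 := by
    rw [iteratedDeriv_succ, iteratedDeriv_one, deriv_deriv_R hp]
    exact mul_ne_zero (by norm_num) hb.Ξ_ne
  have hr1 : deriv M.R (-b) ≠ 0 := by
    rw [deriv_R hp']
    exact deriv_R_neg_ne hb.im_ne hb.U_eq
  have hθ := hσ.hasJet_slope hb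
  have j := (hσ.hasJet_ω₀₂ hb hθ).mul (((hσ.hasJet_U hb hθ).inv (neg_ne_zero.mpr hA2)).mul
    ((hσ.hasJet_R_neg hb hθ).inv (mul_ne_zero (by norm_num) hr1)))
  have j' := j.congr (g := fun z => (z - b) ^ 4 * M.F σ z) (by
    filter_upwards [self_mem_nhdsWithin] with z h3
    have h4 : z - b ≠ 0 := sub_ne_zero.mpr h3
    rw [F, inv_div, inv_div]
    field_simp)
  have hx : iteratedDeriv 3 M.R b = M.xCoeff 1 b * iteratedDeriv 2 M.R b := by
    rw [xCoeff, div_mul_cancel₀ _ hA2]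
  have hx2 : iteratedDeriv 4 M.R b = M.xCoeff 2 b * iteratedDeriv 2 M.R b := by
    rw [xCoeff, div_mul_cancel₀ _ hA2]
  have hy1 : iteratedDeriv 2 M.R (-b) = -M.yCoeff 1 b * deriv M.R (-b) := by
    rw [yCoeff]
    field_simp
  have hy2 : iteratedDeriv 3 M.R (-b) = M.yCoeff 2 b * deriv M.R (-b) := by
    rw [yCoeff]
    field_simp
  refine HasPolar.congr (f := M.F σ) ?_ EventuallyEq.rfl
  convert j'.hasPolar using 1
  funext k
  rw [hσ.residue_F hb, hx, hx2, hy1, hy2]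
  split_ifs
  · field_simp; norm_num
  · field_simp; ring
  · field_simp; ring
  · ring

end IsSheet

end Model

namespace Model

variable {d : ℕ} {M : Model d} {α : Fin d → ℂ}

/-! ### Simplicity of the ramification points -/

/-- The numerator of `R'`, a monic polynomial of degree `2d`. -/
def ramPoly (M : Model d) : Polynomial ℂ :=
  Lagrange.nodal Finset.univ (fun j => -(M.ε j : ℂ)) ^ 2 +
    ∑ k, Polynomial.C (M.c * M.ρ k : ℂ) *
      Lagrange.nodal (Finset.univ.erase k) (fun j => -(M.ε j : ℂ)) ^ 2

lemma degree_ramPoly_aux : (∑ k, Polynomial.C (M.c * M.ρ k : ℂ) *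
      Lagrange.nodal (Finset.univ.erase k) (fun j => -(M.ε j : ℂ)) ^ 2).degree <
    (Lagrange.nodal Finset.univ (fun j => -(M.ε j : ℂ)) ^ 2).degree := by
  rw [Polynomial.degree_pow, Lagrange.degree_nodal]
  refine lt_of_le_of_lt (Polynomial.degree_sum_le _ _) ?_
  have hd : (2 • ((Finset.univ : Finset (Fin d)).card : WithBot ℕ)) =
      ((2 * d : ℕ) : WithBot ℕ) := by
    simp
  rw [hd, Finset.sup_lt_iff (WithBot.bot_lt_coe _)]
  intro k _
  rw [Polynomial.degree_C_mul (M.c_mul_ρ_ne_zero k), Polynomial.degree_pow, Lagrange.degree_nodal,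
    Finset.card_erase_of_mem (Finset.mem_univ k), Finset.card_univ, Fintype.card_fin]
  have hk : 0 < d := k.pos
  have : 2 * (d - 1) < 2 * d := by omega
  rw [nsmul_eq_mul]
  exact_mod_cast this

lemma monic_ramPoly : M.ramPoly.Monic :=
  (Lagrange.nodal_monic.pow 2).add_of_left degree_ramPoly_aux

lemma natDegree_ramPoly : M.ramPoly.natDegree = 2 * d := by
  rw [ramPoly, Polynomial.natDegree_eq_of_degree_eq
    (Polynomial.degree_add_eq_left_of_degree_lt degree_ramPoly_aux), Polynomial.natDegree_pow,
    Lagrange.natDegree_nodal]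
  simp

lemma eval_ramPoly {t : ℂ} (ht : ¬ M.IsPole t) :
    M.ramPoly.eval t = M.U t t * (∏ j, (M.ε j + t)) ^ 2 := by
  have h : ∀ k ∈ Finset.univ, M.c * M.ρ k * (∏ j ∈ Finset.univ.erase k, (M.ε j + t)) ^ 2 =
      M.c * (M.ρ k / ((M.ε k + t) * (M.ε k + t))) * (∏ j, (M.ε j + t)) ^ 2 := by
    intro k hk
    rw [← Finset.mul_prod_erase _ _ hk]
    have := eps_add_ne ht k
    field_simp
  have h2 : M.ramPoly.eval t = (∏ j, (M.ε j + t)) ^ 2 +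
      ∑ k, M.c * M.ρ k * (∏ j ∈ Finset.univ.erase k, (M.ε j + t)) ^ 2 := by
    simp [ramPoly, Polynomial.eval_finsetSum, Lagrange.eval_nodal, sub_neg_eq_add, add_comm t]
  rw [h2, Finset.sum_congr rfl h, ← Finset.sum_mul, ← Finset.mul_sum, U]
  ring

variable {β : Fin (2 * d) → ℂ}

lemma IsRamificationFamily.U_eq (hβ : M.IsRamificationFamily β) (i : Fin (2 * d)) :
    M.U (β i) (β i) = 0 := by
  rw [← deriv_R (hβ.2 i).1, (hβ.2 i).2]

lemma IsRamificationFamily.U_eq_prod (hβ : M.IsRamificationFamily β) {t : ℂ} (ht : ¬ M.IsPole t)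
    (hβt : ∀ i, t ≠ β i) :
    M.U t t = (∏ i, (t - β i)) / (∏ j, (M.ε j + t)) ^ 2 := by
  have h := eval_div_prod_eq Finset.univ β hβ.1.injOn M.ramPoly monic_ramPoly
    (by rw [natDegree_ramPoly]; simp) (y := t) fun j _ => hβt j
  have h0 : ∀ i, M.ramPoly.eval (β i) = 0 := fun i => by
    rw [eval_ramPoly (hβ.2 i).1, hβ.U_eq, zero_mul]
  simp only [h0, zero_div, Finset.sum_const_zero, add_zero] at h
  have hne : ∏ i, (t - β i) ≠ 0 := Finset.prod_ne_zero_iff.mpr fun i _ => sub_ne_zero.mpr (hβt i)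
  rw [div_eq_iff hne, one_mul, eval_ramPoly ht] at h
  rw [eq_div_iff (pow_ne_zero 2 (prod_eps_add_ne_zero ht)), h]

/-- As the numerator of `R'` has degree `2d`, its `2d` distinct zeros are simple. -/
lemma IsRamificationFamily.ram (hβ : M.IsRamificationFamily β) (i : Fin (2 * d)) :
    M.Ram (β i) := by
  have hp := (hβ.2 i).1
  refine ⟨fun h => deriv_R_ne_zero_of_real h (hβ.U_eq i), hβ.U_eq i, fun h0 => ?_⟩
  -- `R'` is `(t - βᵢ) g(t)` with `g(βᵢ) ≠ 0`
  set g : ℂ → ℂ := fun t => (∏ j ∈ Finset.univ.erase i, (t - β j)) / (∏ j, (M.ε j + t)) ^ 2 with hg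
  have hga : ContinuousAt g (β i) :=
    ContinuousAt.div (by fun_prop) (by fun_prop) (pow_ne_zero 2 (prod_eps_add_ne_zero hp))
  have hgne : g (β i) ≠ 0 := by
    refine div_ne_zero (Finset.prod_ne_zero_iff.mpr fun j hj => sub_ne_zero.mpr fun h => ?_)
      (pow_ne_zero 2 (prod_eps_add_ne_zero hp))
    exact Finset.ne_of_mem_erase hj (hβ.1 h).symm
  have h1 := hasDerivAt_iff_tendsto_slope.mp
    (hasDerivAt_U (M := M) (hasDerivAt_id' (β i)) (hasDerivAt_id' (β i)) hp hp)
  rw [h0] at h1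
  have h2 : Tendsto g (𝓝[≠] β i) (𝓝 (-0 * 1 - 0 * 1)) := by
    refine h1.congr' ?_
    have hfin : ∀ j, ∀ᶠ t in 𝓝[≠] β i, t ≠ β j := by
      intro j
      by_cases hj : j = i
      · rw [hj]; exact self_mem_nhdsWithin
      · exact nhdsWithin_le_nhds (isOpen_ne.mem_nhds fun h => hj (hβ.1 h).symm)
    filter_upwards [eventually_all.mpr hfin, nhdsWithin_le_nhds (eventually_not_isPole hp)]
      with t h3 h4
    have h5 : t - β i ≠ 0 := sub_ne_zero.mpr (h3 i)
    rw [slope_def_field, hβ.U_eq, sub_zero, hβ.U_eq_prod h4 h3, hg,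
      ← Finset.mul_prod_erase _ _ (Finset.mem_univ i)]
    field_simp
  exact hgne (by simpa using tendsto_nhds_unique (hga.tendsto.mono_left nhdsWithin_le_nhds) h2)

/-! ### The bracket at generic points -/

lemma eventually_R_neg_ne (p y : ℂ) : ∀ᶠ t in 𝓝[≠] p, M.R (-t) ≠ y := by
  have ht : Tendsto (fun z : ℂ => -z) (𝓝[≠] p) (𝓝[≠] (-p)) := by
    refine tendsto_nhdsWithin_of_tendsto_nhds_of_eventually_within _
      (continuous_neg.continuousAt.mono_left nhdsWithin_le_nhds) ?_
    filter_upwards [self_mem_nhdsWithin] with z hz h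
    exact hz (neg_injective h)
  exact ht.eventually (eventually_R_ne (-p) y)

lemma eventually_generic (α : Fin d → ℂ) {p : ℂ} (h1 : ∀ᶠ q in 𝓝[≠] p, M.U q q ≠ 0)
    (h2 : ∀ᶠ q in 𝓝[≠] p, M.U (-q) (-q) ≠ 0) (h3 : ∀ᶠ q in 𝓝[≠] p, M.R q ≠ M.R (-q)) :
    ∀ᶠ q in 𝓝[≠] p, M.Generic α q := by
  filter_upwards [h1, h2, h3, eventually_gen p,
    eventually_all.mpr fun n => (M.fiber n).eventually_all.mpr fun v _ =>
      eventually_R_ne p (M.R (-v)),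
    eventually_all.mpr fun j => eventually_R_ne p (M.R (α j)),
    eventually_all.mpr fun j => eventually_R_neg_ne p (M.R (α j))] with q e1 e2 e3 e4 e5 e6 e7
  exact ⟨e4, e1, e2, e3, e5, e6, e7⟩

/-- The divided difference of `Φ x x'` in the points `x'` and `y`. -/
def W (M : Model d) (x x' y : ℂ) : ℂ :=
  M.c * ∑ k, M.r k * M.h k x / ((M.e k - x') ^ 2 * (M.e k - y))

lemma Φ_sub_Φ {x x' y : ℂ} (hx' : ∀ k, x' ≠ M.e k) (hy : ∀ k, y ≠ M.e k) :
    M.Φ x x' y - M.Φ x x' x' = (y - x') * M.W x x' y := by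
  have key : ∀ k, M.r k * M.h k x / ((M.e k - x') * (M.e k - y)) -
      M.r k * M.h k x / ((M.e k - x') * (M.e k - x')) =
      (y - x') * (M.r k * M.h k x / ((M.e k - x') ^ 2 * (M.e k - y))) := by
    intro k
    have h1 : (M.e k : ℂ) - x' ≠ 0 := sub_ne_zero.mpr (hx' k).symm
    have h2 : (M.e k : ℂ) - y ≠ 0 := sub_ne_zero.mpr (hy k).symm
    field_simp
    ring
  rw [Φ, Φ, W, add_sub_add_left_eq_sub, ← mul_sub, ← Finset.sum_sub_distrib,
    Finset.sum_congr rfl fun k _ => key k, ← Finset.mul_sum]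
  ring

lemma analyticAt_W {x x' : ℂ} {l : ℂ → ℂ} {a : ℂ} (hx' : ∀ k, x' ≠ M.e k) (hl : AnalyticAt ℂ l a)
    (hla : ∀ k, l a ≠ M.e k) : AnalyticAt ℂ (fun t => M.W x x' (l t)) a := by
  unfold W
  refine analyticAt_const.mul (Finset.analyticAt_fun_sum _ fun k _ => ?_)
  exact analyticAt_const.fun_div (analyticAt_const.mul (analyticAt_const.sub hl))
    (mul_ne_zero (pow_ne_zero 2 (sub_ne_zero.mpr (hx' k).symm)) (sub_ne_zero.mpr (hla k).symm))

/-- The form (coefficient of `dt`) that collects the integrands of all `𝔱_{0,1}(q‖q,εₙ|)`. -/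
def J (M : Model d) (q t : ℂ) : ℂ := M.K q t * M.W (M.R q) (M.R (-q)) (M.R (-t))

/-- The weight of `𝔱_{0,1}(q‖q,εₙ|)` in the residue formula for `ω_{1,1}`. -/
def wt (M : Model d) (n : Fin d) (q : ℂ) : ℂ :=
  M.c * M.r n * M.h n (M.R q) / (M.e n - M.R (-q)) ^ 2

lemma J_eq_sum (q t : ℂ) :
    M.J q t = ∑ n, M.wt n q * (M.K q t / (M.e n - M.R (-t))) := by
  rw [J, W, Finset.mul_sum, Finset.mul_sum]
  refine Finset.sum_congr rfl fun n _ => ?_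
  rw [wt]
  simp only [div_eq_mul_inv, mul_inv]
  ring

lemma meromorphicAt_J (q t : ℂ) : MeromorphicAt (M.J q) t := by
  rw [funext (J_eq_sum q)]
  exact MeromorphicAt.fun_sum fun n _ =>
    (MeromorphicAt.const _ _).fun_mul (meromorphicAt_K_div q t n)

lemma residue_J (q t : ℂ) : residue (M.J q) t =
    ∑ n, M.wt n q * residue (fun t => M.K q t / (M.e n - M.R (-t))) t := by
  rw [funext (J_eq_sum q), residue_sum fun n _ =>
    (MeromorphicAt.const _ _).fun_mul (meromorphicAt_K_div q t n)]
  exact Finset.sum_congr rfl fun n _ => residue_const_mul (meromorphicAt_K_div q t n) _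

/-- The contribution of the poles `t = -v` with `R(v) = eₙ`. -/
def V (M : Model d) (q : ℂ) : ℂ := ∑ n, M.wt n q * ∑ v ∈ M.fiber n, M.K q (-v) / M.U v v

/-- The bracket of the residue formula, in terms of the residues of `J q` at `t = q` and at the
points `t = -v`, and of the functions with two boundaries. -/
theorem bracket_eq {q : ℂ} (hq : M.Generic α q) :
    M.bracket α q = (M.U q q)⁻¹ * (residue (M.J q) q + M.V q) + M.C α q := by
  have h1 : ∀ n, M.r n * M.t₀₁ q q (M.ε n) / (M.U q q * (M.e n - M.R (-q))) * M.c =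
      (M.U q q)⁻¹ * (M.wt n q * (residue (fun t => M.K q t / (M.e n - M.R (-t))) q +
        ∑ v ∈ M.fiber n, M.K q (-v) / M.U v v)) := by
    intro n
    rw [t₀₁_eq hq, wt]
    have := hq.U_ne
    have : (M.e n : ℂ) - M.R (-q) ≠ 0 := sub_ne_zero.mpr (hq.ne_neg n).symm
    field_simp
  rw [bracket, C, residue_J, V, ← Finset.sum_add_distrib, add_sub_assoc, coe_c, deriv_R hq.np]
  simp only [R_ε]
  congr 1
  rw [mul_comm, Finset.sum_mul, Finset.sum_congr rfl fun n _ => h1 n, ← Finset.mul_sum]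
  simp only [mul_add]

/-! ### The residues at `-q` and on the other sheet -/

lemma hasDerivAt_W_R_neg {w x x' : ℂ} (hw : ¬ M.IsPole (-w)) (hw' : ∀ k, M.R (-w) ≠ M.e k)
    (hx' : ∀ k, x' ≠ M.e k) (hne : M.R (-w) ≠ x') :
    HasDerivAt (fun t => M.W x x' (M.R (-t)))
      (-(M.Φ₂ x x' (M.R (-w)) - M.W x x' (M.R (-w))) / (M.R (-w) - x') * M.U (-w) (-w)) w := by
  have h0 : M.R (-w) - x' ≠ 0 := sub_ne_zero.mpr hne
  have hR := hasDerivAt_R_neg (M := M) hw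
  have h1 := (((hasDerivAt_Φ (x := x) hx' hw').comp w hR).sub_const (M.Φ x x' x')).fun_div
    (hR.sub_const x') h0
  have e : (fun t => M.W x x' (M.R (-t))) =ᶠ[𝓝 w]
      fun t => (M.Φ x x' (M.R (-t)) - M.Φ x x' x') / (M.R (-t) - x') := by
    filter_upwards [hR.continuousAt.eventually_ne hne,
      hR.continuousAt.eventually (eventually_ne_e hw')] with t h2 h3
    rw [Φ_sub_Φ hx' h3, mul_div_cancel_left₀ _ (sub_ne_zero.mpr h2)]
  refine (h1.congr_of_eventuallyEq e).congr_deriv ?_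
  simp only [Function.comp_apply]
  rw [Φ_sub_Φ hx' hw']
  field_simp
  ring

/-- At `t = -q`, the form `J q` has the double pole of `(q + t)⁻²`. -/
lemma residue_J_neg {q : ℂ} (hq : M.Gen q) (hD : M.R q ≠ M.R (-q)) :
    residue (M.J q) (-q) = M.W (M.R q) (M.R (-q)) (M.R q) * M.U (-q) (-q) /
        (M.R q - M.R (-q)) ^ 2 -
      (M.Φ₂ (M.R q) (M.R (-q)) (M.R q) - M.W (M.R q) (M.R (-q)) (M.R q)) * M.U q q /
        (M.R q - M.R (-q)) ^ 2 := by
  have h0 : M.R q - M.R (-q) ≠ 0 := sub_ne_zero.mpr hD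
  have hq0 : q - -q ≠ 0 := fun h => hD (congrArg M.R (by linear_combination h))
  have hg : AnalyticAt ℂ (fun t => M.W (M.R q) (M.R (-q)) (M.R (-t)) / (M.R q - M.R t)) (-q) :=
    (analyticAt_W hq.ne_neg (analyticAt_R_neg (by simpa using hq.np))
      (by simpa using hq.ne)).fun_div
      (analyticAt_const.sub (analyticAt_R hq.np_neg)) h0
  have hd : HasDerivAt (fun t => M.W (M.R q) (M.R (-q)) (M.R (-t)) / (M.R q - M.R t)) _ (-q) :=
    (hasDerivAt_W_R_neg (x := M.R q) (w := -q) (by simpa using hq.np) (by simpa using hq.ne)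
    hq.ne_neg (by simpa using hD)).fun_div ((hasDerivAt_R hq.np_neg).const_sub (M.R q)) h0
  have hg2 : AnalyticAt ℂ (fun t => 1 / (q - t) ^ 2 *
      (M.W (M.R q) (M.R (-q)) (M.R (-t)) / (M.R q - M.R t))) (-q) := by
    refine AnalyticAt.fun_mul (AnalyticAt.fun_div (by fun_prop) (by fun_prop)
      (pow_ne_zero 2 hq0)) hg
  have e : M.J q = fun t => (1 / (q - t) ^ 2 *
      (M.W (M.R q) (M.R (-q)) (M.R (-t)) / (M.R q - M.R t))) +
      (M.W (M.R q) (M.R (-q)) (M.R (-t)) / (M.R q - M.R t)) / (t - -q) ^ 2 := by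
    funext t
    rw [J, K, ω₀₂, sub_neg_eq_add, add_comm t]
    ring
  rw [e, residue_add hg2.meromorphicAt (hg.meromorphicAt.fun_div (by fun_prop)),
    (QuarticKontsevich.AnalyticAt.regularAt hg2).residue_eq, residue_div_sub_sq hg, hd.deriv]
  rw [neg_neg]
  field_simp
  ring

/-- At the other sheet `s` over `R(q)`, the residue of `J q` is `-𝔊₀(q) R'(q)` times `F(q)`,
where `s = σ(q)` in the application. -/
lemma residue_J_sheet {q s : ℂ} (hq : M.Gen q) (hs : M.Gen s) (hR : M.R s = M.R q) (hne : s ≠ q)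
    (hne' : q + s ≠ 0) (hU : M.U s s ≠ 0) (hRn : M.R (-q) ≠ M.R (-s)) :
    residue (M.J q) s = -(M.P₁ (M.R (-q)) (M.R q) *
      (ω₀₂ q s / (M.U s s * (M.R (-q) - M.R (-s))))) := by
  have h1 := (sub_ne_zero.mpr hne.symm)
  have hUa : AnalyticAt ℂ (fun t => M.U s t) s :=
    analyticAt_U analyticAt_const analyticAt_id hs.np hs.np
  have hω : AnalyticAt ℂ (fun t => ω₀₂ q t) s := by
    unfold ω₀₂
    refine AnalyticAt.fun_add (AnalyticAt.fun_div (by fun_prop) (by fun_prop) (pow_ne_zero 2 h1))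
      (AnalyticAt.fun_div (by fun_prop) (by fun_prop) (pow_ne_zero 2 hne'))
  have hg := ((hω.fun_mul (analyticAt_W (x := M.R q) hq.ne_neg (analyticAt_R_neg hs.np_neg)
    hs.ne_neg)).fun_div hUa hU).fun_neg
  have h2 := residue_div_sub hg
  have h3 : residue (M.J q) s = residue (fun t => -(ω₀₂ q t * M.W (M.R q) (M.R (-q)) (M.R (-t)) /
      M.U s t) / (t - s)) s := by
    refine residue_congr (hg.meromorphicAt.fun_div (by fun_prop)) ?_
    filter_upwards [nhdsWithin_le_nhds (eventually_not_isPole hs.np), self_mem_nhdsWithin]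
      with t ht hts
    rw [J, K, ← hR, R_sub hs.np ht, ← neg_sub t s, neg_mul, div_neg]
    simp only [div_eq_mul_inv, mul_inv]
    ring
  -- `P(R(s), R(-s)) = 0` and `R(s) = R(q)`, so `Φ` vanishes in `R(-s)`
  have h4 : M.P₁ (M.R (-q)) (M.R q) =
      (M.R (-q) - M.R (-s)) * M.W (M.R q) (M.R (-q)) (M.R (-s)) := by
    have h5 := Φ_sub_Φ (x := M.R q) hq.ne_neg hs.ne_neg
    have h6 := P_eq_mul_Φ hq hs.ne_neg
    rw [P_symm, ← hR, P_R_R_neg hs, eq_comm, mul_eq_zero, hR,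
      or_iff_right (sub_ne_zero.mpr hRn.symm)] at h6
    rw [h6, Φ_self hq.ne] at h5
    linear_combination -h5
  rw [h3, h2, h4]
  have := sub_ne_zero.mpr hRn
  field_simp

end Model

/-! ### Residues depending on a parameter -/

/-- Circle integrals depend continuously on parameters. -/
lemma tendsto_circleIntegral {f : ℂ → ℂ → ℂ} {p : ℂ} {r : ℝ} (hr : 0 ≤ r)
    (h : ∀ t ∈ Metric.sphere p r, AnalyticAt ℂ (fun z : ℂ × ℂ => f z.1 z.2) (p, t)) :
    (∀ᶠ q in 𝓝 p, ∀ t ∈ Metric.sphere p r, AnalyticAt ℂ (f q) t) ∧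
      Tendsto (fun q => ∮ t in C(p, r), f q t) (𝓝 p) (𝓝 (∮ t in C(p, r), f p t)) := by
  have hK : IsCompact (Metric.sphere p r) := isCompact_sphere p r
  have h1 : ∀ᶠ q in 𝓝 p, ∀ t ∈ Metric.sphere p r, AnalyticAt ℂ (f q) t := by
    refine hK.eventually_forall_of_forall_eventually fun t ht => ?_
    filter_upwards [(h t ht).eventually_analyticAt] with z hz
    exact AnalyticAt.fun_comp (g := fun z : ℂ × ℂ => f z.1 z.2) (f := fun t => (z.1, t)) hz
      (analyticAt_const.prod analyticAt_id)
  refine ⟨h1, TendstoUniformlyOn.tendsto_circleIntegral_of_continuousOn hr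
    (h1.mono fun q hq t ht => (hq t ht).continuousAt.continuousWithinAt) ?_⟩
  rw [Metric.tendstoUniformlyOn_iff]
  intro ε hε
  refine hK.eventually_forall_of_forall_eventually fun t ht => ?_
  have hc := (h t ht).continuousAt
  have hc2 : ContinuousAt (fun z : ℂ × ℂ => f p z.2) (p, t) :=
    ContinuousAt.comp (g := fun z : ℂ × ℂ => f z.1 z.2) (f := fun z : ℂ × ℂ => (p, z.2)) hc
      (by fun_prop)
  exact (hc2.dist hc).eventually_lt_const (by simpa using hε)

/-- The sum of the residues in two merging poles is continuous, as it is the integral over a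
fixed circle around both. -/
lemma tendsto_add_residue {f : ℂ → ℂ → ℂ} {p : ℂ} {s : ℂ → ℂ}
    (hs : ContinuousAt s p) (hsp : s p = p) (hne : ∀ᶠ q in 𝓝[≠] p, s q ≠ q)
    (hm : ∀ q t, MeromorphicAt (f q) t)
    (hf : ∀ᶠ z : ℂ × ℂ in 𝓝 (p, p), z.2 ≠ z.1 → z.2 ≠ s z.1 →
      AnalyticAt ℂ (fun z : ℂ × ℂ => f z.1 z.2) z) :
    Tendsto (fun q => residue (f q) q + residue (f q) (s q)) (𝓝[≠] p) (𝓝 (residue (f p) p)) := by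
  rw [nhds_prod_eq, Filter.eventually_prod_iff] at hf
  obtain ⟨pa, ha, pb, hb, hab⟩ := hf
  obtain ⟨r, hr, hball⟩ := Metric.nhds_basis_closedBall.eventually_iff.mp hb
  have hz : ∀ q, pa q → ∀ t ∈ Metric.closedBall p r, t ≠ q → t ≠ s q →
      AnalyticAt ℂ (fun z : ℂ × ℂ => f z.1 z.2) (q, t) := fun q hq t ht h1 h2 =>
    hab hq (hball ht) h1 h2
  have hz' : ∀ q, pa q → ∀ t ∈ Metric.closedBall p r, t ≠ q → t ≠ s q → AnalyticAt ℂ (f q) t :=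
    fun q hq t ht h1 h2 =>
      AnalyticAt.fun_comp (g := fun z : ℂ × ℂ => f z.1 z.2) (f := fun t => (q, t))
        (hz q hq t ht h1 h2) (analyticAt_const.prod analyticAt_id)
  have hsph : ∀ t ∈ Metric.sphere p r, t ≠ p := fun t ht h => by
    rw [h, mem_sphere_iff_norm, sub_self, norm_zero] at ht
    exact hr.ne ht
  obtain ⟨h1, h2⟩ := tendsto_circleIntegral (f := f) hr.le (fun t ht =>
    hz p ha.self_of_nhds t (Metric.sphere_subset_closedBall ht) (hsph t ht)
      (by rw [hsp]; exact hsph t ht))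
  have e0 := circleIntegral_eq_sum_residue (f := f p) hr {p}
    (by simpa using hr) (fun t _ => hm p t)
    (fun t ht h => QuarticKontsevich.AnalyticAt.regularAt (hz' p ha.self_of_nhds t ht
      (by simpa using h) (by rw [hsp]; simpa using h)))
    h1.self_of_nhds
  rw [Finset.sum_singleton] at e0
  rw [← e0]
  refine ((h2.mono_left nhdsWithin_le_nhds).const_mul _).congr' ?_
  have hqb : ∀ᶠ q in 𝓝 p, q ∈ Metric.ball p r := Metric.ball_mem_nhds p hr
  have hsb : ∀ᶠ q in 𝓝 p, s q ∈ Metric.ball p r :=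
    hs.eventually (by rw [hsp]; exact hqb)
  filter_upwards [hne, nhdsWithin_le_nhds h1, nhdsWithin_le_nhds hqb, nhdsWithin_le_nhds hsb,
    nhdsWithin_le_nhds ha] with q e1 e2 e3 e4 e5
  rw [circleIntegral_eq_sum_residue (f := f q) hr {q, s q} (by
    intro t ht
    rcases Finset.mem_insert.mp ht with rfl | ht
    · exact e3
    · rw [Finset.mem_singleton.mp ht]; exact e4) (fun t _ => hm q t) (fun t ht h =>
      QuarticKontsevich.AnalyticAt.regularAt (hz' q e5 t ht
      (fun h' => h (by simp [h'])) (fun h' => h (by simp [h'])))) e2,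
    Finset.sum_pair e1.symm]

/-- The residue of a function with a pole of order at most three. -/
lemma HasJet.residue_eq {f : ℂ → ℂ} {a c₀ c₁ c₂ : ℂ}
    (h : HasJet (fun z => (z - a) ^ 3 * f z) a c₀ c₁ c₂) : residue f a = c₂ := by
  obtain ⟨g, hg, e⟩ := h
  have h2 : HasPolar f a 3 (fun k => if k = 2 then c₀ else if k = 1 then c₁ else c₂) := by
    refine RegularAt.congr (QuarticKontsevich.AnalyticAt.regularAt hg) ?_
    filter_upwards [e, self_mem_nhdsWithin] with z hz hza
    have hne : z - a ≠ 0 := sub_ne_zero.mpr hza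
    have : f z = (c₀ + c₁ * (z - a) + c₂ * (z - a) ^ 2 + (z - a) ^ 3 * g z) / (z - a) ^ 3 := by
      rw [eq_div_iff (pow_ne_zero 3 hne), ← hz, mul_comm]
    rw [this]
    simp [polar, Finset.sum_range_succ]
    field_simp
    ring
  simpa using h2.residue_eq

namespace Model

variable {d : ℕ} {M : Model d} {α : Fin d → ℂ}

lemma analyticAt_J {q t : ℂ} (hq : M.Gen q) (ht : M.Gen t) (hR : M.R q ≠ M.R t) (hn : q ≠ -t) :
    AnalyticAt ℂ (fun z : ℂ × ℂ => M.J z.1 z.2) (q, t) := by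
  have hR1 : AnalyticAt ℂ (fun z : ℂ × ℂ => M.R z.1) (q, t) :=
    AnalyticAt.fun_comp (g := M.R) (analyticAt_R hq.np) analyticAt_fst
  have hR2 : AnalyticAt ℂ (fun z : ℂ × ℂ => M.R z.2) (q, t) :=
    AnalyticAt.fun_comp (g := M.R) (analyticAt_R ht.np) analyticAt_snd
  have hR3 : AnalyticAt ℂ (fun z : ℂ × ℂ => M.R (-z.1)) (q, t) :=
    AnalyticAt.fun_comp (g := fun z => M.R (-z)) (analyticAt_R_neg hq.np_neg) analyticAt_fst
  have hR4 : AnalyticAt ℂ (fun z : ℂ × ℂ => M.R (-z.2)) (q, t) :=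
    AnalyticAt.fun_comp (g := fun z => M.R (-z)) (analyticAt_R_neg ht.np_neg) analyticAt_snd
  have h1 : q - t ≠ 0 := sub_ne_zero.mpr fun h => hR (by rw [h])
  have h2 : q + t ≠ 0 := fun h => hn (by linear_combination h)
  unfold J K ω₀₂ W
  refine AnalyticAt.fun_mul (AnalyticAt.fun_div (AnalyticAt.fun_add
    (AnalyticAt.fun_div analyticAt_const ((analyticAt_fst.fun_sub analyticAt_snd).fun_pow 2)
      (pow_ne_zero 2 h1)) (AnalyticAt.fun_div analyticAt_const
      ((analyticAt_fst.fun_add analyticAt_snd).fun_pow 2) (pow_ne_zero 2 h2)))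
    (hR1.fun_sub hR2) (sub_ne_zero.mpr hR)) ?_
  refine analyticAt_const.fun_mul (Finset.analyticAt_fun_sum _ fun k _ => ?_)
  have hh : AnalyticAt ℂ (fun z : ℂ × ℂ => M.h k (M.R z.1)) (q, t) :=
    AnalyticAt.fun_comp (g := M.h k) (analyticAt_h hq.ne) hR1
  exact (analyticAt_const.fun_mul hh).fun_div
    (((analyticAt_const.fun_sub hR3).fun_pow 2).fun_mul (analyticAt_const.fun_sub hR4))
    (mul_ne_zero (pow_ne_zero 2 (sub_ne_zero.mpr (hq.ne_neg k).symm))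
      (sub_ne_zero.mpr (ht.ne_neg k).symm))

/-- The residue at `t = q` of the `n`-th summand of `J`. -/
lemma residue_K_div {q : ℂ} (hq : M.Gen q) (hq0 : q ≠ 0) (hU : M.U q q ≠ 0) (n : Fin d) {φ : ℂ → ℂ}
    (hφ : φ = fun t => 1 / (M.e n - M.R (-t))) :
    residue (fun t => M.K q t / (M.e n - M.R (-t))) q =
      -(φ q * ((iteratedDeriv 2 M.R q / 2) ^ 2 / deriv M.R q ^ 3 -
          iteratedDeriv 3 M.R q / 6 / deriv M.R q ^ 2) +
        deriv φ q * (-(iteratedDeriv 2 M.R q / 2) / deriv M.R q ^ 2) +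
        iteratedDeriv 2 φ q / 2 * (deriv M.R q)⁻¹) - φ q / (4 * q ^ 2 * deriv M.R q) := by
  have hφa : AnalyticAt ℂ φ q := by
    rw [hφ]
    exact analyticAt_const.fun_div (analyticAt_const.fun_sub (analyticAt_R_neg hq.np_neg))
      (sub_ne_zero.mpr (hq.ne_neg n).symm)
  have hR0 : deriv M.R q ≠ 0 := by rwa [deriv_R hq.np]
  obtain ⟨g, hg, e⟩ := exists_taylor (analyticAt_R hq.np) 4
  -- the Taylor expansion of `(R(t) - R(q)) / (t - q)`
  have hs : HasJet (fun t => (M.R t - M.R q) / (t - q)) q (deriv M.R q)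
      (iteratedDeriv 2 M.R q / 2) (iteratedDeriv 3 M.R q / 6) := by
    refine ⟨g, hg, ?_⟩
    filter_upwards [nhdsWithin_le_nhds e, self_mem_nhdsWithin] with t h1 h2
    have : t - q ≠ 0 := sub_ne_zero.mpr h2
    rw [h1]
    simp [Finset.sum_range_succ, Nat.factorial]
    field_simp
    ring
  have hma : AnalyticAt ℂ (fun t => 1 / (q + t) ^ 2) q :=
    AnalyticAt.fun_div (by fun_prop) (by fun_prop)
      (pow_ne_zero 2 (by rw [← two_mul]; exact mul_ne_zero two_ne_zero hq0))
  have hm := HasJet.of_analyticAt hma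
  have hk := (HasJet.of_analyticAt hφa).mul (hs.inv hR0)
  have hself := HasJet.sub_self (a := q)
  have j := (hk.add ((hself.mul hself).mul (hm.mul hk))).neg
  have j' := (j.congr (g := fun t => (t - q) ^ 3 * (M.K q t / (M.e n - M.R (-t)))) (by
    filter_upwards [self_mem_nhdsWithin] with t h2
    have : t - q ≠ 0 := sub_ne_zero.mpr h2
    have h3 : M.K q t / (M.e n - M.R (-t)) = -(ω₀₂ q t * φ t / (M.R t - M.R q)) := by
      rw [hφ, K, ← neg_sub (M.R t), div_neg]
      simp only [div_eq_mul_inv]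
      ring
    rw [h3, ω₀₂, inv_div, ← neg_sub t q, neg_sq]
    field_simp)).residue_eq
  rw [j']
  field_simp
  ring

/-- The part of the bracket that comes from `𝔱_{0,1}` is meromorphic, because the residue of
`J q` at `t = q` is a rational expression in derivatives of analytic functions. -/
lemma meromorphicAt_residue_J_add_V {p : ℂ} (hp : M.Gen p)
    (hU : ∀ᶠ q in 𝓝[≠] p, M.U q q ≠ 0) :
    MeromorphicAt (fun q => residue (M.J q) q + M.V q) p := by
  have h0 : ∀ᶠ q in 𝓝[≠] p, q ≠ 0 := by
    by_cases h : p = 0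
    · rw [h]; exact self_mem_nhdsWithin
    · exact nhdsWithin_le_nhds (isOpen_ne.mem_nhds h)
  have hwt : ∀ n, MeromorphicAt (fun q => M.wt n q) p := by
    intro n
    have h1 : MeromorphicAt (fun q => M.h n (M.R q)) p :=
      ((analyticAt_h hp.ne).fun_comp (analyticAt_R hp.np)).meromorphicAt
    have := meromorphicAt_R_neg (M := M) p
    unfold wt
    fun_prop
  have hV : MeromorphicAt (fun q => M.V q) p := by
    unfold V K ω₀₂
    have := meromorphicAt_R (M := M) p
    refine MeromorphicAt.fun_sum fun n _ => (hwt n).fun_mul (MeromorphicAt.fun_sum fun v _ => ?_)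
    fun_prop
  refine MeromorphicAt.fun_add ?_ hV
  have hφ : ∀ n : Fin d, AnalyticAt ℂ (fun t => 1 / (M.e n - M.R (-t))) p := fun n =>
    analyticAt_const.fun_div (analyticAt_const.fun_sub (analyticAt_R_neg hp.np_neg))
      (sub_ne_zero.mpr (hp.ne_neg n).symm)
  have hR := analyticAt_R (M := M) hp.np
  have hm : MeromorphicAt (fun q => ∑ n, M.wt n q *
      (-((fun t => 1 / (M.e n - M.R (-t))) q * ((iteratedDeriv 2 M.R q / 2) ^ 2 / deriv M.R q ^ 3 -
          iteratedDeriv 3 M.R q / 6 / deriv M.R q ^ 2) +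
        deriv (fun t => 1 / (M.e n - M.R (-t))) q *
          (-(iteratedDeriv 2 M.R q / 2) / deriv M.R q ^ 2) +
        iteratedDeriv 2 (fun t => 1 / (M.e n - M.R (-t))) q / 2 * (deriv M.R q)⁻¹) -
        (fun t => 1 / (M.e n - M.R (-t))) q / (4 * q ^ 2 * deriv M.R q))) p := by
    refine MeromorphicAt.fun_sum fun n _ => (hwt n).fun_mul ?_
    have a0 := (hφ n).meromorphicAt
    have a1 : MeromorphicAt (fun q => deriv (fun t => 1 / (M.e n - M.R (-t))) q) p :=
      (hφ n).deriv.meromorphicAt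
    have a2 : MeromorphicAt (iteratedDeriv 2 (fun t => 1 / (M.e n - M.R (-t)))) p := by
      rw [iteratedDeriv_eq_iterate]
      exact ((hφ n).iterated_deriv 2).meromorphicAt
    have b1 : MeromorphicAt (fun q => deriv M.R q) p := hR.deriv.meromorphicAt
    have b2 : MeromorphicAt (iteratedDeriv 2 M.R) p := by
      rw [iteratedDeriv_eq_iterate]
      exact (hR.iterated_deriv 2).meromorphicAt
    have b3 : MeromorphicAt (iteratedDeriv 3 M.R) p := by
      rw [iteratedDeriv_eq_iterate]
      exact (hR.iterated_deriv 3).meromorphicAt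
    fun_prop
  refine hm.congr ?_
  filter_upwards [hU, eventually_gen p, h0] with q h1 h2 h3
  rw [residue_J]
  exact Finset.sum_congr rfl fun n _ => by rw [residue_K_div h2 h3 h1 n rfl]

end Model

namespace Model

variable {d : ℕ} {M : Model d} {α : Fin d → ℂ} {b : ℂ}

/-! ### The residue theorem at a ramification point -/

lemma Ram.gen (hb : M.Ram b) : M.Gen b := gen_of_im hb.im_ne

lemma Ram.U_neg_ne (hb : M.Ram b) : M.U (-b) (-b) ≠ 0 := deriv_R_neg_ne hb.im_ne hb.U_eq

lemma Ram.R_ne (hb : M.Ram b) : M.R b ≠ M.R (-b) := R_ne_R_neg hb.im_ne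

lemma Ram.P₁_eq_zero (hb : M.Ram b) : M.P₁ (M.R (-b)) (M.R b) = 0 := by
  have h := P₁_mul_U hb.gen
  rw [hb.U_eq, mul_zero, eq_comm, mul_eq_zero, or_iff_left hb.U_neg_ne] at h
  exact h

lemma Ram.R_ne_of_im (hb : M.Ram b) {t : ℂ} (ht : t.im = 0) : M.R b ≠ M.R t := fun h =>
  hb.im_ne (im_R_eq_zero.mp (by rw [h]; exact im_R_eq_zero.mpr ht))

lemma Ram.ne_of_im (hb : M.Ram b) {t : ℂ} (ht : t.im = 0) : b ≠ t := fun h =>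
  hb.im_ne (by rw [h, ht])

lemma analyticAt_K_div {q t : ℂ} {n : Fin d} (h1 : ¬ M.IsPole t) (h2 : ¬ M.IsPole (-t))
    (hR : M.R q ≠ M.R t) (hq : q ≠ -t) (hn : M.R (-t) ≠ M.e n) :
    AnalyticAt ℂ (fun t => M.K q t / (M.e n - M.R (-t))) t :=
  (analyticAt_K h1 hR hq).fun_div (analyticAt_const.fun_sub (analyticAt_R_neg h2))
    (sub_ne_zero.mpr hn.symm)

lemma Ram.analyticAt_ω₀₂ (hb : M.Ram b) {t : ℂ} (ht : t.im = 0) :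
    AnalyticAt ℂ (fun t => ω₀₂ b t) t := by
  have h1 : b - t ≠ 0 := sub_ne_zero.mpr (hb.ne_of_im ht)
  have h2 : b + t ≠ 0 := fun h => hb.ne_of_im (t := -t) (by simpa using ht)
    (by linear_combination h)
  unfold ω₀₂
  exact AnalyticAt.fun_add (AnalyticAt.fun_div (by fun_prop) (by fun_prop) (pow_ne_zero 2 h1))
    (AnalyticAt.fun_div (by fun_prop) (by fun_prop) (pow_ne_zero 2 h2))

/-- In the poles `-εₖ` of `R` the zero of `K` compensates the possible pole of
`1 / (eₙ - R(-t))`. -/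
lemma Ram.regularAt_pole (hb : M.Ram b) (n k : Fin d) :
    RegularAt (fun t => M.K b t / (M.e n - M.R (-t))) (-(M.ε k : ℂ)) := by
  have hω := (hb.analyticAt_ω₀₂ (t := -(M.ε k : ℂ)) (by simp)).continuousAt.tendsto.mono_left
    (nhdsWithin_le_nhds (s := {-(M.ε k : ℂ)}ᶜ))
  have hnp : ¬ M.IsPole (- -(M.ε k : ℂ)) := by rw [neg_neg]; exact not_isPole_ε k
  have key : ∃ l, Tendsto (fun t => (M.R b - M.R t)⁻¹ * (M.e n - M.R (-t))⁻¹)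
      (𝓝[≠] (-(M.ε k : ℂ))) (𝓝 l) := by
    by_cases hkn : k = n
    · subst hkn
      have h1 : Tendsto (fun t => (M.ε k + t) * M.R b - (M.ε k + t) * M.R t)
          (𝓝[≠] (-(M.ε k : ℂ))) (𝓝 (0 * M.R b - -(M.c * M.ρ k))) := by
        refine Tendsto.sub (Tendsto.mul_const _ ?_) (tendsto_sub_mul_R k)
        have : ContinuousAt (fun t : ℂ => (M.ε k : ℂ) + t) (-(M.ε k : ℂ)) := by fun_prop
        have h := this.tendsto.mono_left (nhdsWithin_le_nhds (s := {-(M.ε k : ℂ)}ᶜ))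
        simpa using h
      have h2 : Tendsto (fun t => M.U (M.ε k) (-t)) (𝓝[≠] (-(M.ε k : ℂ)))
          (𝓝 (M.U (M.ε k) (- -(M.ε k : ℂ)))) :=
        (analyticAt_U (M := M) (f := fun _ => (M.ε k : ℂ)) (g := fun t => -t) analyticAt_const
          (by fun_prop) (not_isPole_ε k) hnp).continuousAt.tendsto.mono_left nhdsWithin_le_nhds
      rw [neg_neg] at h2
      have h3 := (h1.mul h2).inv₀ (mul_ne_zero
        (by simpa using M.c_mul_ρ_ne_zero k) (U_ε_ne_zero k k))
      refine ⟨_, h3.congr' ?_⟩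
      filter_upwards [nhdsWithin_le_nhds (eventually_not_isPole_neg hnp)] with t ht
      rw [← R_ε, R_sub (not_isPole_ε k) ht, ← mul_inv]
      congr 1
      ring
    · have h1 := (tendsto_inv_const_sub_cocompact (M.R b)).comp (tendsto_R_pole (M := M) k)
      have h2 := ((analyticAt_R_neg hnp).continuousAt.tendsto.mono_left
        (nhdsWithin_le_nhds (s := {-(M.ε k : ℂ)}ᶜ))).const_sub (M.e n : ℂ)
      rw [neg_neg, R_ε] at h2
      exact ⟨_, h1.mul (h2.inv₀ (sub_ne_zero.mpr fun h => hkn (M.e_inj.mp h).symm))⟩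
  obtain ⟨l, hl⟩ := key
  refine regularAt_of_tendsto (meromorphicAt_K_div _ _ _) ((hω.mul hl).congr fun t => ?_)
  rw [K]
  simp only [div_eq_mul_inv, mul_assoc]

lemma Ram.regularAt_K_div (hb : M.Ram b) {t : ℂ} (hR : M.R b ≠ M.R t) (ht : b ≠ -t) (n : Fin d)
    (hn : -t ∉ M.fiber n) : RegularAt (fun t => M.K b t / (M.e n - M.R (-t))) t := by
  by_cases h1 : M.IsPole t
  · obtain ⟨k, rfl⟩ := h1
    exact hb.regularAt_pole n k
  by_cases h2 : M.IsPole (-t)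
  · obtain ⟨k, hk⟩ := h2
    have ht' : t = M.ε k := neg_injective hk
    subst ht'
    have h3 : Tendsto (fun t : ℂ => -t) (𝓝[≠] (M.ε k : ℂ)) (𝓝[≠] (-(M.ε k : ℂ))) := by
      refine tendsto_nhdsWithin_of_tendsto_nhds_of_eventually_within _
        (continuous_neg.continuousAt.mono_left nhdsWithin_le_nhds) ?_
      filter_upwards [self_mem_nhdsWithin] with z hz h
      exact hz (neg_injective h)
    have h4 := (tendsto_inv_const_sub_cocompact (M.e n)).comp ((tendsto_R_pole (M := M) k).comp h3)
    have h5 := (analyticAt_K h1 hR ht).continuousAt.tendsto.mono_left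
      (nhdsWithin_le_nhds (s := {(M.ε k : ℂ)}ᶜ))
    exact regularAt_of_tendsto (meromorphicAt_K_div _ _ _) (h5.mul h4)
  · refine QuarticKontsevich.AnalyticAt.regularAt (analyticAt_K_div h1 h2 hR ht fun h => ?_)
    refine hn (mem_fiber.mpr ⟨h2, h, fun h' => h1 ⟨n, by rw [← h', neg_neg]⟩⟩)

/-- The preimages of `R(b)` other than `b` are regular points of `J b`, because the residue of
`J q` on such a sheet is proportional to `𝔊₀(q) R'(q)`, which vanishes in `q = b`. -/
lemma Ram.regularAt_J_fiber (hb : M.Ram b) {t : ℂ} (hR : M.R t = M.R b) (ht : t ≠ b) :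
    RegularAt (M.J b) t := by
  have him : 0 < b.im * t.im := by
    rcases lt_or_gt_of_ne hb.im_ne with h | h
    · have := im_R_neg (M := M).mpr h
      rw [← hR, im_R_neg] at this
      exact mul_pos_of_neg_of_neg h this
    · have := im_R_pos (M := M).mpr h
      rw [← hR, im_R_pos] at this
      exact mul_pos h this
  have hg : M.Gen t := gen_of_im fun h => by rw [h, mul_zero] at him; exact lt_irrefl _ him
  have hU : M.U b t = 0 := by
    have := R_sub hb.gen.np hg.np
    rw [hR, sub_self, eq_comm, mul_eq_zero] at this
    exact this.resolve_left (sub_ne_zero.mpr ht.symm)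
  have hbt : b + t ≠ 0 := fun h => hb.R_ne (by rw [← hR]; congr 1; linear_combination h)
  have hne : M.R (-t) ≠ M.R (-b) := by
    intro h
    have := R_sub hb.gen.np_neg hg.np_neg
    rw [h, sub_self, eq_comm, mul_eq_zero, or_iff_left ((U_ne_zero_or him).resolve_left
      (not_not.mpr hU))] at this
    exact ht (by linear_combination this)
  have hRn := analyticAt_R_neg hg.np_neg
  have hω : AnalyticAt ℂ (fun t => ω₀₂ b t) t := by
    unfold ω₀₂
    exact AnalyticAt.fun_add (AnalyticAt.fun_div (by fun_prop) (by fun_prop)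
      (pow_ne_zero 2 (sub_ne_zero.mpr ht.symm)))
      (AnalyticAt.fun_div (by fun_prop) (by fun_prop) (pow_ne_zero 2 hbt))
  have ha : AnalyticAt ℂ (fun t => ω₀₂ b t * M.Φ (M.R (-t)) (M.R t) (M.R b) /
      (M.R (-t) - M.R (-b)) ^ 2) t :=
    (hω.fun_mul (analyticAt_Φ hRn (analyticAt_R hg.np) analyticAt_const hg.ne_neg hg.ne
      hb.gen.ne)).fun_div ((hRn.fun_sub analyticAt_const).fun_pow 2)
      (pow_ne_zero 2 (sub_ne_zero.mpr hne))
  refine ⟨_, ha, ?_⟩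
  filter_upwards [eventually_gen t, eventually_R_ne (M := M) t (M.R b),
    nhdsWithin_le_nhds (hRn.continuousAt.eventually_ne hne)] with s h1 h2 h3
  have e1 := sub_ne_zero.mpr h2.symm
  have e2 := sub_ne_zero.mpr h3
  have e3 := Φ_sub_Φ (x := M.R b) hb.gen.ne_neg h1.ne_neg
  rw [Φ_self hb.gen.ne, hb.P₁_eq_zero, sub_zero] at e3
  have e4 := P_eq_mul_Φ hb.gen h1.ne_neg
  have e5 := P_eq_mul_Φ h1.neg hb.gen.ne
  rw [neg_neg, P_symm, e4, e3] at e5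
  rw [J, K, div_mul_eq_mul_div, div_eq_div_iff e1 (pow_ne_zero 2 e2)]
  linear_combination ω₀₂ b s * e5

lemma tendsto_mul_K_div (q : ℂ) (n : Fin d) :
    Tendsto (fun t => t * (M.K q t / (M.e n - M.R (-t)))) (cocompact ℂ) (𝓝 0) := by
  have h1 := tendsto_inv_const_sub_cocompact q
  have h2 := (tendsto_inv_const_sub_cocompact (M.R q)).comp M.tendsto_R_cocompact
  have h3 := (tendsto_inv_const_sub_cocompact (M.e n : ℂ)).comp M.tendsto_R_neg_cocompact
  have h4 : Tendsto (fun t : ℂ => (q + t)⁻¹) (cocompact ℂ) (𝓝 0) := by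
    refine (tendsto_inv_sub_cocompact (-q)).congr fun t => ?_
    rw [sub_neg_eq_add, add_comm]
  have h5 : Tendsto (fun t => t * (q - t)⁻¹) (cocompact ℂ) (𝓝 (-1)) := by
    have h6 := (h1.const_mul q).sub (tendsto_const_nhds (x := (1 : ℂ)))
    rw [mul_zero, zero_sub] at h6
    refine h6.congr' ?_
    filter_upwards [(isCompact_singleton (x := q)).compl_mem_cocompact] with r hr
    have : q - r ≠ 0 := sub_ne_zero.mpr fun h => hr h.symm
    field_simp
    ring
  have h6 : Tendsto (fun t => t * (q + t)⁻¹) (cocompact ℂ) (𝓝 1) := by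
    have h6 := (tendsto_const_nhds (x := (1 : ℂ))).sub (h4.const_mul q)
    rw [mul_zero, sub_zero] at h6
    refine h6.congr' ?_
    filter_upwards [(isCompact_singleton (x := -q)).compl_mem_cocompact] with r hr
    have : q + r ≠ 0 := fun h => hr (by rw [Set.mem_singleton_iff]; linear_combination h)
    field_simp
    ring
  have h7 := (((h5.mul h1).add (h6.mul h4)).mul h2).mul h3
  simp only [mul_zero, add_zero] at h7
  refine h7.congr fun t => ?_
  simp only [K, ω₀₂, Function.comp_apply, div_eq_mul_inv, one_mul, ← inv_pow]
  ring

/-- The residue theorem on the sphere for `J b`: the only poles are `b`, `-b` and the points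
`-v` with `R(v) = eₙ`, `v ≠ εₙ`. -/
theorem Ram.sum_residue (hb : M.Ram b) :
    residue (M.J b) b + residue (M.J b) (-b) + M.V b = 0 := by
  set B := Finset.univ.biUnion M.fiber with hB
  have hBim : ∀ v ∈ B, v.im = 0 := by
    intro v hv
    obtain ⟨n, -, hv⟩ := Finset.mem_biUnion.mp hv
    exact fiber_im hv
  have hbneg : b ≠ -b := fun h => hb.R_ne (by rw [← h])
  have hnot : ∀ s : ℂ, s.im ≠ 0 → s ∉ B.image fun v => -v := by
    intro s hs h
    obtain ⟨v, hv, rfl⟩ := Finset.mem_image.mp h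
    exact hs (by simpa using hBim v hv)
  have hnb : (-b).im ≠ 0 := by simpa using hb.im_ne
  set S : Finset ℂ := insert b (insert (-b) (B.image fun v => -v)) with hS
  have hnS : ∀ t, t ∉ S → t ≠ b ∧ b ≠ -t ∧ ∀ n, -t ∉ M.fiber n := by
    intro t ht
    simp only [hS, Finset.mem_insert, Finset.mem_image, not_or, not_exists, not_and] at ht
    refine ⟨ht.1, fun h => ht.2.1 (by rw [h, neg_neg]), fun n hn => ht.2.2 (-t) ?_ (neg_neg t)⟩
    exact Finset.mem_biUnion.mpr ⟨n, Finset.mem_univ _, hn⟩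
  have hreg : ∀ t ∉ S, RegularAt (M.J b) t := by
    intro t ht
    obtain ⟨h1, h2, h3⟩ := hnS t ht
    by_cases hR : M.R b = M.R t
    · exact hb.regularAt_J_fiber hR.symm h1
    · rw [funext (J_eq_sum b)]
      exact RegularAt.sum fun n _ => (RegularAt.const _).mul (hb.regularAt_K_div hR h2 n (h3 n))
  set T : Finset ℂ := S ∪ M.badSet ∪ (M.finite_R_eq (M.R b)).toFinset with hT
  have hanalytic : ∀ t ∉ T, AnalyticAt ℂ (M.J b) t := by
    intro t ht
    simp only [hT, Finset.mem_union, not_or, Set.Finite.mem_toFinset, Set.mem_ofPred_eq] at ht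
    obtain ⟨⟨h1, h2⟩, h3⟩ := ht
    obtain ⟨h4, h5, h6⟩ := hnS t h1
    have hg := not_mem_badSet.mp h2
    rw [funext (J_eq_sum b)]
    exact Finset.analyticAt_fun_sum _ fun n _ => analyticAt_const.fun_mul
      (analyticAt_K_div hg.np hg.np_neg (fun h => h3 h.symm) h5 (hg.ne_neg n))
  have hinf : Tendsto (fun t => t * M.J b t) (cocompact ℂ) (𝓝 0) := by
    have h := tendsto_finsetSum Finset.univ fun n _ =>
      (tendsto_mul_K_div (M := M) b n).const_mul (M.wt n b)
    simp only [mul_zero, Finset.sum_const_zero] at h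
    refine h.congr fun t => ?_
    rw [J_eq_sum, Finset.mul_sum]
    exact Finset.sum_congr rfl fun n _ => by ring
  have hsum := sum_residue_eq_zero S (fun s _ => meromorphicAt_J b s) T hreg hanalytic hinf
  have hV : ∑ s ∈ B.image (fun v => -v), residue (M.J b) s = M.V b := by
    rw [Finset.sum_image fun v _ w _ h => neg_injective h]
    simp only [residue_J]
    rw [Finset.sum_comm, V]
    refine Finset.sum_congr rfl fun n _ => ?_
    rw [← Finset.mul_sum]
    congr 1
    rw [← Finset.sum_subset (Finset.subset_biUnion_of_mem M.fiber (Finset.mem_univ n))]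
    · exact Finset.sum_congr rfl fun v hv => residue_K_div_fiber hv
        (hb.R_ne_of_im (by simpa using fiber_im hv)) (hb.ne_of_im (fiber_im hv))
    · intro v hv hvn
      exact (hb.regularAt_K_div (hb.R_ne_of_im (by simpa using hBim v hv))
        (hb.ne_of_im (by simpa using hBim v hv)) n (by rwa [neg_neg])).residue_eq
  rw [hS, Finset.sum_insert, Finset.sum_insert (hnot _ hnb), hV, ← add_assoc] at hsum
  · exact hsum
  · rw [Finset.mem_insert, not_or]
    exact ⟨hbneg, hnot b hb.im_ne⟩

end Model

namespace Model

variable {d : ℕ} {M : Model d} {α : Fin d → ℂ} {b : ℂ}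

/-! ### The integrand of the residue formula -/

lemma continuousAt_V {p : ℂ} (hp : M.Gen p) (hR : ∀ n, ∀ v ∈ M.fiber n, M.R p ≠ M.R (-v)) :
    ContinuousAt M.V p := by
  have hRc := (analyticAt_R hp.np).continuousAt
  have hRn := (analyticAt_R_neg hp.np_neg).continuousAt
  obtain ⟨-, -, h1, h2⟩ := gen_iff.mp hp
  unfold V wt K ω₀₂
  refine tendsto_finsetSum _ fun n _ => ContinuousAt.mul ?_ (tendsto_finsetSum _ fun v hv => ?_)
  · have hh : ContinuousAt (fun q => M.h n (M.R q)) p :=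
      ContinuousAt.comp (g := M.h n) (continuousAt_h hp.ne) hRc
    exact ContinuousAt.div (by fun_prop) (by fun_prop)
      (pow_ne_zero 2 (sub_ne_zero.mpr (hp.ne_neg n).symm))
  · have e1 : (p - -v) ^ 2 ≠ 0 := pow_ne_zero 2 fun h =>
      h2 n (by rwa [show -p = v by linear_combination -h])
    have e2 : (p + -v) ^ 2 ≠ 0 := pow_ne_zero 2 fun h =>
      h1 n (by rwa [show p = v by linear_combination h])
    have e3 : M.R p - M.R (-v) ≠ 0 := sub_ne_zero.mpr (hR n v hv)
    exact ContinuousAt.div (ContinuousAt.div (ContinuousAt.add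
      (ContinuousAt.div (by fun_prop) (by fun_prop) e1)
      (ContinuousAt.div (by fun_prop) (by fun_prop) e2)) (by fun_prop) e3) (by fun_prop)
      (fiber_deriv_ne_zero hv)

lemma Gen.eventually_G₀ {p : ℂ} (hp : M.Gen p) (hU : M.U (-p) (-p) ≠ 0) :
    M.G₀ =ᶠ[𝓝 p] fun q => M.P₁ (M.R q) (M.R (-q)) / M.U (-q) (-q) := by
  have h1 : AnalyticAt ℂ (fun q => M.U (-q) (-q)) p :=
    analyticAt_U (by fun_prop) (by fun_prop) hp.np_neg hp.np_neg
  filter_upwards [hp.eventually, h1.continuousAt.eventually_ne hU] with q h2 h3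
  exact G₀_eq h2 h3

lemma Gen.analyticAt_G₀ {p : ℂ} (hp : M.Gen p) (hU : M.U (-p) (-p) ≠ 0) :
    AnalyticAt ℂ M.G₀ p := by
  refine AnalyticAt.congr ?_ (hp.eventually_G₀ hU).symm
  exact (analyticAt_P₁ (analyticAt_R hp.np) (analyticAt_R_neg hp.np_neg) hp.ne hp.ne_neg).fun_div
    (analyticAt_U (by fun_prop) (by fun_prop) hp.np_neg hp.np_neg) hU

lemma analyticAt_S_R {p : ℂ} (hp : M.Gen p) : AnalyticAt ℂ (fun q => M.S α (M.R q)) p :=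
  (analyticAt_S hp.ne).fun_comp (analyticAt_R hp.np)

lemma analyticAt_S_R_neg {p : ℂ} (hp : M.Gen p) : AnalyticAt ℂ (fun q => M.S α (M.R (-q))) p :=
  AnalyticAt.fun_comp (g := M.S α) (f := fun q => M.R (-q)) (analyticAt_S hp.ne_neg)
    (analyticAt_R_neg hp.np_neg)

lemma meromorphicAt_bracket (hα : M.IsFixedPointFamily α) {p : ℂ} (hp : M.Gen p)
    (hg : ∀ᶠ q in 𝓝[≠] p, M.Generic α q) : MeromorphicAt (M.bracket α) p := by
  have hR := analyticAt_R hp.np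
  have hRn := analyticAt_R_neg hp.np_neg
  have m1 := hR.meromorphicAt
  have m2 := hRn.meromorphicAt
  have m3 : MeromorphicAt (fun q => M.U q q) p :=
    (analyticAt_U analyticAt_id analyticAt_id hp.np hp.np).meromorphicAt
  have m4 : MeromorphicAt (fun q => M.U (-q) (-q)) p :=
    (analyticAt_U (by fun_prop) (by fun_prop) hp.np_neg hp.np_neg).meromorphicAt
  have m5 : MeromorphicAt (fun q => M.P (M.R q) (M.R q)) p :=
    (analyticAt_P hR hR hp.ne hp.ne).meromorphicAt
  have m6 : MeromorphicAt (fun q => M.P₁ (M.R q) (M.R q)) p :=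
    (analyticAt_P₁ hR hR hp.ne hp.ne).meromorphicAt
  have m7 : MeromorphicAt (fun q => M.P₁ (M.R (-q)) (M.R q)) p :=
    (analyticAt_P₁ hRn hR hp.ne_neg hp.ne).meromorphicAt
  have m8 := (analyticAt_S_R (α := α) hp).meromorphicAt
  have m9 := (analyticAt_S_R_neg (α := α) hp).meromorphicAt
  have mA := meromorphicAt_residue_J_add_V hp (hg.mono fun q hq => hq.U_ne)
  have hC : MeromorphicAt (M.C α) p := by
    refine MeromorphicAt.congr (f := fun q => M.P (M.R q) (M.R q) * (2 * M.U q q + M.U (-q) (-q)) /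
        (M.U q q * (M.R q - M.R (-q)) ^ 4) - M.P₁ (M.R q) (M.R q) / (M.R q - M.R (-q)) ^ 3 -
      M.P₁ (M.R (-q)) (M.R q) / (M.R q - M.R (-q)) ^ 3 +
      M.S α (M.R q) * M.S α (M.R (-q)) * (M.R q + M.R (-q) - 2 * M.R 0) /
        (M.R q - M.R (-q)) ^ 4) (by fun_prop) ?_
    filter_upwards [hg] with q hq
    rw [C_eq hα hq]
  refine ((m3.fun_inv.fun_mul mA).fun_add hC).congr ?_
  filter_upwards [hg] with q hq
  rw [bracket_eq hq]

/-! ### The principal part at a ramification point -/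

lemma Ram.eventually_generic (hb : M.Ram b) (α : Fin d → ℂ) : ∀ᶠ q in 𝓝[≠] b, M.Generic α q := by
  have hg := hb.gen
  refine Model.eventually_generic α hb.eventually_U_ne ?_ ?_
  · exact nhdsWithin_le_nhds ((analyticAt_U (M := M) (f := fun q => -q) (g := fun q => -q)
      (by fun_prop) (by fun_prop) hg.np_neg hg.np_neg).continuousAt.eventually_ne hb.U_neg_ne)
  · filter_upwards [nhdsWithin_le_nhds (((analyticAt_R hg.np).continuousAt.sub
      (analyticAt_R_neg hg.np_neg).continuousAt).eventually_ne (sub_ne_zero.mpr hb.R_ne))] with q hq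
    exact sub_ne_zero.mp hq

/-- Near a ramification point, the poles `q` and `σ(q)` of `J q` merge. -/
lemma IsSheet.tendsto_residue (hb : M.Ram b) {σ : ℂ → ℂ} (hσ : M.IsSheet b σ) :
    Tendsto (fun q => residue (M.J q) q + residue (M.J q) (σ q)) (𝓝[≠] b)
      (𝓝 (residue (M.J b) b)) := by
  refine tendsto_add_residue hσ.analyticAt.continuousAt hσ.map_self (hσ.eventually_ne hb)
    meromorphicAt_J ?_
  have hσc : ContinuousAt (fun z : ℂ × ℂ => σ z.1) (b, b) :=
    ContinuousAt.comp (g := σ) (f := fun z : ℂ × ℂ => z.1) hσ.analyticAt.continuousAt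
      continuousAt_fst
  have hp := hb.gen.np
  have hΞ : ContinuousAt (fun z : ℂ × ℂ => M.Ξ z.1 z.2 (σ z.1)) (b, b) := by
    unfold Ξ
    refine ContinuousAt.mul (by fun_prop) (tendsto_finsetSum _ fun k _ => ?_)
    refine ContinuousAt.div (by fun_prop) (ContinuousAt.mul (by fun_prop)
      (continuousAt_const.add hσc)) (mul_ne_zero (mul_ne_zero (eps_add_ne hp k)
      (eps_add_ne hp k)) ?_)
    simp only [hσ.map_self]
    exact eps_add_ne hp k
  have hne : ∀ᶠ z : ℂ × ℂ in 𝓝 (b, b), z.1 + z.2 ≠ 0 := by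
    refine ContinuousAt.eventually_ne (by fun_prop) fun h => hb.R_ne ?_
    congr 1
    linear_combination h
  filter_upwards [hΞ.eventually_ne (y := 0) (by simpa [hσ.map_self] using hb.Ξ_ne), hne,
    continuousAt_fst.eventually hb.gen.eventually, continuousAt_snd.eventually hb.gen.eventually,
    continuousAt_fst.eventually hσ.eventually_U,
    continuousAt_fst.eventually (hσ.eventually_not_isPole hb)] with z h1 h2 h3 h4 h5 h6 h7 h8
  refine analyticAt_J h3 h4 (fun h => ?_) fun h => h2 (by rw [h]; ring)
  have e1 := R_sub h3.np h4.np
  rw [h, sub_self, eq_comm, mul_eq_zero, or_iff_right (sub_ne_zero.mpr h7.symm)] at e1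
  have e2 := U_sub h3.np h4.np h6.2.2.1
  rw [e1, h5, sub_self, eq_comm, mul_eq_zero, or_iff_left h1] at e2
  exact h8 (by linear_combination -e2)

/-- At a ramification point, the integrand of the residue formula has the principal part of `F`:
the limit of `R'(q)` times the difference is, up to the factor `1 / 𝔊₀(b)`, the sum of all residues
of `J b`, hence zero. -/
theorem IsSheet.regularAt_bracket (hα : M.IsFixedPointFamily α) (hb : M.Ram b) (hG : M.G₀ b ≠ 0)
    {σ : ℂ → ℂ} (hσ : M.IsSheet b σ) :
    RegularAt (fun q => M.bracket α q / M.G₀ q - M.F σ q) b := by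
  have hgen := hb.eventually_generic α
  have hg := hb.gen
  have hG₀ := hg.analyticAt_G₀ hb.U_neg_ne
  have hUa : AnalyticAt ℂ (fun q => M.U q q) b :=
    analyticAt_U analyticAt_id analyticAt_id hg.np hg.np
  refine regularAt_of_mul_tendsto_zero (u := fun q => M.U q q)
    (((meromorphicAt_bracket hα hg hgen).fun_div hG₀.meromorphicAt).fun_sub (hσ.meromorphicAt_F hb))
    hUa hb.U_eq ?_ ?_
  · rw [(hasDerivAt_U (M := M) (hasDerivAt_id' b) (hasDerivAt_id' b) hg.np hg.np).deriv]
    intro h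
    exact hb.Ξ_ne (by linear_combination -h / 2)
  have hV : Tendsto M.V (𝓝[≠] b) (𝓝 (M.V b)) :=
    (continuousAt_V hg fun n v hv => hb.R_ne_of_im (by simpa using fiber_im hv)).tendsto.mono_left
      nhdsWithin_le_nhds
  -- the limit of `R'(q) C(q)`
  have hC : Tendsto (fun q => M.P (M.R q) (M.R q) * (2 * M.U q q + M.U (-q) (-q)) /
      (M.R q - M.R (-q)) ^ 4 + M.U q q * (-M.P₁ (M.R q) (M.R q) / (M.R q - M.R (-q)) ^ 3 -
      M.P₁ (M.R (-q)) (M.R q) / (M.R q - M.R (-q)) ^ 3 +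
      M.S α (M.R q) * M.S α (M.R (-q)) * (M.R q + M.R (-q) - 2 * M.R 0) /
        (M.R q - M.R (-q)) ^ 4)) (𝓝[≠] b)
      (𝓝 (M.P (M.R b) (M.R b) * M.U (-b) (-b) / (M.R b - M.R (-b)) ^ 4)) := by
    have hR := analyticAt_R hg.np
    have hRn := analyticAt_R_neg hg.np_neg
    have c1 := hR.continuousAt
    have c2 := hRn.continuousAt
    have c3 := hUa.continuousAt
    have c4 : ContinuousAt (fun q => M.U (-q) (-q)) b :=
      (analyticAt_U (by fun_prop) (by fun_prop) hg.np_neg hg.np_neg).continuousAt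
    have c5 : ContinuousAt (fun q => M.P (M.R q) (M.R q)) b :=
      (analyticAt_P hR hR hg.ne hg.ne).continuousAt
    have c6 : ContinuousAt (fun q => M.P₁ (M.R q) (M.R q)) b :=
      (analyticAt_P₁ hR hR hg.ne hg.ne).continuousAt
    have c7 : ContinuousAt (fun q => M.P₁ (M.R (-q)) (M.R q)) b :=
      (analyticAt_P₁ hRn hR hg.ne_neg hg.ne).continuousAt
    have c8 := (analyticAt_S_R (α := α) hg).continuousAt
    have c9 := (analyticAt_S_R_neg (α := α) hg).continuousAt
    have hD := sub_ne_zero.mpr hb.R_ne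
    have hD3 := pow_ne_zero 3 hD
    have hD4 := pow_ne_zero 4 hD
    have hc : ContinuousAt (fun q => M.P (M.R q) (M.R q) * (2 * M.U q q + M.U (-q) (-q)) /
      (M.R q - M.R (-q)) ^ 4 + M.U q q * (-M.P₁ (M.R q) (M.R q) / (M.R q - M.R (-q)) ^ 3 -
      M.P₁ (M.R (-q)) (M.R q) / (M.R q - M.R (-q)) ^ 3 +
      M.S α (M.R q) * M.S α (M.R (-q)) * (M.R q + M.R (-q) - 2 * M.R 0) /
        (M.R q - M.R (-q)) ^ 4)) b := by
      fun_prop (disch := assumption)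
    have h := hc.tendsto.mono_left (nhdsWithin_le_nhds (s := {b}ᶜ))
    simpa [hb.U_eq] using h
  have hres : residue (M.J b) (-b) =
      M.P (M.R b) (M.R b) * M.U (-b) (-b) / (M.R b - M.R (-b)) ^ 4 := by
    have h1 := Φ_sub_Φ (x := M.R b) hg.ne_neg hg.ne
    rw [Φ_self hg.ne, hb.P₁_eq_zero, sub_zero] at h1
    rw [residue_J_neg hg hb.R_ne, hb.U_eq, mul_zero, zero_div, sub_zero, P_eq_mul_Φ hg hg.ne, h1]
    have := sub_ne_zero.mpr hb.R_ne
    field_simp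
  have hlim := (((hσ.tendsto_residue hb).add hV).add hC).mul
    ((hG₀.continuousAt.tendsto.mono_left nhdsWithin_le_nhds).inv₀ hG)
  rw [← hres, add_right_comm, hb.sum_residue, zero_mul] at hlim
  refine hlim.congr' ?_
  filter_upwards [hgen, (hσ.tendsto_punctured hb).eventually hgen, hσ.eventually_ne hb,
    nhdsWithin_le_nhds (hσ.eventually_R hb), hσ.eventually_R_neg_ne hb,
    nhdsWithin_le_nhds (hG₀.continuousAt.eventually_ne hG)] with q h1 h2 h3 h4 h5 h6
  have hne : q + σ q ≠ 0 := fun h => h1.D_ne (by rw [← h4]; congr 1; linear_combination h)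
  rw [residue_J_sheet h1.toGen h2.toGen h4 h3 hne h2.U_ne h5, bracket_eq h1, C_eq hα h1,
    ← G₀_mul_U h1.toGen h1.U_neg_ne, F]
  have e1 := h1.U_ne
  have e2 := h2.U_ne
  have e3 := sub_ne_zero.mpr h1.D_ne
  have e4 := sub_ne_zero.mpr h5
  field_simp
  ring

/-! ### The principal part at the origin -/

lemma U_zero_ne : M.U 0 0 ≠ 0 := deriv_R_ne_zero_of_real rfl

lemma continuousAt_U_prod {p : ℂ × ℂ} (h1 : ¬ M.IsPole p.1) (h2 : ¬ M.IsPole p.2) :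
    ContinuousAt (fun z : ℂ × ℂ => M.U z.1 z.2) p := by
  unfold U
  refine ContinuousAt.add (by fun_prop) (ContinuousAt.mul (by fun_prop)
    (tendsto_finsetSum _ fun k _ => ?_))
  exact ContinuousAt.div (by fun_prop) (by fun_prop)
    (mul_ne_zero (eps_add_ne h1 k) (eps_add_ne h2 k))

lemma analyticAt_U_self_neg : AnalyticAt ℂ (fun q => M.U q (-q)) 0 :=
  analyticAt_U analyticAt_id (by fun_prop) gen_zero.np (by simpa using gen_zero.np)

lemma analyticAt_U_neg_neg : AnalyticAt ℂ (fun q => M.U (-q) (-q)) 0 :=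
  analyticAt_U (by fun_prop) (by fun_prop) (by simpa using gen_zero.np) (by simpa using gen_zero.np)

lemma eventually_generic_zero (α : Fin d → ℂ) : ∀ᶠ q in 𝓝[≠] (0 : ℂ), M.Generic α q := by
  have hg := gen_zero (M := M)
  refine Model.eventually_generic α ?_ ?_ ?_
  · exact nhdsWithin_le_nhds ((analyticAt_U (M := M) (f := fun q => q) (g := fun q => q)
      analyticAt_id analyticAt_id hg.np hg.np).continuousAt.eventually_ne U_zero_ne)
  · exact nhdsWithin_le_nhds (analyticAt_U_neg_neg.continuousAt.eventually_ne
      (by simpa using U_zero_ne))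
  · filter_upwards [nhdsWithin_le_nhds (analyticAt_U_self_neg (M := M).continuousAt.eventually_ne
      (y := 0) (by simpa using U_zero_ne)), self_mem_nhdsWithin, nhdsWithin_le_nhds hg.eventually]
      with q h1 h2 h3 h4
    have := R_sub h3.np h3.np_neg
    rw [h4, sub_self, eq_comm, mul_eq_zero, or_iff_left h1] at this
    exact h2 (by rw [Set.mem_singleton_iff]; linear_combination this / 2)

/-- Near the origin, the poles `q` and `-q` of `J q` merge. -/
lemma tendsto_residue_zero :
    Tendsto (fun q => residue (M.J q) q + residue (M.J q) (-q)) (𝓝[≠] 0)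
      (𝓝 (residue (M.J 0) 0)) := by
  refine tendsto_add_residue continuous_neg.continuousAt neg_zero ?_ meromorphicAt_J ?_
  · filter_upwards [self_mem_nhdsWithin] with q hq h
    exact hq (by rw [Set.mem_singleton_iff]; linear_combination -h / 2)
  have hg := gen_zero (M := M)
  filter_upwards [(continuousAt_U_prod (M := M) (p := (0, 0)) hg.np hg.np).eventually_ne U_zero_ne,
    continuousAt_fst.eventually hg.eventually, continuousAt_snd.eventually hg.eventually]
    with z h1 h2 h3 h4 h5
  refine analyticAt_J h2 h3 (fun h => ?_) fun h => h5 (by rw [h, neg_neg])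
  have e1 := R_sub h2.np h3.np
  rw [h, sub_self, eq_comm, mul_eq_zero, or_iff_left h1] at e1
  exact h4 (by linear_combination -e1)

/-- The diagonal value of `∂P` at `R(0)`, read off from `P(y,y) = 2 (y - R(0)) S(y)²`. -/
lemma G₀_zero_mul (hα : M.IsFixedPointFamily α) : M.G₀ 0 * M.U 0 0 = M.S α (M.R 0) ^ 2 := by
  have hg := gen_zero (M := M)
  have h1 := G₀_mul_U hg (by simpa using U_zero_ne)
  rw [neg_zero, P₁_diag hα hg.ne (analyticAt_S hg.ne).differentiableAt.hasDerivAt] at h1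
  rw [h1]
  ring

lemma G₀_zero_ne (hα : M.IsFixedPointFamily α) : M.G₀ 0 ≠ 0 := by
  intro h
  have h1 := G₀_zero_mul hα
  rw [h, zero_mul] at h1
  exact pow_ne_zero 2 (S_ne_zero (gen_zero (M := M)).ne fun j h' =>
    hα.R_ne_R_zero j h'.symm) h1.symm

/-- A function with the principal part of the integrand of `ω_{1,1}` at the origin. -/
def E (M : Model d) (α : Fin d → ℂ) (q : ℂ) : ℂ :=
  M.U (-q) (-q) / (M.R q - M.R (-q)) ^ 3 +
    M.S α (M.R q) * M.S α (M.R (-q)) * (M.R q + M.R (-q) - 2 * M.R 0) /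
      ((M.R q - M.R (-q)) ^ 4 * M.G₀ q)

lemma analyticAt_G₀_zero : AnalyticAt ℂ M.G₀ 0 :=
  (gen_zero (M := M)).analyticAt_G₀ (by simpa using U_zero_ne)

lemma meromorphicAt_E_left : MeromorphicAt (fun q => M.U (-q) (-q) / (M.R q - M.R (-q)) ^ 3) 0 := by
  have m1 := (analyticAt_U_neg_neg (M := M)).meromorphicAt
  have m2 := meromorphicAt_R (M := M) 0
  have m3 := meromorphicAt_R_neg (M := M) 0
  fun_prop

lemma meromorphicAt_E_right : MeromorphicAt (fun q => M.S α (M.R q) * M.S α (M.R (-q)) *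
    (M.R q + M.R (-q) - 2 * M.R 0) / ((M.R q - M.R (-q)) ^ 4 * M.G₀ q)) 0 := by
  have m2 := meromorphicAt_R (M := M) 0
  have m3 := meromorphicAt_R_neg (M := M) 0
  have m4 := (analyticAt_S_R (α := α) (gen_zero (M := M))).meromorphicAt
  have m5 := (analyticAt_S_R_neg (α := α) (gen_zero (M := M))).meromorphicAt
  have m6 := (analyticAt_G₀_zero (M := M)).meromorphicAt
  fun_prop

/-- At the origin, the integrand of the residue formula has the principal part of `E`. -/
theorem regularAt_bracket_zero (hα : M.IsFixedPointFamily α) :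
    RegularAt (fun q => M.bracket α q / M.G₀ q - M.E α q) 0 := by
  have hgen := eventually_generic_zero (M := M) α
  have hg := gen_zero (M := M)
  have hUa : AnalyticAt ℂ (fun q => M.U q q) 0 :=
    analyticAt_U analyticAt_id analyticAt_id hg.np hg.np
  have hG₀ := analyticAt_G₀_zero (M := M)
  have hV : Tendsto M.V (𝓝[≠] 0) (𝓝 (M.V 0)) :=
    (continuousAt_V hg fun n v hv => (fiber_R_neg_ne_R_zero hv).symm).tendsto.mono_left
      nhdsWithin_le_nhds
  have hlim := ((tendsto_residue_zero (M := M)).add hV).mul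
    (((hUa.fun_mul hG₀).continuousAt.tendsto.mono_left nhdsWithin_le_nhds).inv₀
      (mul_ne_zero U_zero_ne (G₀_zero_ne hα)))
  refine regularAt_of_tendsto (((meromorphicAt_bracket hα hg hgen).fun_div
    hG₀.meromorphicAt).fun_sub (meromorphicAt_E_left.fun_add meromorphicAt_E_right))
    (hlim.congr' ?_)
  filter_upwards [hgen, nhdsWithin_le_nhds (hG₀.continuousAt.eventually_ne (G₀_zero_ne hα))]
    with q h1 h2
  have e1 := h1.U_ne
  have e3 := sub_ne_zero.mpr h1.D_ne
  have f1 := Φ_sub_Φ (x := M.R q) h1.ne_neg h1.ne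
  rw [Φ_self h1.ne, ← G₀_mul_U h1.toGen h1.U_neg_ne, sub_eq_iff_eq_add] at f1
  have f2 := Φ_add_mul_Φ₂ h1.toGen h1.ne
  rw [f1] at f2
  rw [bracket_eq h1, C_eq hα h1, residue_J_neg h1.toGen h1.D_ne, E,
    ← G₀_mul_U h1.toGen h1.U_neg_ne, P_eq_mul_Φ h1.toGen h1.ne, f1, ← f2]
  field_simp
  ring

end Model

/-! ### Residues against the Cauchy kernel -/

lemma residue_inv_pow (a : ℂ) (k : ℕ) : residue (fun q => 1 / (q - a) ^ (k + 2)) a = 0 := by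
  have h : HasPolar (fun q => 1 / (q - a) ^ (k + 2)) a (k + 2)
      (fun j => if j = k + 1 then 1 else 0) := by
    refine RegularAt.congr (RegularAt.const 0) (Eventually.of_forall fun q => ?_)
    simp [polar, ite_div]
  simpa using h.residue_eq

lemma residue_cauchy_pow {a z : ℂ} (hz : z ≠ a) (k : ℕ) :
    residue (fun q => 1 / (q - z) * (1 / (q - a) ^ (k + 1))) a = -(1 / (z - a) ^ (k + 1)) := by
  have hza : z - a ≠ 0 := sub_ne_zero.mpr hz
  have hm : ∀ k : ℕ, MeromorphicAt (fun q => 1 / (q - z) * (1 / (q - a) ^ (k + 1))) a := by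
    intro k
    fun_prop
  induction k with
  | zero =>
    have hg : AnalyticAt ℂ (fun q => 1 / (q - z)) a :=
      AnalyticAt.fun_div (by fun_prop) (by fun_prop) (sub_ne_zero.mpr hz.symm)
    have h := residue_div_sub hg
    rw [zero_add, pow_one, ← neg_sub a z, one_div_neg_eq_neg_one_div, neg_neg, ← h]
    congr 1
    funext q
    ring
  | succ k ih =>
    have hm2 : MeromorphicAt (fun q => -1 * (1 / (q - a) ^ (k + 2))) a := by fun_prop
    have e : (fun q => 1 / (q - z) * (1 / (q - a) ^ (k + 1 + 1))) =ᶠ[𝓝[≠] a] fun q =>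
        (z - a)⁻¹ * (1 / (q - z) * (1 / (q - a) ^ (k + 1)) + -1 * (1 / (q - a) ^ (k + 2))) := by
      filter_upwards [self_mem_nhdsWithin, nhdsWithin_le_nhds (isOpen_ne.mem_nhds hz.symm)]
        with q h1 h2
      have h3 : q - a ≠ 0 := sub_ne_zero.mpr h1
      have h4 : q - z ≠ 0 := sub_ne_zero.mpr h2
      field_simp
      ring
    rw [residue_congr ((MeromorphicAt.const _ _).fun_mul ((hm k).fun_add hm2)) e,
      residue_const_mul ((hm k).fun_add hm2), residue_add (hm k) hm2, ih,
      residue_const_mul (by fun_prop), residue_inv_pow]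
    field_simp
    ring

/-- The residue against the Cauchy kernel is, up to sign, the principal part. -/
lemma HasPolar.residue_cauchy {f : ℂ → ℂ} {a z : ℂ} {n : ℕ} {c : ℕ → ℂ} (h : HasPolar f a n c)
    (hz : z ≠ a) : residue (fun q => 1 / (q - z) * f q) a = -polar n c a z := by
  have hk : AnalyticAt ℂ (fun q => 1 / (q - z)) a :=
    AnalyticAt.fun_div (by fun_prop) (by fun_prop) (sub_ne_zero.mpr hz.symm)
  have hreg := (QuarticKontsevich.AnalyticAt.regularAt hk).mul h
  have hm : ∀ k : ℕ, MeromorphicAt (fun q => 1 / (q - z) * (1 / (q - a) ^ (k + 1))) a := by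
    intro k
    fun_prop
  have hm2 : ∀ k ∈ Finset.range n,
      MeromorphicAt (fun q => c k * (1 / (q - z) * (1 / (q - a) ^ (k + 1)))) a :=
    fun k _ => (MeromorphicAt.const _ _).fun_mul (hm k)
  have e : (fun q => 1 / (q - z) * f q) = fun q => 1 / (q - z) * (f q - polar n c a q) +
      ∑ k ∈ Finset.range n, c k * (1 / (q - z) * (1 / (q - a) ^ (k + 1))) := by
    funext q
    rw [mul_sub, polar, Finset.mul_sum, sub_add, eq_comm, sub_eq_self, ← Finset.sum_sub_distrib]
    exact Finset.sum_eq_zero fun k _ => by ring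
  rw [e, residue_add hreg.meromorphicAt (MeromorphicAt.fun_sum hm2), hreg.residue_eq,
    residue_sum hm2, zero_add, polar, ← Finset.sum_neg_distrib]
  refine Finset.sum_congr rfl fun k _ => ?_
  rw [residue_const_mul (hm k), residue_cauchy_pow hz]
  ring

lemma exists_eq_sub_mul {L : ℂ → ℂ} {b : ℂ} (hL : AnalyticAt ℂ L b) (h0 : L b = 0) :
    ∃ h, AnalyticAt ℂ h b ∧ ∀ z, L z = (z - b) * h z := by
  obtain ⟨p, hp⟩ := hL
  refine ⟨dslope L b, ⟨_, hp.has_fpower_series_dslope_fslope⟩, fun z => ?_⟩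
  have := sub_smul_dslope L b z
  rw [h0, sub_zero, smul_eq_mul] at this
  exact this.symm

namespace Model

variable {d : ℕ} {M : Model d} {α : Fin d → ℂ} {b : ℂ}

/-- The first summand of `E` differs from an even function, which has no residue, by a
derivative. -/
lemma residue_E_left : residue (fun q => M.U (-q) (-q) / (M.R q - M.R (-q)) ^ 3) 0 = 0 := by
  have hm := meromorphicAt_E_left (M := M)
  have h1 := residue_comp (f := fun q => M.U (-q) (-q) / (M.R q - M.R (-q)) ^ 3)
    (φ := fun q => -q) (a := 0) (by fun_prop) (by simp) (by rwa [neg_zero])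
  rw [neg_zero] at h1
  have hg := gen_zero (M := M)
  have m1 : MeromorphicAt (fun q => M.U q q) 0 :=
    (analyticAt_U analyticAt_id analyticAt_id hg.np hg.np).meromorphicAt
  have m2 := meromorphicAt_R (M := M) 0
  have m3 := meromorphicAt_R_neg (M := M) 0
  have m4 : MeromorphicAt (fun q => M.U q q / (M.R q - M.R (-q)) ^ 3) 0 := by fun_prop
  have e1 : (fun q => M.U (- -q) (- -q) / (M.R (-q) - M.R (- -q)) ^ 3 * deriv (fun q => -q) q) =
      fun q : ℂ => M.U q q / (M.R q - M.R (-q)) ^ 3 := by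
    funext q
    rw [neg_neg, ← neg_sub (M.R q), (hasDerivAt_neg q).deriv, Odd.neg_pow (by decide), div_neg,
      mul_neg_one, neg_neg]
  rw [e1] at h1
  -- the symmetrised function is a derivative
  have m5 : MeromorphicAt (fun q => -1 / (2 * (M.R q - M.R (-q)) ^ 2)) 0 := by fun_prop
  have e2 : (fun q => M.U q q / (M.R q - M.R (-q)) ^ 3 +
      M.U (-q) (-q) / (M.R q - M.R (-q)) ^ 3) =ᶠ[𝓝[≠] 0]
      deriv (fun q => -1 / (2 * (M.R q - M.R (-q)) ^ 2)) := by
    filter_upwards [eventually_generic_zero (M := M) fun _ => 0] with q hq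
    have hD := sub_ne_zero.mpr hq.D_ne
    have h3 := (hasDerivAt_const q (-1 : ℂ)).fun_div (((((hasDerivAt_R hq.np).fun_sub
      (hasDerivAt_R_neg hq.np_neg)).fun_pow 2).const_mul 2)) (mul_ne_zero two_ne_zero
      (pow_ne_zero 2 hD))
    rw [h3.deriv]
    field_simp
    ring
  have h2 := residue_add m4 hm
  rw [residue_congr m5.deriv e2, residue_deriv m5, h1] at h2
  linear_combination -h2 / 2

lemma G₀_neg {q : ℂ} (hq : M.Gen q) (hU : M.U q q ≠ 0) (hU' : M.U (-q) (-q) ≠ 0) :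
    M.G₀ (-q) = M.G₀ q := by
  have h1 := G₀_eq hq.neg (by rwa [neg_neg])
  rw [neg_neg] at h1
  rw [h1, div_eq_iff hU, G₀_mul_U hq hU']

/-- The second summand of `E` is even in `q`. -/
lemma residue_E_right : residue (fun q => M.S α (M.R q) * M.S α (M.R (-q)) *
    (M.R q + M.R (-q) - 2 * M.R 0) / ((M.R q - M.R (-q)) ^ 4 * M.G₀ q)) 0 = 0 := by
  have hm := meromorphicAt_E_right (M := M) (α := α)
  have h1 := residue_comp (f := fun q => M.S α (M.R q) * M.S α (M.R (-q)) *
    (M.R q + M.R (-q) - 2 * M.R 0) / ((M.R q - M.R (-q)) ^ 4 * M.G₀ q))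
    (φ := fun q => -q) (a := 0) (by fun_prop) (by simp) (by rwa [neg_zero])
  rw [neg_zero] at h1
  have e : (fun q => M.S α (M.R (-q)) * M.S α (M.R (- -q)) * (M.R (-q) + M.R (- -q) - 2 * M.R 0) /
      ((M.R (-q) - M.R (- -q)) ^ 4 * M.G₀ (-q)) * deriv (fun q => -q) q) =ᶠ[𝓝[≠] 0]
      fun q => -1 * (M.S α (M.R q) * M.S α (M.R (-q)) *
        (M.R q + M.R (-q) - 2 * M.R 0) / ((M.R q - M.R (-q)) ^ 4 * M.G₀ q)) := by
    filter_upwards [eventually_generic_zero (M := M) α] with q hq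
    rw [neg_neg, G₀_neg hq.toGen hq.U_ne hq.U_neg_ne, ← neg_sub (M.R q), (hasDerivAt_neg q).deriv,
      Even.neg_pow (by decide)]
    ring
  rw [residue_congr ((MeromorphicAt.const _ _).fun_mul hm) e, residue_const_mul hm] at h1
  linear_combination -h1 / 2

/-- The principal part of `E` at the origin. -/
lemma hasPolar_E (hα : M.IsFixedPointFamily α) :
    HasPolar (M.E α) 0 4 (fun k => if k = 3 then 0 else if k = 2 then 1 / (8 * deriv M.R 0 ^ 2)
      else if k = 1 then -iteratedDeriv 2 M.R 0 / (16 * deriv M.R 0 ^ 3) else 0) := by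
  have hg := gen_zero (M := M)
  have hU0 := U_zero_ne (M := M)
  have hR1 : deriv M.R 0 = M.U 0 0 := deriv_R hg.np
  have hR2 : iteratedDeriv 2 M.R 0 = -2 * M.Ξ 0 0 0 := by
    rw [iteratedDeriv_succ, iteratedDeriv_one, deriv_deriv_R hg.np]
  have hn : ¬ M.IsPole (-0) := by simpa using hg.np
  have hself := HasJet.sub_self (a := (0 : ℂ))
  have jU := HasJet.of_analyticAt (analyticAt_U_self_neg (M := M))
  rw [(hasDerivAt_U (M := M) (hasDerivAt_id' 0) (hasDerivAt_neg 0) hg.np hn).deriv] at jU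
  have jUn := HasJet.of_analyticAt (analyticAt_U_neg_neg (M := M))
  rw [(hasDerivAt_U (M := M) (hasDerivAt_neg 0) (hasDerivAt_neg 0) hn hn).deriv] at jUn
  have jR := HasJet.of_analyticAt (analyticAt_R hg.np)
  have jRn := HasJet.of_analyticAt (analyticAt_R_neg hn)
  rw [(hasDerivAt_R_neg hn).deriv, iteratedDeriv_comp_neg] at jRn
  have jSum := (jR.add jRn).sub (HasJet.const (a := 0) (2 * M.R 0))
  have jS := (HasJet.of_analyticAt (analyticAt_S_R (α := α) hg)).mul
    (HasJet.of_analyticAt (analyticAt_S_R_neg (α := α) hg))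
  have jG := HasJet.of_analyticAt (analyticAt_G₀_zero (M := M))
  simp only [neg_zero] at jU jUn jSum jS
  have hG := G₀_zero_ne hα
  have hS := G₀_zero_mul hα
  have j := (hself.mul (jUn.mul (((HasJet.const (a := 0) 8).mul (jU.mul (jU.mul jU))).inv
      (mul_ne_zero (by norm_num) (mul_ne_zero hU0 (mul_ne_zero hU0 hU0)))))).add
    ((jS.mul jSum).mul (((HasJet.const (a := 0) 16).mul (((jU.mul jU).mul (jU.mul jU)).mul jG)).inv
      (mul_ne_zero (by norm_num) (mul_ne_zero (mul_ne_zero (mul_ne_zero hU0 hU0)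
      (mul_ne_zero hU0 hU0)) hG))))
  have j' := j.congr (g := fun q => (q - 0) ^ 4 * M.E α q) (by
    filter_upwards [eventually_generic_zero (M := M) α, self_mem_nhdsWithin,
      nhdsWithin_le_nhds ((analyticAt_G₀_zero (M := M)).continuousAt.eventually_ne hG)]
      with q hq hq0 hGq
    have hq0' : q ≠ 0 := hq0
    have h1 := R_sub hq.np hq.np_neg
    have h2 : M.U q (-q) ≠ 0 := fun h => hq.D_ne (by
      rw [h, mul_zero, sub_eq_zero] at h1; exact h1)
    rw [E, h1, sub_zero]
    field_simp
    ring)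
  have hres : residue (M.E α) 0 = 0 := by
    have := residue_add (meromorphicAt_E_left (M := M)) (meromorphicAt_E_right (M := M) (α := α))
    rw [residue_E_left, residue_E_right, add_zero] at this
    exact this
  convert j'.hasPolar using 1
  funext k
  rw [hres, hR1, hR2]
  have hS' : M.S α (M.R 0) * M.S α (M.R 0) = M.G₀ 0 * M.U 0 0 := by rw [hS, sq]
  split_ifs
  · ring
  · field_simp
    ring
  · rw [hS']
    field_simp
    ring
  · rfl

end Model

namespace Model

variable {d : ℕ} {M : Model d} {α : Fin d → ℂ} {β : Fin (2 * d) → ℂ} {b : ℂ}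

/-! ### The form `ω_{1,1}` -/

/-- The residue formula projects the integrand to minus its principal part; the sign comes from
the kernel `dz / (q - z)`. -/
lemma contribution_eq {p z : ℂ} {n : ℕ} {c : ℕ → ℂ}
    (h : HasPolar (fun q => M.bracket α q / M.G₀ q) p n c) (hz : z ≠ p) :
    M.contribution α p z = -polar n c p z := by
  rw [contribution, ← h.residue_cauchy hz]
  congr 1
  funext q
  rw [← div_div, div_mul_eq_mul_div, mul_div_assoc]

lemma IsSheet.hasPolar_bracket (hα : M.IsFixedPointFamily α) (hb : M.Ram b) (hG : M.G₀ b ≠ 0)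
    {σ : ℂ → ℂ} (hσ : M.IsSheet b σ) {n : ℕ} {c : ℕ → ℂ} (hF : HasPolar (M.F σ) b n c) :
    HasPolar (fun q => M.bracket α q / M.G₀ q) b n c := by
  refine RegularAt.congr ((hσ.regularAt_bracket hα hb hG).add hF)
    (Eventually.of_forall fun q => ?_)
  ring

lemma contribution_ram (hα : M.IsFixedPointFamily α) (hb : M.Ram b) (hG : M.G₀ b ≠ 0) {z : ℂ}
    (hz : z ≠ b) :
    M.contribution α b z = 1 / (deriv M.R (-b) * iteratedDeriv 2 M.R b) *
      (-1 / (8 * (z - b) ^ 4) + M.xCoeff 1 b / (24 * (z - b) ^ 3) + 1 / (z - b) ^ 2 *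
        (M.xCoeff 2 b / 48 - M.xCoeff 1 b ^ 2 / 48 - M.xCoeff 1 b * M.yCoeff 1 b / 48 +
          M.yCoeff 2 b / 48 - 1 / (8 * b ^ 2))) := by
  obtain ⟨σ, hσ⟩ := exists_isSheet hb
  rw [contribution_eq (hσ.hasPolar_bracket hα hb hG (hσ.hasPolar_F hb)) hz]
  have : z - b ≠ 0 := sub_ne_zero.mpr hz
  simp only [polar, Finset.sum_range_succ, Finset.sum_range_zero]
  norm_num
  field_simp
  ring

lemma hasPolar_bracket_zero (hα : M.IsFixedPointFamily α) {n : ℕ} {c : ℕ → ℂ}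
    (hE : HasPolar (M.E α) 0 n c) : HasPolar (fun q => M.bracket α q / M.G₀ q) 0 n c := by
  refine RegularAt.congr ((regularAt_bracket_zero hα).add hE) (Eventually.of_forall fun q => ?_)
  ring

lemma holomorphicPart_eq (hα : M.IsFixedPointFamily α) {z : ℂ} (hz : z ≠ 0) :
    M.holomorphicPart α z = -1 / (8 * deriv M.R 0 ^ 2 * z ^ 3) +
      iteratedDeriv 2 M.R 0 / (16 * deriv M.R 0 ^ 3 * z ^ 2) := by
  rw [holomorphicPart, contribution_eq (hasPolar_bracket_zero hα (hasPolar_E hα)) hz]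
  have hR1 : deriv M.R 0 ≠ 0 := by
    rw [deriv_R gen_zero.np]
    exact U_zero_ne
  simp only [polar, Finset.sum_range_succ, Finset.sum_range_zero, sub_zero]
  norm_num
  field_simp

/-- Near a ramification point, `ω_{1,1}` is the sum of `-F` and a holomorphic function. -/
lemma regularAt_ω₁₁_add_F (hα : M.IsFixedPointFamily α) (hβ : M.IsRamificationFamily β)
    (hG : ∀ i, M.G₀ (β i) ≠ 0) (i : Fin (2 * d)) {σ : ℂ → ℂ} (hσ : M.IsSheet (β i) σ) :
    RegularAt (fun z => M.ω₁₁ α β z + M.F σ z) (β i) := by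
  have hpol : ∀ j, ∃ n c, HasPolar (fun q => M.bracket α q / M.G₀ q) (β j) n c := by
    intro j
    obtain ⟨τ, hτ⟩ := exists_isSheet (hβ.ram j)
    exact ⟨_, _, hτ.hasPolar_bracket hα (hβ.ram j) (hG j) (hτ.hasPolar_F (hβ.ram j))⟩
  have hF := hσ.hasPolar_F (hβ.ram i)
  have hB := hσ.hasPolar_bracket hα (hβ.ram i) (hG i) hF
  choose n c hc using hpol
  have hβ0 : β i ≠ 0 := (hβ.ram i).ne_of_im rfl
  have h1 : RegularAt (fun z => ∑ j ∈ Finset.univ.erase i, (-1) * polar (n j) (c j) (β j) z)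
      (β i) := by
    refine RegularAt.sum fun j hj => (RegularAt.const _).mul
      (QuarticKontsevich.AnalyticAt.regularAt (analyticAt_polar _ _ fun h => ?_))
    exact Finset.ne_of_mem_erase hj (hβ.1 h).symm
  have h2 := (QuarticKontsevich.AnalyticAt.regularAt (analyticAt_polar 4 (fun k => if k = 3 then 0
    else if k = 2 then 1 / (8 * deriv M.R 0 ^ 2)
      else if k = 1 then -iteratedDeriv 2 M.R 0 / (16 * deriv M.R 0 ^ 3) else 0) hβ0))
  refine ((RegularAt.add h1 hF).sub h2).congr ?_
  have hfin : ∀ j, ∀ᶠ t in 𝓝[≠] β i, t ≠ β j := by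
    intro j
    by_cases hj : j = i
    · rw [hj]; exact self_mem_nhdsWithin
    · exact nhdsWithin_le_nhds (isOpen_ne.mem_nhds fun h => hj (hβ.1 h).symm)
  filter_upwards [eventually_all.mpr hfin, nhdsWithin_le_nhds (isOpen_ne.mem_nhds hβ0)] with z h3 h4
  rw [ω₁₁, polarPart, holomorphicPart,
    contribution_eq (hasPolar_bracket_zero hα (hasPolar_E hα)) h4,
    ← Finset.add_sum_erase _ _ (Finset.mem_univ i), contribution_eq hB (h3 i),
    Finset.sum_congr rfl fun j _ => contribution_eq (hc j) (h3 j)]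
  simp only [neg_one_mul]
  ring

/-! ### The loop equations -/

/-- The linear loop equation follows from `F(σ(z)) σ'(z) = -F(z)`. -/
theorem linearLoopEquation (hα : M.IsFixedPointFamily α) (hβ : M.IsRamificationFamily β)
    (hG : ∀ i, M.G₀ (β i) ≠ 0) (i : Fin (2 * d)) {σ : ℂ → ℂ} (hσ : M.IsSheet (β i) σ) :
    LinearLoopEquation (M.ω₁₁ α β) (β i) σ := by
  have hb := hβ.ram i
  obtain ⟨k, hk, e⟩ := regularAt_ω₁₁_add_F hα hβ hG i hσ
  have hkσ : AnalyticAt ℂ (fun z => k (σ z)) (β i) :=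
    AnalyticAt.fun_comp (by rwa [hσ.map_self]) hσ.analyticAt
  obtain ⟨h, hh, hL⟩ := exists_eq_sub_mul (hk.fun_add (hkσ.fun_mul hσ.analyticAt.deriv))
    (by simp only [hσ.map_self, hσ.deriv_eq hb]; ring)
  refine ⟨h, hh, ?_⟩
  filter_upwards [e, (hσ.tendsto_punctured hb).eventually e, hσ.F_odd hb] with z e1 e2 e3
  rw [← hL z, ← e1, ← e2]
  linear_combination -e3

/-- The quadratic loop equation: `F` cancels `ω_{0,2}`, and in the rest a factor `R'(z)` meets a
function that vanishes at the ramification point. -/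
theorem quadraticLoopEquation (hα : M.IsFixedPointFamily α) (hβ : M.IsRamificationFamily β)
    (hG : ∀ i, M.G₀ (β i) ≠ 0) (i : Fin (2 * d)) {σ : ℂ → ℂ} (hσ : M.IsSheet (β i) σ) :
    QuadraticLoopEquation M.ω₀₁ ω₀₂ (M.ω₁₁ α β) (β i) σ := by
  have hb := hβ.ram i
  have hg := hb.gen
  obtain ⟨k, hk, e⟩ := regularAt_ω₁₁_add_F hα hβ hG i hσ
  have hkσ : AnalyticAt ℂ (fun z => k (σ z)) (β i) :=
    AnalyticAt.fun_comp (by rwa [hσ.map_self]) hσ.analyticAt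
  have hRn := analyticAt_R_neg hg.np_neg
  have hRσ : AnalyticAt ℂ (fun z => M.R (-σ z)) (β i) :=
    AnalyticAt.fun_comp (g := fun z => M.R (-z)) (by rwa [hσ.map_self]) hσ.analyticAt
  obtain ⟨h, hh, hL⟩ := exists_eq_sub_mul ((hRn.fun_mul (hkσ.fun_mul hσ.analyticAt.deriv)).fun_add
    (hRσ.fun_mul hk)) (by simp only [hσ.map_self, hσ.deriv_eq hb]; ring)
  obtain ⟨l, hl, hl'⟩ := exists_eq_sub_mul (analyticAt_R hg.np).deriv (hβ.2 i).2
  refine ⟨fun z => -(l z * h z), (hl.fun_mul hh).fun_neg, ?_⟩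
  filter_upwards [e, (hσ.tendsto_punctured hb).eventually e, hσ.F_odd hb,
    (hσ.tendsto_punctured hb).eventually hb.eventually_U_ne, hσ.eventually_R_neg_ne hb,
    nhdsWithin_le_nhds (hσ.eventually_deriv hb), nhdsWithin_le_nhds (hσ.eventually_not_isPole hb)]
    with z e1 e2 e3 e4 e5 e6 e7
  -- `F` is defined such that it cancels `ω_{0,2}` in the quadratic loop equation
  have e8 : M.F σ z * M.U (σ z) (σ z) * (M.R (-z) - M.R (-σ z)) = ω₀₂ z (σ z) := by
    rw [F]
    have := sub_ne_zero.mpr e5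
    field_simp
  have e9 := hL z
  have e10 := hl' z
  rw [← e1, ← e2] at e9
  rw [deriv_R e7.1, ← e6] at e10
  rw [ω₀₁, ω₀₁, y, y, deriv_R e7.1, deriv_R e7.2.2.1, ← e6]
  have e11 : (z - β i) ^ 2 * -(l z * h z) = -(((z - β i) * l z) * ((z - β i) * h z)) := by ring
  rw [e11, ← e9, ← e10, ← e8]
  linear_combination M.U (σ z) (σ z) * deriv σ z * M.R (-z) * e3

end Model

end QuarticKontsevich

end

theorem mainTheorem2 {d : ℕ} (M : QuarticKontsevich.Model d)
    (α : Fin d → ℂ) (hα : M.IsFixedPointFamily α)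
    (β : Fin (2 * d) → ℂ) (hβ : M.IsRamificationFamily β)
    (hG₀ : ∀ i, M.G₀ (β i) ≠ 0) :
    (∀ z : ℂ, (∀ i, z ≠ β i) →
      M.polarPart α β z =
        ∑ i, 1 / (deriv M.R (-β i) * iteratedDeriv 2 M.R (β i)) *
          (-1 / (8 * (z - β i) ^ 4) + M.xCoeff 1 (β i) / (24 * (z - β i) ^ 3) +
            1 / (z - β i) ^ 2 *
              (M.xCoeff 2 (β i) / 48 - M.xCoeff 1 (β i) ^ 2 / 48 -
                M.xCoeff 1 (β i) * M.yCoeff 1 (β i) / 48 + M.yCoeff 2 (β i) / 48 -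
                1 / (8 * β i ^ 2)))) ∧
    (∀ z : ℂ, z ≠ 0 →
      M.holomorphicPart α z =
        -1 / (8 * deriv M.R 0 ^ 2 * z ^ 3) +
          iteratedDeriv 2 M.R 0 / (16 * deriv M.R 0 ^ 3 * z ^ 2)) ∧
    (∀ (i : Fin (2 * d)) (σ : ℂ → ℂ),
      QuarticKontsevich.IsLocalGaloisInvolution M.R (β i) σ →
        QuarticKontsevich.LinearLoopEquation (M.ω₁₁ α β) (β i) σ ∧
        QuarticKontsevich.QuadraticLoopEquation M.ω₀₁ QuarticKontsevich.Model.ω₀₂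
          (M.ω₁₁ α β) (β i) σ) := by
  refine ⟨fun z hz => ?_, fun z hz => QuarticKontsevich.Model.holomorphicPart_eq hα hz,
    fun i σ hσ => ?_⟩
  · exact Finset.sum_congr rfl fun i _ =>
      QuarticKontsevich.Model.contribution_ram hα (hβ.ram i) (hG₀ i) (hz i)
  · have hs := QuarticKontsevich.Model.isSheet_of_involution (hβ.ram i) hσ
    exact ⟨QuarticKontsevich.Model.linearLoopEquation hα hβ hG₀ i hs,
      QuarticKontsevich.Model.quadraticLoopEquation hα hβ hG₀ i hs⟩
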